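/- All random variables take finitely many values, $H$ and $I$ denote entropy and (conditional) mutual information, and logarithms are natural (another base only rescales every quantity below). Let $X\to(Y,Z)$ be the binary skew-symmetric broadcast channel with parameter $p=\tfrac12$: all alphabets are $\{0,1\}$; given $X=0$, $Y$ is uniform and $Z=0$; given $X=1$, $Y=1$ and $Z$ is uniform. Let $\mathcal M\subset\mathbb R_{\ge 0}^2$ be Marton's inner bound (private messages) for this channel, i.e. the closure of the set of all rate pairs $(R_1,R_2)$ with $R_1,R_2\ge 0$ such that, for some triple $(U,V,W)$ with $(U,V,W)\to X\to(Y,Z)$, $$R_1<I(U,W;Y),\qquad R_2<I(V,W;Z),$$ $$R_1+R_2<\min\{I(W;Y),I(W;Z)\}+I(U;Y|W)+I(V;Z|W)-I(U;V|W).$$ Then for every real $\alpha\ge 1$: (i) for all $(U,V)$ with $(U,V)\to X\to(Y,Z)$, $$\alpha I(U;Y)+I(V;Z)-I(U;V)\le\max\{\alpha I(X;Y),\,I(X;Z)\},$$ and likewise, with the roles of $Y$ and $Z$ swapped, $$I(U;Y)+\alpha I(V;Z)-I(U;V)\le\max\{I(X;Y),\,\alpha I(X;Z)\};$$ (ii)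 the maxima below exist and $$\max_{(R_1,R_2)\in\mathcal M}\bigl(\alpha R_1+R_2\bigr)=\max_{p(w,x)}\Bigl(\min\{I(W;Y),I(W;Z)\}+(\alpha-1)I(W;Y)+\alpha\,\mathrm P(W=0)\,I(X;Y|W=0)+\mathrm P(W=1)\,I(X;Z|W=1)\Bigr),$$ where the maximum on the right is over all joint distributions of $(W,X)$ on $\{0,1\}\times\{0,1\}$, with $W\to X\to(Y,Z)$; (iii) with the roles of $Y$ and $Z$ swapped, $$\max_{(R_1,R_2)\in\mathcal M}\bigl(R_1+\alpha R_2\bigr)=\max_{p(w,x)}\Bigl(\min\{I(W;Y),I(W;Z)\}+(\alpha-1)I(W;Z)+\alpha\,\mathrm P(W=0)\,I(X;Z|W=0)+\mathrm P(W=1)\,I(X;Y|W=1)\Bigr),$$ with the same range of $p(w,x)$. -/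

import Mathlib

noncomputable section

namespace BC

/-- Shannon entropy (in nats) of a probability mass function on a finite set. -/
def entropy {β : Type*} [Fintype β] (p : β → ℝ) : ℝ := ∑ b, Real.negMulLog (p b)

open Classical in
/-- The law (probability mass function) of the random variable `f` on the finite probability space
with mass function `P`. -/
def law {Ω β : Type*} [Fintype Ω] (P : Ω → ℝ) (f : Ω → β) (b : β) : ℝ :=
  ∑ s, if f s = b then P s else 0

open Classical in
/-- The conditional mass function `P( · | f = b)`; it is identically `0` if `f = b` has
probability `0`. -/
def condOn {Ω β : Type*} [Fintype Ω] (P : Ω → ℝ) (f : Ω → β) (b : β) (s : Ω) : ℝ :=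
  if f s = b then P s / law P f b else 0

/-- `H(f)`. -/
def H {Ω β : Type*} [Fintype Ω] [Fintype β] (P : Ω → ℝ) (f : Ω → β) : ℝ := entropy (law P f)

/-- Mutual information `I(f; g) = H(f) + H(g) - H(f, g)`. -/
def I {Ω β γ : Type*} [Fintype Ω] [Fintype β] [Fintype γ]
    (P : Ω → ℝ) (f : Ω → β) (g : Ω → γ) : ℝ :=
  H P f + H P g - H P (fun s => (f s, g s))

/-- Conditional mutual information
`I(f; g | h) = H(f, h) + H(g, h) - H(f, g, h) - H(h)`. -/
def condI {Ω β γ δ : Type*} [Fintype Ω] [Fintype β] [Fintype γ] [Fintype δ]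
    (P : Ω → ℝ) (f : Ω → β) (g : Ω → γ) (h : Ω → δ) : ℝ :=
  H P (fun s => (f s, h s)) + H P (fun s => (g s, h s)) - H P (fun s => (f s, g s, h s)) - H P h

/-- Given a broadcast channel `q(y, z | x)` and a joint mass function `p(a, x)` of an auxiliary
variable `A` and the input `X`, the joint mass function `p(a, x) q(y, z | x)` of `(A, X, Y, Z)`, so
that `A → X → (Y, Z)`. -/
def joint {𝒜 𝒳 𝒴 𝒵 : Type*} (q : 𝒳 → 𝒴 × 𝒵 → ℝ) (p : 𝒜 × 𝒳 → ℝ) (s : 𝒜 × 𝒳 × 𝒴 × 𝒵) : ℝ :=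
  p (s.1, s.2.1) * q s.2.1 s.2.2

/-- The auxiliary variable as a random variable on the sample space of `joint`. -/
def aux {𝒜 𝒳 𝒴 𝒵 : Type*} (s : 𝒜 × 𝒳 × 𝒴 × 𝒵) : 𝒜 := s.1

/-- The channel input as a random variable on the sample space of `joint`. -/
def inX {𝒜 𝒳 𝒴 𝒵 : Type*} (s : 𝒜 × 𝒳 × 𝒴 × 𝒵) : 𝒳 := s.2.1

/-- The first channel output as a random variable on the sample space of `joint`. -/
def outY {𝒜 𝒳 𝒴 𝒵 : Type*} (s : 𝒜 × 𝒳 × 𝒴 × 𝒵) : 𝒴 := s.2.2.1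

/-- The second channel output as a random variable on the sample space of `joint`. -/
def outZ {𝒜 𝒳 𝒴 𝒵 : Type*} (s : 𝒜 × 𝒳 × 𝒴 × 𝒵) : 𝒵 := s.2.2.2

/-- Transition matrix of the component `X → Y` of the binary skew-symmetric broadcast channel with
`p = 1/2`: the input `0` gives a uniform output, the input `1` gives the output `1`. -/
def bsscY (x y : Fin 2) : ℝ := if x = 0 then 1 / 2 else if y = 1 then 1 else 0

/-- Transition matrix of the component `X → Z` of the binary skew-symmetric broadcast channel with
`p = 1/2`: the input `0` gives the output `0`, the input `1` gives a uniform output. -/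
def bsscZ (x z : Fin 2) : ℝ := if x = 1 then 1 / 2 else if z = 0 then 1 else 0

/-- The binary skew-symmetric broadcast channel with `p = 1/2`. For every input one of the two
outputs is deterministic, so this is the only `q(y, z | x)` with the marginals `bsscY`, `bsscZ`. -/
def bssc (x : Fin 2) (yz : Fin 2 × Fin 2) : ℝ := bsscY x yz.1 * bsscZ x yz.2

/-- The rate pairs satisfying the strict inequalities of Marton's inner bound for some triple
`(U, V, W)` of finite-valued random variables with `(U, V, W) → X → (Y, Z)`. -/
def martonRates {𝒳 𝒴 𝒵 : Type*} [Fintype 𝒳] [Fintype 𝒴] [Fintype 𝒵]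
    (q : 𝒳 → 𝒴 × 𝒵 → ℝ) : Set (ℝ × ℝ) :=
  {R | 0 ≤ R.1 ∧ 0 ≤ R.2 ∧
    ∃ (k l m : ℕ), ∃ p ∈ stdSimplex ℝ ((Fin k × Fin l × Fin m) × 𝒳),
      R.1 < I (joint q p) (fun s => ((aux s).1, (aux s).2.2)) outY ∧
      R.2 < I (joint q p) (fun s => ((aux s).2.1, (aux s).2.2)) outZ ∧
      R.1 + R.2 <
        min (I (joint q p) (fun s => (aux s).2.2) outY) (I (joint q p) (fun s => (aux s).2.2) outZ)
          + condI (joint q p) (fun s => (aux s).1) outY (fun s => (aux s).2.2)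
          + condI (joint q p) (fun s => (aux s).2.1) outZ (fun s => (aux s).2.2)
          - condI (joint q p) (fun s => (aux s).1) (fun s => (aux s).2.1) (fun s => (aux s).2.2)}

/-- Marton's inner bound: the closure of the union of the rate pairs above. -/
def martonRegion {𝒳 𝒴 𝒵 : Type*} [Fintype 𝒳] [Fintype 𝒴] [Fintype 𝒵]
    (q : 𝒳 → 𝒴 × 𝒵 → ℝ) : Set (ℝ × ℝ) := closure (martonRates q)

end BC

end

noncomputable section

namespace BC

open Real Set

/-! Entropies are written with unnormalized masses: `s` and `t` are the masses of the inputs 0 and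
1, and `outEnt s t` is homogeneous of degree one. Conditioning on an auxiliary variable is then a
sum over atoms, and concavity is superadditivity. Exchanging the inputs exchanges the receivers, so
only the form with weight `α` on `Y` needs an argument.

Inequality (i). Let x = P(X = 0). With p(v,x|u) held fixed, the left side is a function of the law
of X, plus a linear function of the law of U, minus H(V,Z); it is therefore convex under the two
linear constraints that fix the input masses, and two values of U suffice
(`exists_card_support_le_two`). For two values, the part depending on V is a sum over v of a
homogeneous function of four masses, and a linear majorant of that function bounds the whole sum
(`negMulLog_add_le`, `dualBound`). `exists_dualBound_le` chooses the majorant. In one regime it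
corresponds to V = X, where what remains is α I(U;Y) ≤ I(U;X), a tangent inequality for h(y) - α
h(y/2) with h the binary entropy. In the other regime the majorants form a family with one parameter
θ. For fixed θ the bound is convex along the segment of splits on which the majorant is exact, so it
is enough to check the two ends: one is again V = X, and at the other a value of U determines X.
That leaves the functions `edgeOne` and `edgeTwo` of one variable, whose maxima are the end values α
I(X;Y) and I(X;Z).

The analytic conditions behind these steps are collected in `Balanced`. They hold for α = 1, x ≤
1/2, and for x ≥ 1/2 when α I(X;Y) = I(X;Z). This is enough, because the left side is affine in α
with slope I(U;Y) between 0 and I(X;Y) (`sumRate_le_of_sum_eq_one`).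

Maximum (ii). Write αR₁ + R₂ as (α - 1)R₁ + (R₁ + R₂), expand by the chain rule, and apply (i) given
each W = w: each w serves one receiver only. Replace the minimum by a convex combination with
parameter l. The gains from serving Y and from serving Z are each concave on one cone of masses and
convex on the complement, and they agree at pure inputs. A point in the convex part of one gain
therefore splits into a point of its concave part and a pure point, which is handed to the other
gain; merging the concave parts leaves two values of W (`exists_split_sum`). A connectedness
argument in l then gives a saddle point (`exists_tdRate_eq_lagr`). Conversely U = X when W = 0 and V
= X when W = 1 achieves the value, unless the sum rate bound is below I(U,W;Y); then serving Y alone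
does at least as well (`exists_tdRate_le`). -/

/-! ### Output entropies as homogeneous functions of the input masses -/

/-- For an input law with masses `s` at `0` and `t` at `1`, the total mass times `H(Y)`; the
corresponding quantity for `Z` is `outEnt t s`. -/
def outEnt (s t : ℝ) : ℝ := negMulLog (s / 2) + negMulLog (s / 2 + t) - negMulLog (s + t)

/-- The total mass times the entropy of the input with masses `s` and `t`. -/
def inEnt (s t : ℝ) : ℝ := negMulLog s + negMulLog t - negMulLog (s + t)

@[fun_prop] lemma continuous_outEnt {X : Type*} [TopologicalSpace X] {f g : X → ℝ}
    (hf : Continuous f) (hg : Continuous g) : Continuous fun x => outEnt (f x) (g x) := by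
  unfold outEnt; fun_prop

lemma outEnt_smul (c s t : ℝ) : outEnt (c * s) (c * t) = c * outEnt s t := by
  have h1 : c * s / 2 = c * (s / 2) := by ring
  have h2 : c * (s / 2) + c * t = c * (s / 2 + t) := by ring
  have h3 : c * s + c * t = c * (s + t) := by ring
  simp only [outEnt, h1, h2, h3, negMulLog_mul]; ring

lemma inEnt_smul (c s t : ℝ) : inEnt (c * s) (c * t) = c * inEnt s t := by
  have h3 : c * s + c * t = c * (s + t) := by ring
  simp only [inEnt, h3, negMulLog_mul]; ring

@[simp] lemma outEnt_zero_left (t : ℝ) : outEnt 0 t = 0 := by simp [outEnt]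

@[simp] lemma outEnt_zero_right (s : ℝ) : outEnt s 0 = s * log 2 := by
  rcases eq_or_ne s 0 with rfl | hs
  · simp
  · simp only [outEnt, add_zero, negMulLog, log_div hs two_ne_zero]; ring

@[simp] lemma inEnt_zero_left (t : ℝ) : inEnt 0 t = 0 := by simp [inEnt]

lemma outEnt_of_add_eq_one {y z : ℝ} (h : y + z = 1) : outEnt y z = binEntropy (y / 2) := by
  have : y / 2 + z = 1 - y / 2 := by linarith
  simp [outEnt, h, this, binEntropy_eq_negMulLog_add_negMulLog_one_sub]

lemma inEnt_of_add_eq_one {y z : ℝ} (h : y + z = 1) : inEnt y z = binEntropy y := by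
  have : z = 1 - y := by linarith
  simp [inEnt, this, binEntropy_eq_negMulLog_add_negMulLog_one_sub]

/-- A combination of the entropies of input and outputs as a function of the probability of the
input `0`. -/
def mixEnt (c A B y : ℝ) : ℝ :=
  c * binEntropy y + A * binEntropy (y / 2) + B * binEntropy ((1 - y) / 2)

/-- The derivative of `mixEnt`. -/
def mixEnt' (c A B y : ℝ) : ℝ :=
  c * (log (1 - y) - log y) + A / 2 * (log (2 - y) - log y) - B / 2 * (log (1 + y) - log (1 - y))

@[fun_prop] lemma continuous_mixEnt (c A B : ℝ) : Continuous (mixEnt c A B) := by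
  unfold mixEnt; fun_prop

lemma hasDerivAt_mixEnt (c A B : ℝ) {y : ℝ} (h0 : 0 < y) (h1 : y < 1) :
    HasDerivAt (mixEnt c A B) (mixEnt' c A B y) y := by
  have e1 := (hasDerivAt_binEntropy h0.ne' h1.ne).const_mul c
  have e2 := ((hasDerivAt_binEntropy (p := y / 2) (by positivity) (by linarith)).comp y
    ((hasDerivAt_id y).div_const 2)).const_mul A
  have e3 := ((hasDerivAt_binEntropy (p := (1 - y) / 2) (by linarith) (by linarith)).comp y
    (((hasDerivAt_id y).const_sub 1).div_const 2)).const_mul B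
  have l1 : log (1 - y / 2) = log (2 - y) - log 2 := by
    rw [← log_div (by linarith) two_ne_zero]; ring_nf
  have l2 : log (y / 2) = log y - log 2 := log_div h0.ne' two_ne_zero
  have l3 : log (1 - (1 - y) / 2) = log (1 + y) - log 2 := by
    rw [← log_div (by linarith) two_ne_zero]; ring_nf
  have l4 : log ((1 - y) / 2) = log (1 - y) - log 2 := log_div (by linarith) two_ne_zero
  refine ((e1.add e2).add e3).congr_deriv ?_
  simp only [l1, l2, l3, l4, mixEnt']
  ring

lemma hasDerivAt_mixEnt' (c A B : ℝ) {y : ℝ} (h0 : 0 < y) (h1 : y < 1) :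
    HasDerivAt (mixEnt' c A B)
      (-(c / (y * (1 - y)) + A / (y * (2 - y)) + B / ((1 - y) * (1 + y)))) y := by
  have d1 := ((hasDerivAt_id y).const_sub 1).log (x := y) (by simp; linarith)
  have d2 := (hasDerivAt_id y).log (x := y) h0.ne'
  have d3 := ((hasDerivAt_id y).const_sub 2).log (x := y) (by simp; linarith)
  have d4 := ((hasDerivAt_id y).const_add 1).log (x := y) (by simp; linarith)
  refine ((((d1.sub d2).const_mul c).add ((d3.sub d2).const_mul (A / 2))).sub
    ((d4.sub d1).const_mul (B / 2))).congr_deriv ?_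
  have : 1 - y ≠ 0 := by linarith
  have : 2 - y ≠ 0 := by linarith
  simp only [id]
  field_simp
  ring

lemma concaveOn_mixEnt {c A B lo hi : ℝ} (hlo : 0 ≤ lo) (hhi : hi ≤ 1)
    (h : ∀ y ∈ Ioo lo hi, 0 ≤ c / (y * (1 - y)) + A / (y * (2 - y)) + B / ((1 - y) * (1 + y))) :
    ConcaveOn ℝ (Icc lo hi) (mixEnt c A B) := by
  refine concaveOn_of_hasDerivWithinAt2_nonpos (convex_Icc _ _)
    (continuous_mixEnt c A B).continuousOn (f' := mixEnt' c A B)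
    (f'' := fun y => -(c / (y * (1 - y)) + A / (y * (2 - y)) + B / ((1 - y) * (1 + y)))) ?_ ?_ ?_
  all_goals
    intro y hy
    rw [interior_Icc] at hy
  · exact (hasDerivAt_mixEnt c A B (hlo.trans_lt hy.1) (hy.2.trans_le hhi)).hasDerivWithinAt
  · exact (hasDerivAt_mixEnt' c A B (hlo.trans_lt hy.1) (hy.2.trans_le hhi)).hasDerivWithinAt
  · exact neg_nonpos.2 (h y hy)

lemma mixEnt_neg (c A B y : ℝ) : mixEnt (-c) (-A) (-B) y = -mixEnt c A B y := by
  simp only [mixEnt]; ring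

lemma convexOn_mixEnt {c A B lo hi : ℝ} (hlo : 0 ≤ lo) (hhi : hi ≤ 1)
    (h : ∀ y ∈ Ioo lo hi, c / (y * (1 - y)) + A / (y * (2 - y)) + B / ((1 - y) * (1 + y)) ≤ 0) :
    ConvexOn ℝ (Icc lo hi) (mixEnt c A B) := by
  have := (concaveOn_mixEnt (c := -c) (A := -A) (B := -B) hlo hhi (fun y hy => by
    have := h y hy
    rw [neg_div, neg_div, neg_div]; linarith)).neg
  refine this.congr fun y _ => ?_
  simp [mixEnt_neg]

/-- The perspective of `mixEnt`: the same combination for unnormalized input masses. -/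
lemma mixEnt_persp (c A B : ℝ) {s t : ℝ} (hs : 0 ≤ s) (ht : 0 ≤ t) :
    c * inEnt s t + A * outEnt s t + B * outEnt t s = (s + t) * mixEnt c A B (s / (s + t)) := by
  rcases (add_nonneg hs ht).eq_or_lt with h | h
  · have h1 : s = 0 := by linarith
    have h2 : t = 0 := by linarith
    simp [h1, h2]
  · have e1 : s = (s + t) * (s / (s + t)) := by field_simp
    have e2 : t = (s + t) * (t / (s + t)) := by field_simp
    have e3 : s / (s + t) + t / (s + t) = 1 := by field_simp
    have e4 : t / (s + t) = 1 - s / (s + t) := by linarith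
    have k1 : inEnt s t = (s + t) * binEntropy (s / (s + t)) := by
      rw [← inEnt_of_add_eq_one e3, ← inEnt_smul, ← e1, ← e2]
    have k2 : outEnt s t = (s + t) * binEntropy (s / (s + t) / 2) := by
      rw [← outEnt_of_add_eq_one e3, ← outEnt_smul, ← e1, ← e2]
    have k3 : outEnt t s = (s + t) * binEntropy ((1 - s / (s + t)) / 2) := by
      rw [← e4, ← outEnt_of_add_eq_one ((add_comm _ _).trans e3), ← outEnt_smul, ← e1, ← e2]
    rw [k1, k2, k3, mixEnt]; ring

/-- The perspective of a concave function is superadditive. The bounds `lo` and `hi` keep both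
proportions of input 0 in the interval of concavity, so the lemma also serves functions that are
concave on part of [0,1] only. -/
lemma mixEnt_superadd {c A B lo hi : ℝ} (hf : ConcaveOn ℝ (Icc lo hi) (mixEnt c A B))
    {s t s' t' : ℝ} (hs : 0 ≤ s) (ht : 0 ≤ t) (hs' : 0 ≤ s') (ht' : 0 ≤ t')
    (h1 : lo * (s + t) ≤ s) (h2 : s ≤ hi * (s + t))
    (h1' : lo * (s' + t') ≤ s') (h2' : s' ≤ hi * (s' + t')) :
    (c * inEnt s t + A * outEnt s t + B * outEnt t s)
      + (c * inEnt s' t' + A * outEnt s' t' + B * outEnt t' s')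
      ≤ c * inEnt (s + s') (t + t') + A * outEnt (s + s') (t + t')
        + B * outEnt (t + t') (s + s') := by
  rcases (add_nonneg hs ht).eq_or_lt with h | h
  · have h3 : s = 0 := by linarith
    have h4 : t = 0 := by linarith
    simp [h3, h4]
  rcases (add_nonneg hs' ht').eq_or_lt with h' | h'
  · have h3 : s' = 0 := by linarith
    have h4 : t' = 0 := by linarith
    simp [h3, h4]
  rw [mixEnt_persp c A B hs ht, mixEnt_persp c A B hs' ht',
    mixEnt_persp c A B (add_nonneg hs hs') (add_nonneg ht ht')]
  have hM : 0 < s + t + (s' + t') := by linarith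
  have m1 : s / (s + t) ∈ Icc lo hi := ⟨(le_div_iff₀ h).2 h1, (div_le_iff₀ h).2 h2⟩
  have m2 : s' / (s' + t') ∈ Icc lo hi := ⟨(le_div_iff₀ h').2 h1', (div_le_iff₀ h').2 h2'⟩
  have w1 : 0 ≤ (s + t) / (s + t + (s' + t')) := by positivity
  have w2 : 0 ≤ (s' + t') / (s + t + (s' + t')) := by positivity
  have key := hf.2 m1 m2 w1 w2 (by field_simp)
  have e : ((s + t) / (s + t + (s' + t'))) • (s / (s + t))
      + ((s' + t') / (s + t + (s' + t'))) • (s' / (s' + t')) = (s + s') / (s + t + (s' + t')) := by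
    simp only [smul_eq_mul]; field_simp
  rw [e] at key
  have e2 : s + s' + (t + t') = s + t + (s' + t') := by ring
  rw [e2]
  simp only [smul_eq_mul] at key
  have := mul_le_mul_of_nonneg_left key hM.le
  refine le_trans (le_of_eq ?_) this
  field_simp

lemma mixEnt_subadd {c A B lo hi : ℝ} (hf : ConvexOn ℝ (Icc lo hi) (mixEnt c A B))
    {s t s' t' : ℝ} (hs : 0 ≤ s) (ht : 0 ≤ t) (hs' : 0 ≤ s') (ht' : 0 ≤ t')
    (h1 : lo * (s + t) ≤ s) (h2 : s ≤ hi * (s + t))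
    (h1' : lo * (s' + t') ≤ s') (h2' : s' ≤ hi * (s' + t')) :
    c * inEnt (s + s') (t + t') + A * outEnt (s + s') (t + t') + B * outEnt (t + t') (s + s')
      ≤ (c * inEnt s t + A * outEnt s t + B * outEnt t s)
        + (c * inEnt s' t' + A * outEnt s' t' + B * outEnt t' s') := by
  have hf' : ConcaveOn ℝ (Icc lo hi) (mixEnt (-c) (-A) (-B)) :=
    hf.neg.congr fun y _ => by simp [mixEnt_neg]
  have := mixEnt_superadd hf' hs ht hs' ht' h1 h2 h1' h2'
  linarith

lemma outEnt_superadd {s t s' t' : ℝ} (hs : 0 ≤ s) (ht : 0 ≤ t) (hs' : 0 ≤ s') (ht' : 0 ≤ t') :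
    outEnt s t + outEnt s' t' ≤ outEnt (s + s') (t + t') := by
  have hf : ConcaveOn ℝ (Icc 0 1) (mixEnt 0 1 0) := concaveOn_mixEnt le_rfl le_rfl fun y hy => by
    have h1 := hy.1
    have : 0 < 2 - y := by linarith [hy.2]
    simp only [zero_div, zero_add, add_zero]
    positivity
  have := mixEnt_superadd hf hs ht hs' ht' (by simpa using hs) (by linarith)
    (by simpa using hs') (by linarith)
  simpa using this

lemma sum_outEnt_le {ι : Type*} (A : Finset ι) {s t : ι → ℝ} (hs : ∀ i, 0 ≤ s i)
    (ht : ∀ i, 0 ≤ t i) :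
    ∑ i ∈ A, outEnt (s i) (t i) ≤ outEnt (∑ i ∈ A, s i) (∑ i ∈ A, t i) := by
  classical
  induction A using Finset.induction_on with
  | empty => simp
  | insert a A ha ih =>
    rw [Finset.sum_insert ha, Finset.sum_insert ha, Finset.sum_insert ha]
    exact (add_le_add_right ih _).trans (outEnt_superadd (hs a) (ht a)
      (Finset.sum_nonneg fun i _ => hs i) (Finset.sum_nonneg fun i _ => ht i))

/-- Only input 0 makes `Y` noisy, so `s * log 2` is the mass times H(Y|X), and the difference of the
two sides is the mass times I(X;Y). -/
lemma mul_log_two_le_outEnt {s t : ℝ} (hs : 0 ≤ s) (ht : 0 ≤ t) : s * log 2 ≤ outEnt s t := by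
  simpa using outEnt_superadd hs le_rfl le_rfl ht

lemma mul_log_two_lt_outEnt {s t : ℝ} (hs : 0 < s) (ht : 0 < t) : s * log 2 < outEnt s t := by
  have hm : 0 < s + t := by positivity
  have h1 : outEnt s t = (s + t) * binEntropy (s / (s + t) / 2) := by
    simpa [mixEnt] using mixEnt_persp 0 1 0 hs.le ht.le
  have hy0 : 0 < s / (s + t) := by positivity
  have hy1 : s / (s + t) < 1 := (div_lt_one hm).2 (by linarith)
  have m0 : (0 : ℝ) ∈ Icc 0 1 := by norm_num
  have m1 : (2⁻¹ : ℝ) ∈ Icc 0 1 := by norm_num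
  have h2 := strictConcave_binEntropy.2 m0 m1 (by norm_num) (sub_pos.2 hy1) hy0 (by ring)
  simp only [binEntropy_zero, binEntropy_two_inv, smul_eq_mul, mul_zero, zero_add] at h2
  rw [h1, div_eq_mul_inv _ (2 : ℝ)]
  calc s * log 2 = (s + t) * (s / (s + t) * log 2) := by field_simp
    _ < _ := mul_lt_mul_of_pos_left h2 hm

/-! ### The tangent inequality behind the case V = X -/

/-- The function h(y) - α h(y/2) is convex up to an inflection point `r` and concave after it. By
`ha` the point `x` lies in the concave part, so the tangent at `x` is above the function there; on
the convex part it is enough to compare at the ends 0 and `r`. -/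
lemma mixEnt_tangent {α x : ℝ} (hα : 1 ≤ α) (h0 : 0 < x) (h1 : x < 1)
    (ha : α * (1 - x) ≤ 2 - x) (hb : log (1 - x) ≤ α * log (1 - x / 2)) {y : ℝ} (hy : y ∈ Icc (0 : ℝ) 1) :
    mixEnt 1 (-α) 0 y ≤ mixEnt 1 (-α) 0 x + mixEnt' 1 (-α) 0 x * (y - x) := by
  set f := mixEnt 1 (-α) 0
  set f' := mixEnt' 1 (-α) 0 x
  -- The second derivative has the sign of α(1 - y) - (2 - y), which vanishes at (α - 2)/(α - 1);
  -- for α ≤ 2 the function is concave throughout.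
  obtain ⟨r, hr0, hrx, hr1, hr2⟩ : ∃ r, 0 ≤ r ∧ r ≤ x ∧ (∀ y, r ≤ y → α * (1 - y) ≤ 2 - y) ∧
      ∀ y, 0 < y → y < r → 2 - y ≤ α * (1 - y) := by
    rcases le_or_gt α 2 with h | h
    · refine ⟨0, le_rfl, h0.le, fun y hy => by nlinarith, fun y hy hy' => by linarith⟩
    · refine ⟨(α - 2) / (α - 1), div_nonneg (by linarith) (by linarith), ?_, fun y hy => ?_,
        fun y _ hy => ?_⟩
      · rw [div_le_iff₀ (by linarith)]; linarith
      · rw [div_le_iff₀ (by linarith)] at hy; linarith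
      · rw [lt_div_iff₀ (by linarith)] at hy; linarith
  have key : ∀ y, 0 < y → y < 1 → 1 / (y * (1 - y)) + -α / (y * (2 - y)) + 0 / ((1 - y) * (1 + y))
      = (2 - y - α * (1 - y)) / (y * (1 - y) * (2 - y)) := fun y hy0 hy1 => by
    have : 1 - y ≠ 0 := by linarith
    have : 2 - y ≠ 0 := by linarith
    simp only [zero_div, add_zero]
    field_simp
    ring
  have hconc : ConcaveOn ℝ (Icc r 1) f := concaveOn_mixEnt hr0 le_rfl fun y hy => by
    have := hr1 y hy.1.le
    have h3 : 0 < y := hr0.trans_lt hy.1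
    have h4 : 0 < 1 - y := by linarith [hy.2]
    have h5 : 0 < 2 - y := by linarith
    rw [key y h3 hy.2]
    exact div_nonneg (by linarith) (by positivity)
  have hder : HasDerivAt f f' x := hasDerivAt_mixEnt 1 (-α) 0 h0 h1
  have hright : ∀ y ∈ Icc r 1, f y ≤ f x + f' * (y - x) := fun y hy => by
    rcases lt_trichotomy y x with h | h | h
    · have := hconc.le_slope_of_hasDerivAt hy ⟨hrx, h1.le⟩ h hder
      rw [slope_def_field, le_div_iff₀ (by linarith)] at this
      linarith
    · simp [h]
    · have := hconc.slope_le_of_hasDerivAt ⟨hrx, h1.le⟩ hy h hder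
      rw [slope_def_field, div_le_iff₀ (by linarith)] at this
      linarith
  rcases le_or_gt r y with h | h
  · exact hright y ⟨h, hy.2⟩
  have hconv : ConvexOn ℝ (Icc 0 r) f := convexOn_mixEnt le_rfl (hrx.trans h1.le) fun y hy => by
    have := hr2 y hy.1 hy.2
    have h4 : 0 < 1 - y := by linarith [hy.2]
    have h5 : 0 < 2 - y := by linarith
    have h6 := hy.1
    rw [key y hy.1 (by linarith)]
    exact div_nonpos_of_nonpos_of_nonneg (by linarith) (by positivity)
  have hr : 0 < r := hy.1.trans_lt h
  -- At 0 the tangent inequality reduces exactly to `hb`.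
  have hf0 : f 0 ≤ f x + f' * (0 - x) := by
    have l1 : log (1 - x / 2) = log (2 - x) - log 2 := by
      rw [← log_div (by linarith) two_ne_zero]; ring_nf
    have l2 : log (x / 2) = log x - log 2 := log_div h0.ne' two_ne_zero
    have e0 : f 0 = 0 := by simp [f, mixEnt]
    rw [e0]
    simp only [f, f', mixEnt, mixEnt', binEntropy, log_inv, l1, l2] at hb ⊢
    linarith
  have hfr := hright r ⟨le_rfl, hrx.trans h1.le⟩
  have h0m : (0 : ℝ) ∈ Icc 0 r := ⟨le_rfl, hr.le⟩
  have hrm : r ∈ Icc 0 r := ⟨hr.le, le_rfl⟩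
  have w1 : 0 ≤ 1 - y / r := by rw [sub_nonneg, div_le_one hr]; exact h.le
  have w2 : 0 ≤ y / r := div_nonneg hy.1 hr.le
  have := hconv.2 h0m hrm w1 w2 (by ring)
  simp only [smul_eq_mul, mul_zero, zero_add, div_mul_cancel₀ _ hr.ne'] at this
  calc f y ≤ _ := this
    _ ≤ (1 - y / r) * (f x + f' * (0 - x)) + y / r * (f x + f' * (r - x)) := by gcongr
    _ = f x + f' * (y / r * r - x) := by ring
    _ = _ := by rw [div_mul_cancel₀ _ hr.ne']

/-- If the binary variable is the input degraded, its information about the input dominates. -/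
lemma inEnt_sub_outEnt_add_le {α x : ℝ} (hα : 1 ≤ α) (h0 : 0 < x) (h1 : x < 1)
    (ha : α * (1 - x) ≤ 2 - x) (hb : log (1 - x) ≤ α * log (1 - x / 2)) {d₁ a₁ d₂ a₂ : ℝ}
    (hd₁ : 0 ≤ d₁) (ha₁ : 0 ≤ a₁) (hd₂ : 0 ≤ d₂) (ha₂ : 0 ≤ a₂) (hx : d₁ + d₂ = x)
    (hx' : a₁ + a₂ = 1 - x) :
    (inEnt d₁ a₁ - α * outEnt d₁ a₁) + (inEnt d₂ a₂ - α * outEnt d₂ a₂)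
      ≤ inEnt x (1 - x) - α * outEnt x (1 - x) := by
  have key : ∀ s t : ℝ, 0 ≤ s → 0 ≤ t → inEnt s t - α * outEnt s t ≤
      (s + t) * mixEnt 1 (-α) 0 x + mixEnt' 1 (-α) 0 x * (s - (s + t) * x) := fun s t hs ht => by
    have e := mixEnt_persp 1 (-α) 0 hs ht
    rcases (add_nonneg hs ht).eq_or_lt with h | h
    · have h3 : s = 0 := by linarith
      have h4 : t = 0 := by linarith
      simp [h3, h4]
    have := mixEnt_tangent hα h0 h1 ha hb (y := s / (s + t))
      ⟨by positivity, (div_le_one h).2 (by linarith)⟩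
    have := mul_le_mul_of_nonneg_left this h.le
    have e2 : (s + t) * (s / (s + t)) = s := by field_simp
    calc _ = (s + t) * mixEnt 1 (-α) 0 (s / (s + t)) := by rw [← e]; ring
      _ ≤ _ := this
      _ = (s + t) * mixEnt 1 (-α) 0 x
          + mixEnt' 1 (-α) 0 x * ((s + t) * (s / (s + t)) - (s + t) * x) := by ring
      _ = _ := by rw [e2]
  have e : inEnt x (1 - x) - α * outEnt x (1 - x) = mixEnt 1 (-α) 0 x := by
    have := mixEnt_persp 1 (-α) 0 h0.le (sub_nonneg.2 h1.le)
    simp only [add_sub_cancel, div_one, one_mul, zero_mul, add_zero] at this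
    linarith
  -- The slope terms of the two atoms cancel, since together they have mass one and mass `x` at
  -- input 0.
  have k1 := key d₁ a₁ hd₁ ha₁
  have k2 := key d₂ a₂ hd₂ ha₂
  rw [e]
  have : d₂ = x - d₁ := by linarith
  have : a₂ = 1 - x - a₁ := by linarith
  subst d₂ a₂
  linarith

/-! ### The dual bound on the two edges: functions of one variable -/

/-- The value of the dual bound for a pure atom at input `1` and a mixed atom, as a function of the
dual parameter. -/
def edgeOne (α x θ : ℝ) : ℝ :=
  α * (outEnt x (1 - x) - negMulLog (x / 2)) + outEnt (1 - x) x - (1 - x) * log 2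
    + α * (negMulLog (1 - (1 + x) * θ + 2 * x * θ / (1 + θ))
      - negMulLog (1 - (1 + x) * θ + 2 * x * θ / (1 + θ) - x / 2))
    + ((1 + x) * θ - 2 * x * θ / (1 + θ)) * log (1 - x + θ * (1 + x))
    + (1 - (1 + x) * θ + 2 * x * θ / (1 + θ)) * log (1 + θ * (1 + x)) - (1 + x) * log (1 + θ)

/-- The derivative factors as P'(u) s(u), with P the mass of the mixed atom, P' ≤ 0 and s
decreasing. Hence the function first falls and then rises, and its maximum is at an end: at θ = 0
the mixed atom carries all the mass and the value is I(X;Z); at τ both atoms are pure and the value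
is α I(X;Y). -/
lemma edgeOne_le {α x : ℝ} (hα : 1 ≤ α) (h0 : 0 < x) (h1 : x < 1) {θ : ℝ} (hθ : 0 ≤ θ)
    (hθ' : (1 + x) * θ ^ 2 ≤ 1 - x) :
    edgeOne α x θ ≤ max (α * (outEnt x (1 - x) - x * log 2)) (outEnt (1 - x) x - (1 - x) * log 2) := by
  set τ := √((1 - x) / (1 + x)) with hτ
  have hτ2 : (1 + x) * τ ^ 2 = 1 - x := by
    rw [hτ, sq_sqrt (div_nonneg (by linarith) (by linarith))]; field_simp
  have hτ0 : 0 < τ := by rw [hτ, sqrt_pos]; exact div_pos (by linarith) (by linarith)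
  have hτ1 : τ < 1 := by nlinarith
  have hle : θ ≤ τ := by
    have : θ ^ 2 ≤ τ ^ 2 := le_of_mul_le_mul_left (hθ'.trans hτ2.ge) (by linarith)
    exact (pow_le_pow_iff_left₀ hθ hτ0.le two_ne_zero).1 this
  -- the mass of the mixed atom
  let P : ℝ → ℝ := fun θ => 1 - (1 + x) * θ + 2 * x * θ / (1 + θ)
  have hPd : ∀ u, 0 ≤ u → HasDerivAt P (-(1 + x - 2 * x / (1 + u) ^ 2)) u := fun u hu => by
    have : (1 + u) ≠ 0 := by linarith
    have := (((hasDerivAt_id u).const_mul (1 + x)).const_sub 1).add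
      ((((hasDerivAt_id u).const_mul (2 * x)).div ((hasDerivAt_id u).const_add 1) this))
    refine this.congr_deriv ?_
    simp only [id]
    field_simp
    ring
  have hP' : ∀ u, 0 ≤ u → -(1 + x - 2 * x / (1 + u) ^ 2) ≤ 0 := fun u hu => by
    have : 2 * x / (1 + u) ^ 2 ≤ 2 * x := div_le_self (by linarith) (by nlinarith)
    linarith
  have hPτ : P τ = x := by
    simp only [P]
    field_simp
    linear_combination (-1 : ℝ) * hτ2
  have hPanti : AntitoneOn P (Icc 0 τ) := by
    refine antitoneOn_of_deriv_nonpos (convex_Icc _ _) (fun u hu => (hPd u hu.1).continuousAt.continuousWithinAt)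
      (fun u hu => ?_) fun u hu => ?_
    all_goals rw [interior_Icc] at hu
    · exact (hPd u hu.1.le).differentiableAt.differentiableWithinAt
    · rw [(hPd u hu.1.le).deriv]; exact hP' u hu.1.le
  have hPx : ∀ u ∈ Icc 0 τ, x ≤ P u := fun u hu =>
    hPτ ▸ hPanti hu ⟨hτ0.le, le_rfl⟩ hu.2
  let s : ℝ → ℝ := fun u => α * log (1 - x / (2 * P u)) + log (1 + x / (1 - x + u * (1 + x)))
  have hs : AntitoneOn s (Icc 0 τ) := fun u hu v hv huv => by
    have hv' := hPx v hv
    have hPuv := hPanti hu hv huv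
    have hux : x / (2 * P v) ≤ 1 / 2 := by
      rw [div_le_div_iff₀ (by linarith) two_pos]; linarith
    have hden : 0 < 1 - x + u * (1 + x) := by nlinarith [hu.1]
    have : 0 ≤ x / (1 - x + v * (1 + x)) := div_nonneg h0.le (by nlinarith [hv.1])
    have : 0 < 2 * P v := by linarith
    simp only [s]
    gcongr
    linarith
  have hder : ∀ u ∈ Ioo 0 τ, HasDerivAt (edgeOne α x) (-(1 + x - 2 * x / (1 + u) ^ 2) * s u) u :=
      fun u hu => by
    have hP := hPd u hu.1.le
    have hxP := hPx u ⟨hu.1.le, hu.2.le⟩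
    have hP0 : P u ≠ 0 := by linarith
    have hP0' : P u - x / 2 ≠ 0 := by linarith
    have d1 := (hasDerivAt_negMulLog hP0).comp u hP
    have d2 := (hasDerivAt_negMulLog hP0').comp u (hP.sub_const (x / 2))
    have hA : 0 < 1 - x + u * (1 + x) := by nlinarith [hu.1]
    have hB : 0 < 1 + u * (1 + x) := by nlinarith [hu.1]
    have hC : 0 < 1 + u := by linarith [hu.1]
    have d3 := (((hasDerivAt_id u).mul_const (1 + x)).const_add (1 - x)).log (by simpa using hA.ne')
    have d4 := (((hasDerivAt_id u).mul_const (1 + x)).const_add 1).log (by simpa using hB.ne')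
    have d5 := ((hasDerivAt_id u).const_add 1).log (by simpa using hC.ne')
    have tot := ((((d1.sub d2).const_mul α).const_add (α * (outEnt x (1 - x) - negMulLog (x / 2))
      + outEnt (1 - x) x - (1 - x) * log 2)).add ((hP.const_sub 1).mul d3)).add (hP.mul d4)
      |>.sub (d5.const_mul (1 + x))
    have e : edgeOne α x =ᶠ[nhds u] fun u => α * (outEnt x (1 - x) - negMulLog (x / 2))
        + outEnt (1 - x) x - (1 - x) * log 2 + α * (negMulLog (P u) - negMulLog (P u - x / 2))
        + (1 - P u) * log (1 - x + id u * (1 + x)) + P u * log (1 + id u * (1 + x))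
        - (1 + x) * log (1 + id u) := Filter.Eventually.of_forall fun v => by
      simp only [edgeOne, P, id]; ring
    refine (HasDerivAt.congr_of_eventuallyEq tot e).congr_deriv ?_
    have l1 : log (1 - x / (2 * P u)) = log (P u - x / 2) - log (P u) := by
      rw [← log_div hP0' hP0]; congr 1; field_simp
    have l2 : log (1 + x / (1 - x + u * (1 + x)))
        = log (1 + u * (1 + x)) - log (1 - x + u * (1 + x)) := by
      rw [← log_div hB.ne' hA.ne']; congr 1; field_simp; ring
    have k1 : (1 - P u) * (1 * (1 + x) / (1 - x + u * (1 + x))) = (1 + x) * u / (1 + u) := by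
      have : 1 - P u = u * (1 - x + u * (1 + x)) / (1 + u) := by
        simp only [P]; field_simp; ring
      rw [this]; field_simp
    have k2 : P u * (1 * (1 + x) / (1 + u * (1 + x))) = (1 + x) * (1 - u) / (1 + u) := by
      have : P u = (1 - u) * (1 + u * (1 + x)) / (1 + u) := by
        simp only [P]; field_simp; ring
      rw [this]; field_simp
    have k3 : (1 + x) * (1 / (1 + u)) = (1 + x) * u / (1 + u) + (1 + x) * (1 - u) / (1 + u) := by
      field_simp; ring
    simp only [s, l1, l2, id]
    linear_combination k1 + k2 - k3
  have hcont : ContinuousOn (edgeOne α x) (Icc 0 τ) := by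
    unfold edgeOne
    have e1 : ∀ u ∈ Icc 0 τ, 1 + u ≠ 0 := fun u hu => by linarith [hu.1]
    have e2 : ∀ u ∈ Icc 0 τ, 1 + u * (1 + x) ≠ 0 := fun u hu => by nlinarith [hu.1]
    have e3 : ∀ u ∈ Icc 0 τ, 1 - x + u * (1 + x) ≠ 0 := fun u hu => by nlinarith [hu.1]
    have c0 : ContinuousOn (fun u : ℝ => 2 * x * u / (1 + u)) (Icc 0 τ) :=
      ContinuousOn.div (by fun_prop) (by fun_prop) e1
    have c1 : ContinuousOn (fun u : ℝ => log (1 + u)) (Icc 0 τ) := ContinuousOn.log (by fun_prop) e1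
    have c2 : ContinuousOn (fun u : ℝ => log (1 + u * (1 + x))) (Icc 0 τ) :=
      ContinuousOn.log (by fun_prop) e2
    have c3 : ContinuousOn (fun u : ℝ => log (1 - x + u * (1 + x))) (Icc 0 τ) :=
      ContinuousOn.log (by fun_prop) e3
    have c4 : ContinuousOn (fun u : ℝ => 1 - (1 + x) * u + 2 * x * u / (1 + u)) (Icc 0 τ) :=
      ContinuousOn.add (by fun_prop) c0
    have c5 := continuous_negMulLog.comp_continuousOn c4
    have c6 := continuous_negMulLog.comp_continuousOn (c4.sub (continuousOn_const (c := x / 2)))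
    have c7 : ContinuousOn (fun u : ℝ => (1 + x) * u - 2 * x * u / (1 + u)) (Icc 0 τ) :=
      ContinuousOn.sub (by fun_prop) c0
    exact (((continuousOn_const.add (continuousOn_const.mul (c5.sub c6))).add (c7.mul c3)).add
      (c4.mul c2)).sub (continuousOn_const.mul c1)
  have hval0 : edgeOne α x 0 = outEnt (1 - x) x - (1 - x) * log 2 := by
    have : x / 2 + (1 - x) = 1 - x / 2 := by ring
    simp only [edgeOne, outEnt, this, mul_zero, zero_div, zero_mul, sub_zero, add_zero, log_one,
      negMulLog_one, add_sub_cancel, sub_add_cancel]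
    ring
  have hvalτ : edgeOne α x τ = α * (outEnt x (1 - x) - x * log 2) := by
    have hP1 : 1 - (1 + x) * τ + 2 * x * τ / (1 + τ) = x := hPτ
    have hP2 : (1 + x) * τ - 2 * x * τ / (1 + τ) = 1 - x := by linarith
    have e1 : 1 - x + τ * (1 + x) = (1 + x) * τ * (1 + τ) := by linear_combination (-1 : ℝ) * hτ2
    have hx1 : 0 < 1 - τ := by linarith
    have e2 : 1 + τ * (1 + x) = x * (1 + τ) / (1 - τ) := by
      rw [eq_div_iff hx1.ne']; linear_combination (-1 : ℝ) * hτ2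
    have e3 : (1 - τ) * (1 + τ) = 2 * x / (1 + x) := by
      rw [eq_div_iff (by linarith)]; linear_combination (-1 : ℝ) * hτ2
    have hx2 : 0 < 1 + x := by linarith
    have hx3 : 0 < 1 + τ := by linarith
    have l3 := congrArg log e3
    rw [log_mul hx1.ne' hx3.ne', log_div (by positivity) hx2.ne', log_mul two_ne_zero h0.ne'] at l3
    have l4 := congrArg log hτ2
    rw [log_mul hx2.ne' (by positivity), log_pow] at l4
    rw [edgeOne, hP1, hP2, e1, e2, log_div (by positivity) hx1.ne', log_mul (by positivity) hx3.ne',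
      log_mul (by positivity) hτ0.ne', log_mul (by positivity) hx3.ne']
    have e4 : x - x / 2 = x / 2 := by ring
    have e5 : (1 - x) / 2 + x = (1 + x) / 2 := by ring
    simp only [outEnt, e4, e5, sub_add_cancel, negMulLog, log_one]
    rw [log_div h0.ne' two_ne_zero, log_div hx2.ne' two_ne_zero, log_div (by linarith) two_ne_zero]
    push_cast at l4
    linear_combination (1 - x) / 2 * l4 - x * l3
  rcases le_total 0 (s θ) with hsθ | hsθ
  · refine le_max_of_le_right ?_
    rw [← hval0]
    have : AntitoneOn (edgeOne α x) (Icc 0 θ) := by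
      refine antitoneOn_of_deriv_nonpos (convex_Icc _ _) (hcont.mono (Icc_subset_Icc_right hle))
        (fun u hu => ?_) fun u hu => ?_
      all_goals
        rw [interior_Icc] at hu
        have hd := hder u ⟨hu.1, hu.2.trans_le hle⟩
      · exact hd.differentiableAt.differentiableWithinAt
      · rw [hd.deriv]
        exact mul_nonpos_of_nonpos_of_nonneg (hP' u hu.1.le)
          (hsθ.trans (hs ⟨hu.1.le, hu.2.le.trans hle⟩ ⟨hθ, hle⟩ hu.2.le))
    exact this ⟨le_rfl, hθ⟩ ⟨hθ, le_rfl⟩ hθ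
  · refine le_max_of_le_left ?_
    rw [← hvalτ]
    have : MonotoneOn (edgeOne α x) (Icc θ τ) := by
      refine monotoneOn_of_deriv_nonneg (convex_Icc _ _) (hcont.mono (Icc_subset_Icc_left hθ))
        (fun u hu => ?_) fun u hu => ?_
      all_goals
        rw [interior_Icc] at hu
        have hd := hder u ⟨hθ.trans_lt hu.1, hu.2⟩
      · exact hd.differentiableAt.differentiableWithinAt
      · rw [hd.deriv]
        exact mul_nonneg_of_nonpos_of_nonpos (hP' u (hθ.trans hu.1.le))
          ((hs ⟨hθ, hle⟩ ⟨hθ.trans hu.1.le, hu.2.le⟩ hu.1.le).trans hsθ)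
    exact this ⟨le_rfl, hle⟩ ⟨hle, le_rfl⟩ hle

/-- The value of the dual bound for a pure atom at input `0` and a mixed atom, as a function of the
mass of input `0` at the mixed atom. -/
def edgeTwo (α x a : ℝ) : ℝ :=
  α * (outEnt x (1 - x) - outEnt a (1 - x) - (x - a) * log 2) + outEnt (1 - x) x
    - negMulLog (a + (1 - x)) - (x - a) * log (2 / (1 + x))
    - (a + (1 - x) / 2) * log ((2 * a + (1 - x)) / (1 + x)) - (1 - x) * log 2

/-- The derivative of `edgeTwo`, with `d = 1 - x`. -/
def edgeTwo' (α d a : ℝ) : ℝ :=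
  α * (log a / 2 + log (a + 2 * d) / 2 - log (a + d)) + log (a + d) + log 2 - log (2 * a + d)

lemma hasDerivAt_edgeTwo {α x a : ℝ} (h0 : 0 < x) (h1 : x < 1) (ha : 0 < a) :
    HasDerivAt (edgeTwo α x) (edgeTwo' α (1 - x) a) a := by
  have hd : 0 < 1 - x := by linarith
  have hx : 0 < 1 + x := by linarith
  have i := hasDerivAt_id a
  have n1 : a / 2 ≠ 0 := by positivity
  have n2 : a / 2 + (1 - x) ≠ 0 := by positivity
  have n3 : a + (1 - x) ≠ 0 := by positivity
  have n4 : (2 * a + (1 - x)) / (1 + x) ≠ 0 := by positivity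
  have d1 := (hasDerivAt_negMulLog n1).comp a (i.div_const 2)
  have d2 := (hasDerivAt_negMulLog n2).comp a ((i.div_const 2).add_const (1 - x))
  have d3 := (hasDerivAt_negMulLog n3).comp a (i.add_const (1 - x))
  have d4 := (((i.const_mul 2).add_const (1 - x)).div_const (1 + x)).log n4
  have tot := ((((((d1.add d2).sub d3).const_sub (outEnt x (1 - x))).sub
    ((i.const_sub x).mul_const (log 2))).const_mul α).add_const (outEnt (1 - x) x)).sub d3
    |>.sub ((i.const_sub x).mul_const (log (2 / (1 + x)))) |>.sub
    ((i.add_const ((1 - x) / 2)).mul d4) |>.sub_const ((1 - x) * log 2)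
  refine tot.congr_deriv ?_
  have l1 : log (a / 2) = log a - log 2 := log_div ha.ne' two_ne_zero
  have l2 : log (a / 2 + (1 - x)) = log (a + 2 * (1 - x)) - log 2 := by
    rw [← log_div (by positivity) two_ne_zero]; congr 1; ring
  have l3 : log (2 / (1 + x)) = log 2 - log (1 + x) := log_div two_ne_zero hx.ne'
  have l4 : log ((2 * a + (1 - x)) / (1 + x)) = log (2 * a + (1 - x)) - log (1 + x) :=
    log_div (by positivity) hx.ne'
  have k : (a + (1 - x) / 2) * (2 * 1 / (1 + x) / ((2 * a + (1 - x)) / (1 + x))) = 1 := by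
    field_simp
  simp only [id, l1, l2, l3, l4, edgeTwo']
  linear_combination -k

lemma hasDerivAt_edgeTwo' {α d a : ℝ} (hd : 0 < d) (ha : 0 < a) :
    HasDerivAt (edgeTwo' α d) (d * (α * d * (2 * a + d) - a * (a + 2 * d))
      / (a * (a + d) * (a + 2 * d) * (2 * a + d))) a := by
  have i := hasDerivAt_id a
  have n1 : id a ≠ 0 := ha.ne'
  have n2 : id a + 2 * d ≠ 0 := by simp only [id]; positivity
  have n3 : id a + d ≠ 0 := by simp only [id]; positivity
  have n4 : 2 * id a + d ≠ 0 := by simp only [id]; positivity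
  have d1 := i.log n1
  have d2 := (i.add_const (2 * d)).log n2
  have d3 := (i.add_const d).log n3
  have d4 := ((i.const_mul 2).add_const d).log n4
  have tot := (((((d1.div_const 2).add (d2.div_const 2)).sub d3).const_mul α).add d3).add_const
    (log 2) |>.sub d4
  refine tot.congr_deriv ?_
  simp only [id] at *
  field_simp
  ring

/-- The end values are α I(X;Y) at 0 and I(X;Z) at `x`. The second derivative has the sign of `q`,
which can only pass from positive to negative, so the first derivative rises and then falls. Under
`hc` either it never falls on (0, x] or it is still nonnegative at `x`; in both cases it changes
sign at most once, from negative to positive, and the maximum is at an end. -/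
lemma edgeTwo_le {α x : ℝ} (hα : 1 ≤ α) (h0 : 0 < x) (h1 : x < 1)
    (hc : (α = 1 ∧ x ≤ 1 / 2) ∨ 0 ≤ α * (log (2 - x) + log x) / 2 + log 2 - log (1 + x))
    {a : ℝ} (ha : 0 ≤ a) (hax : a ≤ x) :
    edgeTwo α x a ≤
      max (α * (outEnt x (1 - x) - x * log 2)) (outEnt (1 - x) x - (1 - x) * log 2) := by
  have hd : 0 < 1 - x := by linarith
  have hx : 0 < 1 + x := by linarith
  have hcont : ContinuousOn (edgeTwo α x) (Icc 0 x) := by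
    have c1 : ContinuousOn (fun u : ℝ => log ((2 * u + (1 - x)) / (1 + x))) (Icc 0 x) :=
      ContinuousOn.log (by fun_prop) fun u hu => by have := hu.1; positivity
    unfold edgeTwo
    refine ContinuousOn.sub (ContinuousOn.sub (Continuous.continuousOn (by fun_prop))
      (ContinuousOn.mul (by fun_prop) c1)) continuousOn_const
  have hvalx : edgeTwo α x x = outEnt (1 - x) x - (1 - x) * log 2 := by
    have e : 2 * x + (1 - x) = 1 + x := by ring
    simp [edgeTwo, e, hx.ne']
  have hval0 : edgeTwo α x 0 = α * (outEnt x (1 - x) - x * log 2) := by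
    have e : (1 - x) / 2 + x = (1 + x) / 2 := by ring
    simp only [edgeTwo, outEnt, e, mul_zero, zero_add, sub_add_cancel,
      sub_zero, negMulLog, log_one]
    rw [log_div hd.ne' hx.ne', log_div two_ne_zero hx.ne', log_div hd.ne' two_ne_zero,
      log_div hx.ne' two_ne_zero]
    ring_nf
  set q : ℝ → ℝ := fun a => α * (1 - x) * (2 * a + (1 - x)) - a * (a + 2 * (1 - x))
  have hq : ∀ u v, 0 < u → u ≤ v → 0 ≤ q v → 0 ≤ q u := fun u v hu huv hv => by
    -- This says that q(a)/a is decreasing, whence the single sign change.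
    have : q v * u ≤ q u * v := by
      have : 0 ≤ α * (1 - x) ^ 2 * (v - u) + u * v * (v - u) := by
        have : 0 ≤ v - u := by linarith
        have : 0 < v := by linarith
        positivity
      simp only [q]
      linarith
    have hv0 : 0 < v := by linarith
    exact nonneg_of_mul_nonneg_left ((mul_nonneg hv hu.le).trans this) hv0
  have hmono : ∀ u v, 0 < u → u ≤ v → 0 ≤ q v → edgeTwo' α (1 - x) u ≤ edgeTwo' α (1 - x) v :=
      fun u v hu huv hv => by
    have : MonotoneOn (edgeTwo' α (1 - x)) (Icc u v) := by
      refine monotoneOn_of_deriv_nonneg (convex_Icc _ _) (fun w hw => ?_) (fun w hw => ?_)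
        fun w hw => ?_
      · exact (hasDerivAt_edgeTwo' hd (hu.trans_le hw.1)).continuousAt.continuousWithinAt
      all_goals
        rw [interior_Icc] at hw
        have hw0 : 0 < w := hu.trans hw.1
        have hder := hasDerivAt_edgeTwo' (α := α) hd hw0
      · exact hder.differentiableAt.differentiableWithinAt
      · rw [hder.deriv]
        exact div_nonneg (mul_nonneg hd.le (hq w v hw0 hw.2.le hv)) (by positivity)
    exact this ⟨le_rfl, huv⟩ ⟨huv, le_rfl⟩ huv
  have hanti : ∀ u v, 0 < u → u ≤ v → q u ≤ 0 → edgeTwo' α (1 - x) v ≤ edgeTwo' α (1 - x) u :=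
      fun u v hu huv hqu => by
    have : AntitoneOn (edgeTwo' α (1 - x)) (Icc u v) := by
      refine antitoneOn_of_deriv_nonpos (convex_Icc _ _) (fun w hw => ?_) (fun w hw => ?_)
        fun w hw => ?_
      · exact (hasDerivAt_edgeTwo' hd (hu.trans_le hw.1)).continuousAt.continuousWithinAt
      all_goals
        rw [interior_Icc] at hw
        have hw0 : 0 < w := hu.trans hw.1
        have hder := hasDerivAt_edgeTwo' (α := α) hd hw0
      · exact hder.differentiableAt.differentiableWithinAt
      · rw [hder.deriv]
        have : q w ≤ 0 := by
          by_contra! h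
          have hqu' := hq u w hu hw.1.le h.le
          have : q w * u ≤ q u * w := by
            have : 0 ≤ α * (1 - x) ^ 2 * (w - u) + u * w * (w - u) := by
              have : 0 ≤ w - u := by linarith [hw.1]
              positivity
            simp only [q]
            linarith
          nlinarith [mul_pos h hu, mul_nonneg (neg_nonneg.2 hqu) hw0.le]
        exact div_nonpos_of_nonpos_of_nonneg (mul_nonpos_of_nonneg_of_nonpos hd.le this)
          (by positivity)
    exact this ⟨le_rfl, huv⟩ ⟨huv, le_rfl⟩ huv
  -- beyond a point with nonnegative derivative the derivative stays nonnegative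
  have hend : (∀ u, 0 < u → u ≤ x → 0 ≤ q u) ∨ 0 ≤ edgeTwo' α (1 - x) x := by
    rcases hc with ⟨rfl, hx2⟩ | hc
    · refine Or.inl fun u hu hux => ?_
      have : q u = (1 - x - u) * (1 - x + u) := by simp only [q]; ring
      rw [this]
      exact mul_nonneg (by linarith) (by linarith)
    · refine Or.inr ?_
      have e1 : x + 2 * (1 - x) = 2 - x := by ring
      have e2 : x + (1 - x) = 1 := by ring
      have e3 : 2 * x + (1 - x) = 1 + x := by ring
      rw [edgeTwo', e1, e2, e3, log_one]
      linarith
  rcases ha.eq_or_lt with rfl | ha0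
  · exact hval0 ▸ le_max_left _ _
  rcases le_or_gt 0 (edgeTwo' α (1 - x) a) with hD | hD
  · refine le_max_of_le_right (hvalx ▸ ?_)
    have : MonotoneOn (edgeTwo α x) (Icc a x) := by
      refine monotoneOn_of_deriv_nonneg (convex_Icc _ _) (hcont.mono (Icc_subset_Icc_left ha))
        (fun w hw => ?_) fun w hw => ?_
      all_goals
        rw [interior_Icc] at hw
        have hw0 : 0 < w := ha0.trans hw.1
        have hder := hasDerivAt_edgeTwo (α := α) h0 h1 hw0
      · exact hder.differentiableAt.differentiableWithinAt
      · rw [hder.deriv]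
        rcases le_total 0 (q w) with h | h
        · exact hD.trans (hmono a w ha0 hw.1.le h)
        · rcases hend with he | he
          · exact hD.trans (hmono a w ha0 hw.1.le (he w hw0 hw.2.le))
          · exact he.trans (hanti w x hw0 hw.2.le h)
    exact this ⟨le_rfl, hax⟩ ⟨hax, le_rfl⟩ hax
  · refine le_max_of_le_left (hval0 ▸ ?_)
    have hqa : ∀ w, 0 < w → w ≤ a → edgeTwo' α (1 - x) w ≤ 0 := fun w hw hwa => by
      rcases le_total 0 (q a) with h | h
      · exact (hmono w a hw hwa h).trans hD.le
      · rcases hend with he | he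
        · exact (hmono w a hw hwa (he a ha0 hax)).trans hD.le
        · exact absurd (he.trans (hanti a x ha0 hax h)) hD.not_ge
    have : AntitoneOn (edgeTwo α x) (Icc 0 a) := by
      refine antitoneOn_of_deriv_nonpos (convex_Icc _ _) (hcont.mono (Icc_subset_Icc_right hax))
        (fun w hw => ?_) fun w hw => ?_
      all_goals
        rw [interior_Icc] at hw
        have hder := hasDerivAt_edgeTwo (α := α) h0 h1 hw.1
      · exact hder.differentiableAt.differentiableWithinAt
      · rw [hder.deriv]
        exact hqa w hw.1 hw.2.le
    exact this ⟨le_rfl, ha⟩ ⟨ha, le_rfl⟩ ha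

/-! ### Numerical estimates and balanced pairs -/

lemma log_one_sub_le {y : ℝ} (h0 : 0 ≤ y) (h1 : y < 1) : log (1 - y) ≤ -y - y ^ 2 / 2 := by
  have hd : ∀ u ∈ Icc 0 y, HasDerivAt (fun u : ℝ => log (1 - u) + u + u ^ 2 / 2)
      (-1 / (1 - u) + 1 + 2 * u / 2) u := fun u hu => by
    have := (((hasDerivAt_id u).const_sub 1).log (by simp only [id]; linarith [hu.2])).add
      (hasDerivAt_id u) |>.add (((hasDerivAt_id u).pow 2).div_const 2)
    exact this.congr_deriv (by simp)
  have : AntitoneOn (fun u : ℝ => log (1 - u) + u + u ^ 2 / 2) (Icc 0 y) := by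
    refine antitoneOn_of_deriv_nonpos (convex_Icc _ _)
      (fun u hu => (hd u hu).continuousAt.continuousWithinAt) (fun u hu => ?_) fun u hu => ?_
    all_goals
      rw [interior_Icc] at hu
      have hu' : u ∈ Icc 0 y := ⟨hu.1.le, hu.2.le⟩
    · exact (hd u hu').differentiableAt.differentiableWithinAt
    · rw [(hd u hu').deriv]
      have h2 : 0 < 1 - u := by linarith [hu.2]
      have : -1 / (1 - u) + 1 + 2 * u / 2 = -u ^ 2 / (1 - u) := by field_simp; ring
      rw [this]
      exact div_nonpos_of_nonpos_of_nonneg (by nlinarith) h2.le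
  have := this ⟨le_rfl, h0⟩ ⟨h0, le_rfl⟩ h0
  simp at this
  linarith

lemma log_one_add_le {y : ℝ} (h0 : 0 ≤ y) : log (1 + y) ≤ y - y ^ 2 / 2 + y ^ 3 / 3 := by
  have hd : ∀ u ∈ Icc 0 y, HasDerivAt (fun u : ℝ => log (1 + u) - u + u ^ 2 / 2 - u ^ 3 / 3)
      (1 / (1 + u) - 1 + 2 * u / 2 - 3 * u ^ 2 / 3) u := fun u hu => by
    have := (((hasDerivAt_id u).const_add 1).log (by simp only [id]; linarith [hu.1])).sub
      (hasDerivAt_id u) |>.add (((hasDerivAt_id u).pow 2).div_const 2)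
      |>.sub (((hasDerivAt_id u).pow 3).div_const 3)
    exact this.congr_deriv (by simp)
  have : AntitoneOn (fun u : ℝ => log (1 + u) - u + u ^ 2 / 2 - u ^ 3 / 3) (Icc 0 y) := by
    refine antitoneOn_of_deriv_nonpos (convex_Icc _ _)
      (fun u hu => (hd u hu).continuousAt.continuousWithinAt) (fun u hu => ?_) fun u hu => ?_
    all_goals
      rw [interior_Icc] at hu
      have hu' : u ∈ Icc 0 y := ⟨hu.1.le, hu.2.le⟩
    · exact (hd u hu').differentiableAt.differentiableWithinAt
    · rw [(hd u hu').deriv]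
      have h2 : 0 < 1 + u := by linarith [hu.1]
      have : 1 / (1 + u) - 1 + 2 * u / 2 - 3 * u ^ 2 / 3 = -u ^ 3 / (1 + u) := by field_simp; ring
      rw [this]
      exact div_nonpos_of_nonpos_of_nonneg (by have := pow_pos hu.1 3; linarith) h2.le
  have := this ⟨le_rfl, h0⟩ ⟨h0, le_rfl⟩ h0
  simp at this
  linarith

lemma log_one_sub_le_cubic {y : ℝ} (h0 : 0 ≤ y) (h1 : y < 1) :
    log (1 - y) ≤ -y - y ^ 2 / 2 - y ^ 3 / 3 := by
  have hd : ∀ u ∈ Icc 0 y, HasDerivAt (fun u : ℝ => log (1 - u) + u + u ^ 2 / 2 + u ^ 3 / 3)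
      (-1 / (1 - u) + 1 + 2 * u / 2 + 3 * u ^ 2 / 3) u := fun u hu => by
    have := (((hasDerivAt_id u).const_sub 1).log (by simp only [id]; linarith [hu.2])).add
      (hasDerivAt_id u) |>.add (((hasDerivAt_id u).pow 2).div_const 2)
      |>.add (((hasDerivAt_id u).pow 3).div_const 3)
    exact this.congr_deriv (by simp)
  have : AntitoneOn (fun u : ℝ => log (1 - u) + u + u ^ 2 / 2 + u ^ 3 / 3) (Icc 0 y) := by
    refine antitoneOn_of_deriv_nonpos (convex_Icc _ _)
      (fun u hu => (hd u hu).continuousAt.continuousWithinAt) (fun u hu => ?_) fun u hu => ?_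
    all_goals
      rw [interior_Icc] at hu
      have hu' : u ∈ Icc 0 y := ⟨hu.1.le, hu.2.le⟩
    · exact (hd u hu').differentiableAt.differentiableWithinAt
    · rw [(hd u hu').deriv]
      have h2 : 0 < 1 - u := by linarith [hu.2]
      have : -1 / (1 - u) + 1 + 2 * u / 2 + 3 * u ^ 2 / 3 = -u ^ 3 / (1 - u) := by
        field_simp; ring
      rw [this]
      exact div_nonpos_of_nonpos_of_nonneg (by have := pow_pos hu.1 3; linarith) h2.le
  have := this ⟨le_rfl, h0⟩ ⟨h0, le_rfl⟩ h0
  simp at this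
  linarith

/-- Lower bound on `I(X;Y)` for `P(X = 1) = e`. -/
lemma le_outEnt_sub {e : ℝ} (h0 : 0 < e) (h1 : e ≤ 1 / 2) :
    e * (log 2 - e / 2 - e ^ 3 / 3) ≤ outEnt (1 - e) e - (1 - e) * log 2 := by
  have e1 : (1 - e) / 2 + e = (1 + e) / 2 := by ring
  have hp : 0 < 1 + e := by linarith
  have hm : 0 < 1 - e := by linarith
  have b1 := mul_le_mul_of_nonneg_left (log_one_add_le h0.le) hp.le
  have b2 := mul_le_mul_of_nonneg_left (log_one_sub_le_cubic h0.le (by linarith)) hm.le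
  simp only [outEnt, e1, sub_add_cancel, negMulLog]
  rw [log_div hm.ne' two_ne_zero, log_div hp.ne' two_ne_zero, log_one]
  linarith

/-- Upper bound on `I(X;Z)` for `P(X = 1) = e`. -/
lemma outEnt_sub_le {e : ℝ} (h0 : 0 < e) (h1 : e ≤ 1 / 2) :
    outEnt e (1 - e) - e * log 2 ≤ e / 2 * (-log e + 1 - log 2) := by
  have e1 : e / 2 + (1 - e) = 1 - e / 2 := by ring
  have hm : 0 < 1 - e / 2 := by linarith
  have b : -(1 - e / 2) * log (1 - e / 2) ≤ e / 2 := by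
    have := self_sub_one_le_mul_log hm.le
    linarith
  simp only [outEnt, e1, add_sub_cancel, negMulLog_one, sub_zero]
  simp only [negMulLog] at b ⊢
  rw [log_div h0.ne' two_ne_zero]
  linarith

lemma neg_log_le_inv_sub {e : ℝ} (h0 : 0 < e) : -log e ≤ 1 / e - 1 := by
  have := log_le_sub_one_of_pos (inv_pos.2 h0)
  rw [log_inv] at this
  simpa using this

/-- The ratio of the two mutual informations is at most `21 / (25 e)`. -/
lemma mul_outEnt_sub_le {e : ℝ} (h0 : 0 < e) (h1 : e ≤ 1 / 2) :
    e * (outEnt e (1 - e) - e * log 2) ≤ 21 / 25 * (outEnt (1 - e) e - (1 - e) * log 2) := by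
  have l1 := log_two_gt_d9
  have l2 := log_two_lt_d9
  have h2 := mul_le_mul_of_nonneg_left (outEnt_sub_le h0 h1) h0.le
  have h3 := mul_le_mul_of_nonneg_left (neg_log_le_inv_sub h0) (mul_nonneg h0.le h0.le)
  have e3 : e * e * (1 / e - 1) = e - e * e := by field_simp
  rw [e3] at h3
  refine le_trans (b := e / 2 - e * e / 2 * log 2) (by linarith) ?_
  refine le_trans ?_ (mul_le_mul_of_nonneg_left (le_outEnt_sub h0 h1) (by norm_num))
  have : 0 ≤ e * (21 / 25 * (log 2 - e / 2 - e ^ 3 / 3) - 1 / 2 + e / 2 * log 2) := by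
    refine mul_nonneg h0.le ?_
    have c1 : e ^ 3 ≤ e / 4 := by nlinarith
    nlinarith
  linarith

/-- When α is the ratio I(X;Y)/I(X;Z) at P(X = 1) = 1 - e, or by symmetry the balancing ratio at x =
1 - e with the outputs exchanged, this compares α with logarithms; it supplies the field `log_le` of
`Balanced`. -/
lemma outEnt_sub_mul_log_le {e : ℝ} (h0 : 0 < e) (h1 : e ≤ 1 / 2) :
    (outEnt e (1 - e) - e * log 2) * (log 2 - log (1 + e))
      ≤ (outEnt (1 - e) e - (1 - e) * log 2) * -log e := by
  have l1 := log_two_gt_d9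
  have l2 := log_two_lt_d9
  have hL : log 2 ≤ -log e := by
    rw [← log_inv]
    exact log_le_log two_pos (by rw [le_inv_comm₀ two_pos h0]; linarith)
  have b1 : 2 * e / 3 ≤ log (1 + e) := by
    have := one_sub_inv_le_log_of_pos (x := 1 + e) (by linarith)
    have h3 : 2 * e / 3 ≤ 1 - (1 + e)⁻¹ := by
      have : 1 - (1 + e)⁻¹ = e / (1 + e) := by field_simp; ring
      rw [this, div_le_div_iff₀ (by norm_num) (by linarith)]
      nlinarith
    linarith
  have b2 : log (1 + e) ≤ log 2 := log_le_log (by linarith) (by linarith)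
  refine le_trans (mul_le_mul_of_nonneg_right (outEnt_sub_le h0 h1) (by linarith)) ?_
  refine le_trans ?_ (mul_le_mul_of_nonneg_right (le_outEnt_sub h0 h1) (by linarith))
  set L := -log e
  have c0 : e ^ 2 ≤ 1 / 4 := by nlinarith
  have c1 : e ^ 3 ≤ e / 4 := by nlinarith
  have : (L + 1 - log 2) * (log 2 - log (1 + e)) ≤ (L + 1 - log 2) * (log 2 - 2 * e / 3) :=
    mul_le_mul_of_nonneg_left (by linarith) (by linarith)
  have k : 0 ≤ (log 2 - e / 2 - e ^ 3 / 3) * L - (L + 1 - log 2) * (log 2 - 2 * e / 3) / 2 := by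
    have k1 : 0 ≤ (log 2 / 2 - e / 6 - e ^ 3 / 3) * (L - log 2) :=
      mul_nonneg (by linarith) (by linarith)
    have k2 : 0 ≤ (log 2 - e / 2 - e ^ 3 / 3) * log 2 - (log 2 - 2 * e / 3) / 2 := by
      nlinarith
    linarith
  have := mul_nonneg h0.le k
  nlinarith

/-- The pairs `(α, x)` at which the two extreme strategies give the same value (or `α = 1` and
`x ≤ 1 / 2`) satisfy the analytic conditions used below. -/
structure Balanced (α x : ℝ) : Prop where
  one_le : 1 ≤ α
  degraded : α * (1 - x) ≤ 2 - x
  log_le : log (1 - x) ≤ α * log (1 - x / 2)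
  edge : (α = 1 ∧ x ≤ 1 / 2) ∨ 0 ≤ α * (log (2 - x) + log x) / 2 + log 2 - log (1 + x)

lemma balanced_one {x : ℝ} (h0 : 0 < x) (h1 : x ≤ 1 / 2) : Balanced 1 x where
  one_le := le_rfl
  degraded := by linarith
  log_le := by rw [one_mul]; exact log_le_log (by linarith) (by linarith)
  edge := Or.inl ⟨rfl, h1⟩

/-- With e = 1 - x, equality of the two strategies makes α a ratio of mutual informations, so the
two preceding comparisons become α e ≤ 21/25 and α (log 2 - log(1 + e)) ≤ -log e. The first gives
`degraded`, the second is `log_le`, and `edge` follows from the first by expanding logarithms. -/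
lemma balanced_of_eq {α x : ℝ} (hα : 1 ≤ α) (h0 : 1 / 2 ≤ x) (h1 : x < 1)
    (h : α * (outEnt x (1 - x) - x * log 2) = outEnt (1 - x) x - (1 - x) * log 2) :
    Balanced α x := by
  obtain ⟨e, rfl⟩ : ∃ e, x = 1 - e := ⟨1 - x, by ring⟩
  have he0 : 0 < e := by linarith
  have he1 : e ≤ 1 / 2 := by linarith
  rw [sub_sub_cancel] at h
  have hpos : 0 < outEnt (1 - e) e - (1 - e) * log 2 := by
    have := mul_log_two_lt_outEnt (s := 1 - e) (t := e) (by linarith) he0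
    linarith
  have k1 := mul_outEnt_sub_le he0 he1
  have k2 := outEnt_sub_mul_log_le he0 he1
  rw [← h] at k1 k2
  have a1 : α * e ≤ 21 / 25 := le_of_mul_le_mul_right (by linarith) hpos
  have a2 : α * (log 2 - log (1 + e)) ≤ -log e := le_of_mul_le_mul_right (by linarith) hpos
  refine ⟨hα, by linarith, ?_, Or.inr ?_⟩
  · have : 1 - (1 - e) / 2 = (1 + e) / 2 := by ring
    rw [this, log_div (by linarith) two_ne_zero, sub_sub_cancel]
    linarith
  · have e1 : 2 - (1 - e) = 1 + e := by ring
    have e2 : 1 + (1 - e) = 2 * (1 - e / 2) := by ring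
    have e3 : log (1 + e) + log (1 - e) = log (1 - e ^ 2) := by
      rw [← log_mul (by linarith) (by linarith)]; ring_nf
    rw [e1, e2, e3, log_mul two_ne_zero (by linarith)]
    have h2 := log_one_sub_le (y := e / 2) (by linarith) (by linarith)
    have h4 : 0 < 1 - e ^ 2 := by nlinarith
    have h3 := one_sub_inv_le_log_of_pos h4
    have h5 : 1 - (1 - e ^ 2)⁻¹ = -(e ^ 2 / (1 - e ^ 2)) := by field_simp; ring
    rw [h5] at h3
    have h6 : α * (e ^ 2 / (1 - e ^ 2)) ≤ e + e ^ 2 / 4 := by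
      rw [← mul_div_assoc, div_le_iff₀ h4]
      have : α * e ^ 2 ≤ 21 / 25 * e := by nlinarith
      refine this.trans ?_
      -- The worst case is e = 1/2, where the product is 27/32, just above 21/25.
      have : 0 ≤ e * ((1 + e / 4) * (1 - e ^ 2) - 21 / 25) := by
        refine mul_nonneg he0.le ?_
        nlinarith [mul_nonneg he0.le he0.le]
      linarith
    have h7 : -(α * (e ^ 2 / (1 - e ^ 2))) ≤ α * log (1 - e ^ 2) := by
      have := mul_le_mul_of_nonneg_left h3 (by linarith : (0 : ℝ) ≤ α)
      linarith
    linarith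

/-! ### Linear majorants for two values of U -/

/-- One atom of the dual bound. -/
lemma atom_le {s t A B τ K M : ℝ} (hs : 0 ≤ s) (ht : 0 ≤ t) (hK : 0 < K) (hM0 : 0 ≤ M) (hA : A ≤ M)
    (hB : B * τ ≤ M) (hsA : 0 < s → 0 < A) (htB : 0 < t → 0 < B) (htτ : 0 < t → 0 < τ) :
    negMulLog (s + t) + s * log A + t * log B
      ≤ -(s + t) * log K + M * K - (s + t) - t * log τ := by
  rcases (add_nonneg hs ht).eq_or_lt with h | h
  · have h1 : s = 0 := by linarith
    have h2 : t = 0 := by linarith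
    have := mul_nonneg hM0 hK.le
    simpa [h1, h2] using this
  have hM : 0 < M := by
    rcases hs.eq_or_lt with h1 | h1
    · have ht' : 0 < t := by linarith
      exact (mul_pos (htB ht') (htτ ht')).trans_le hB
    · exact (hsA h1).trans_le hA
  have k1 : s * log A ≤ s * log M := by
    rcases hs.eq_or_lt with h1 | h1
    · simp [← h1]
    · exact mul_le_mul_of_nonneg_left (log_le_log (hsA h1) hA) hs
  have k2 : t * log B + t * log τ ≤ t * log M := by
    rcases ht.eq_or_lt with h1 | h1
    · simp [← h1]
    · rw [← mul_add, ← log_mul (htB h1).ne' (htτ h1).ne']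
      exact mul_le_mul_of_nonneg_left (log_le_log (mul_pos (htB h1) (htτ h1)) hB) ht
  -- This is log y ≤ y - 1 at y = MK/(s + t), the only loss apart from replacing `A` and `B * τ` by
  -- `M`.
  have k3 : (s + t) * (log M + log K - log (s + t)) ≤ M * K - (s + t) := by
    rw [← log_mul hM.ne' hK.ne', ← log_div (by positivity) h.ne']
    have := mul_le_mul_of_nonneg_left (log_le_sub_one_of_pos (x := M * K / (s + t)) (by positivity))
      h.le
    refine this.trans (le_of_eq ?_)
    field_simp
  simp only [negMulLog]
  linarith

/-- Dual bound for one value of the second auxiliary variable: two atoms. -/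
lemma negMulLog_add_le {s₁ t₁ s₂ t₂ A₁ B₁ A₂ B₂ : ℝ} (hs₁ : 0 ≤ s₁) (ht₁ : 0 ≤ t₁) (hs₂ : 0 ≤ s₂)
    (ht₂ : 0 ≤ t₂) (hA₁ : 0 ≤ A₁) (hA₂ : 0 ≤ A₂) (h₁ : 0 < s₁ → 0 < A₁) (h₁' : 0 < t₁ → 0 < B₁)
    (h₂ : 0 < s₂ → 0 < A₂) (h₂' : 0 < t₂ → 0 < B₂)
    (h : ∀ τ, 0 ≤ τ → max A₁ (B₁ * τ) + max A₂ (B₂ * τ) ≤ 1 + τ ^ 2) :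
    negMulLog (s₁ + t₁) + negMulLog (s₂ + t₂)
        + (s₁ * log A₁ + t₁ * log B₁ + s₂ * log A₂ + t₂ * log B₂)
      ≤ negMulLog ((t₁ + t₂) / 2) + negMulLog ((t₁ + t₂) / 2 + (s₁ + s₂)) := by
  set S := s₁ + s₂
  set T := t₁ + t₂
  have hS : 0 ≤ S := add_nonneg hs₁ hs₂
  have hT : 0 ≤ T := add_nonneg ht₁ ht₂
  rcases (by positivity : 0 ≤ T / 2 + S).eq_or_lt with hK | hK
  · have e1 : s₁ = 0 := by linarith
    have e2 : s₂ = 0 := by linarith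
    have e3 : t₁ = 0 := by linarith
    have e4 : t₂ = 0 := by linarith
    simp [S, T, e1, e2, e3, e4]
  -- The masses of Z = 0 and Z = 1 are K = T/2 + S and T/2 = τ²K, so (1 + τ²)K = S + T and the
  -- hypothesis on the multipliers absorbs the linear terms of the two atoms.
  set τ := √(T / 2 / (T / 2 + S))
  have hτ2 : τ ^ 2 = T / 2 / (T / 2 + S) := sq_sqrt (by positivity)
  have hτ : 0 < T → 0 < τ := fun h => sqrt_pos.2 (by positivity)
  have a1 := atom_le hs₁ ht₁ hK (hA₁.trans (le_max_left A₁ (B₁ * τ))) (le_max_left _ _)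
    (le_max_right _ _) h₁ h₁' (fun h => hτ (by linarith))
  have a2 := atom_le hs₂ ht₂ hK (hA₂.trans (le_max_left A₂ (B₂ * τ))) (le_max_left _ _)
    (le_max_right _ _) h₂ h₂' (fun h => hτ (by linarith))
  have hM : (max A₁ (B₁ * τ) + max A₂ (B₂ * τ)) * (T / 2 + S) ≤ S + T := by
    refine (mul_le_mul_of_nonneg_right (h τ (sqrt_nonneg _)) hK.le).trans (le_of_eq ?_)
    rw [hτ2, add_mul, div_mul_cancel₀ _ hK.ne']; ring
  have hlog : T * log τ = T / 2 * (log (T / 2) - log (T / 2 + S)) := by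
    rcases hT.eq_or_lt with h0 | h0
    · simp [← h0]
    · rw [← log_div (by positivity) hK.ne', ← hτ2, log_pow]; push_cast; ring
  have hlog' : T * log τ = t₁ * log τ + t₂ * log τ := by simp only [T]; ring
  have hN : (s₁ + t₁) * log (T / 2 + S) + (s₂ + t₂) * log (T / 2 + S)
      = (S + T) * log (T / 2 + S) := by simp only [S, T]; ring
  simp only [negMulLog] at a1 a2 ⊢
  linarith

/-- The value of the dual bound with multipliers `A₁, B₁, A₂, B₂` for two atoms. -/
def dualBound (α d₁ a₁ d₂ a₂ A₁ B₁ A₂ B₂ : ℝ) : ℝ :=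
  α * (outEnt (d₁ + d₂) (a₁ + a₂) - outEnt d₁ a₁ - outEnt d₂ a₂) + outEnt (a₁ + a₂) (d₁ + d₂)
    - negMulLog (d₁ + a₁) - negMulLog (d₂ + a₂)
    - d₁ * log A₁ - a₁ * log B₁ - d₂ * log A₂ - a₂ * log B₂

/-- For fixed multipliers and fixed totals, the nonlinear terms are negatives of `outEnt` and
`negMulLog`, hence convex. -/
lemma dualBound_convex {α d₁ a₁ d₂ a₂ d₁' a₁' d₂' a₂' c A₁ B₁ A₂ B₂ : ℝ} (hα : 0 ≤ α)
    (hd₁ : 0 ≤ d₁) (ha₁ : 0 ≤ a₁) (hd₂ : 0 ≤ d₂) (ha₂ : 0 ≤ a₂)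
    (hd₁' : 0 ≤ d₁') (ha₁' : 0 ≤ a₁') (hd₂' : 0 ≤ d₂') (ha₂' : 0 ≤ a₂')
    (hd : d₁ + d₂ = d₁' + d₂') (ha : a₁ + a₂ = a₁' + a₂') (hc : 0 ≤ c) (hc1 : c ≤ 1) :
    dualBound α ((1 - c) * d₁ + c * d₁') ((1 - c) * a₁ + c * a₁') ((1 - c) * d₂ + c * d₂')
        ((1 - c) * a₂ + c * a₂') A₁ B₁ A₂ B₂
      ≤ (1 - c) * dualBound α d₁ a₁ d₂ a₂ A₁ B₁ A₂ B₂
        + c * dualBound α d₁' a₁' d₂' a₂' A₁ B₁ A₂ B₂ := by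
  have hc' : 0 ≤ 1 - c := by linarith
  have e1 : (1 - c) * d₁ + c * d₁' + ((1 - c) * d₂ + c * d₂') = d₁ + d₂ := by
    linear_combination (-c) * hd
  have e2 : (1 - c) * a₁ + c * a₁' + ((1 - c) * a₂ + c * a₂') = a₁ + a₂ := by
    linear_combination (-c) * ha
  have b1 := outEnt_superadd (mul_nonneg hc' hd₁) (mul_nonneg hc' ha₁) (mul_nonneg hc hd₁')
    (mul_nonneg hc ha₁')
  have b2 := outEnt_superadd (mul_nonneg hc' hd₂) (mul_nonneg hc' ha₂) (mul_nonneg hc hd₂')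
    (mul_nonneg hc ha₂')
  rw [outEnt_smul, outEnt_smul] at b1 b2
  have n1 := concaveOn_negMulLog.2 (mem_Ici.2 (add_nonneg hd₁ ha₁)) (mem_Ici.2 (add_nonneg hd₁' ha₁'))
    hc' hc (by ring)
  have n2 := concaveOn_negMulLog.2 (mem_Ici.2 (add_nonneg hd₂ ha₂)) (mem_Ici.2 (add_nonneg hd₂' ha₂'))
    hc' hc (by ring)
  simp only [smul_eq_mul] at n1 n2
  have e3 : (1 - c) * (d₁ + a₁) + c * (d₁' + a₁')
      = (1 - c) * d₁ + c * d₁' + ((1 - c) * a₁ + c * a₁') := by ring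
  have e4 : (1 - c) * (d₂ + a₂) + c * (d₂' + a₂')
      = (1 - c) * d₂ + c * d₂' + ((1 - c) * a₂ + c * a₂') := by ring
  rw [e3] at n1
  rw [e4] at n2
  have b12 := mul_le_mul_of_nonneg_left (add_le_add b1 b2) hα
  simp only [dualBound, e1, e2, ← hd, ← ha]
  linarith

/-- The dual bound when `V` reveals the input. -/
lemma dualBound_le_of_degraded {α x d₁ a₁ d₂ a₂ : ℝ} (hb : Balanced α x) (h0 : 0 < x) (h1 : x < 1)
    (hd₁ : 0 ≤ d₁) (ha₁ : 0 ≤ a₁) (hd₂ : 0 ≤ d₂) (ha₂ : 0 ≤ a₂) (hx : d₁ + d₂ = x)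
    (hx' : a₁ + a₂ = 1 - x) :
    dualBound α d₁ a₁ d₂ a₂ (d₁ / x) (2 * (a₁ / (1 - x))) (d₂ / x) (2 * (a₂ / (1 - x)))
      ≤ outEnt (1 - x) x - (1 - x) * log 2 := by
  have key := inEnt_sub_outEnt_add_le hb.one_le h0 h1 hb.degraded hb.log_le hd₁ ha₁ hd₂ ha₂ hx hx'
  have hd : 0 < 1 - x := by linarith
  have f1 : ∀ d : ℝ, d * log (d / x) = -negMulLog d - d * log x := fun d => by
    rcases eq_or_ne d 0 with rfl | h
    · simp
    · rw [log_div h h0.ne', negMulLog]; ring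
  have f2 : ∀ a : ℝ, a * log (2 * (a / (1 - x))) = a * log 2 - negMulLog a - a * log (1 - x) :=
      fun a => by
    rcases eq_or_ne a 0 with rfl | h
    · simp
    · rw [log_mul two_ne_zero (div_ne_zero h hd.ne'), log_div h hd.ne', negMulLog]; ring
  have e1 : inEnt x (1 - x) = -x * log x - (1 - x) * log (1 - x) := by
    simp [inEnt, negMulLog]; ring
  rw [e1] at key
  have g1 : d₁ * log x + d₂ * log x = x * log x := by rw [← add_mul, hx]
  have g2 : a₁ * log (1 - x) + a₂ * log (1 - x) = (1 - x) * log (1 - x) := by rw [← add_mul, hx']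
  have g3 : a₁ * log 2 + a₂ * log 2 = (1 - x) * log 2 := by rw [← add_mul, hx']
  simp only [dualBound, hx, hx', f1, f2]
  simp only [inEnt] at key
  linarith

/-- This is the end of the segment of parameter θ at which the first atom has no mass at input 0. -/
lemma dualBound_edgeOne {α x θ : ℝ} (h0 : 0 < x) (h1 : x < 1) (hθ0 : 0 < θ) (hθ1 : θ < 1) :
    dualBound α 0 (θ * (1 - x) + 2 * x * θ ^ 2 / (1 + θ)) x
      (1 - x - (θ * (1 - x) + 2 * x * θ ^ 2 / (1 + θ))) (θ ^ 2) (2 * θ) (1 - θ ^ 2) (2 * (1 - θ))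
      = edgeOne α x θ := by
  have hp : 0 < 1 + θ := by linarith
  have hm : 0 < 1 - θ := by linarith
  have hA : 0 < 1 - x + θ * (1 + x) := by nlinarith
  have hB : 0 < 1 + θ * (1 + x) := by nlinarith
  set P := 1 - (1 + x) * θ + 2 * x * θ / (1 + θ) with hP
  have e1 : θ * (1 - x) + 2 * x * θ ^ 2 / (1 + θ) = 1 - P := by rw [hP]; field_simp; ring
  have e2 : (1 + x) * θ - 2 * x * θ / (1 + θ) = 1 - P := by rw [hP]; ring
  have e3 : 1 - P = θ * (1 - x + θ * (1 + x)) / (1 + θ) := by rw [hP]; field_simp; ring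
  have e4 : P = (1 - θ) * (1 + θ * (1 + x)) / (1 + θ) := by rw [hP]; field_simp; ring
  have l3 : log (1 - P) = log θ + log (1 - x + θ * (1 + x)) - log (1 + θ) := by
    rw [e3, log_div (by positivity) hp.ne', log_mul hθ0.ne' hA.ne']
  have l4 : log P = log (1 - θ) + log (1 + θ * (1 + x)) - log (1 + θ) := by
    rw [e4, log_div (by positivity) hp.ne', log_mul hm.ne' hB.ne']
  have l5 : log (1 - θ ^ 2) = log (1 - θ) + log (1 + θ) := by
    rw [← log_mul hm.ne' hp.ne']; ring_nf
  have e5 : 1 - x - (1 - P) = P - x := by ring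
  have e6 : 1 - P + (P - x) = 1 - x := by ring
  have e7 : x / 2 + (P - x) = P - x / 2 := by ring
  rw [edgeOne, ← hP, e1, e2, e5, dualBound]
  simp only [outEnt_zero_left, zero_add, e6, zero_mul, add_sub_cancel, sub_zero]
  have e8 : outEnt x (P - x) = negMulLog (x / 2) + negMulLog (P - x / 2) - negMulLog P := by
    simp [outEnt, e7]
  rw [e8, l5, log_mul two_ne_zero hθ0.ne', log_mul two_ne_zero hm.ne']
  have n1 : negMulLog (1 - P)
      = -(1 - P) * (log θ + log (1 - x + θ * (1 + x)) - log (1 + θ)) := by rw [negMulLog, l3]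
  have n2 : negMulLog P = -P * (log (1 - θ) + log (1 + θ * (1 + x)) - log (1 + θ)) := by
    rw [negMulLog, l4]
  linear_combination -n1 - n2

/-- This is the end of the segment of parameter θ at which the second atom has no mass at input 1.
-/
lemma dualBound_edgeTwo {α x θ d : ℝ} (h0 : 0 < x) (h1 : x < 1) (hθ0 : 0 < θ) (hθ1 : θ < 1)
    (hd : d = θ ^ 2 * x - (1 - x) * (1 - θ ^ 2) / 2) :
    dualBound α d (1 - x) (x - d) 0 (θ ^ 2) (2 * θ) (1 - θ ^ 2) (2 * (1 - θ))
      = edgeTwo α x d := by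
  have hx : 0 < 1 + x := by linarith
  have hm : 0 < 1 - θ ^ 2 := by nlinarith
  have e1 : (2 * d + (1 - x)) / (1 + x) = θ ^ 2 := by rw [hd]; field_simp; ring
  have e2 : x - d = (1 + x) / 2 * (1 - θ ^ 2) := by rw [hd]; ring
  have l1 : log (2 / (1 + x)) = log (1 - θ ^ 2) - log (x - d) := by
    rw [← log_div hm.ne' (by rw [e2]; positivity), e2]
    congr 1
    field_simp
  rw [edgeTwo, dualBound, e1, l1]
  simp only [add_sub_cancel, add_zero, outEnt_zero_right, zero_mul, sub_zero]
  rw [log_mul two_ne_zero hθ0.ne', log_pow]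
  simp only [negMulLog]
  push_cast
  ring

/-- Each of the four choices in the maxima is covered by a square: 2qτ ≤ q² + τ², 2(1 - q)τ ≤ (1 -
q)² + τ², 2τ ≤ 1 + τ², or τ² ≥ 0. -/
lemma max_add_max_le {p q : ℝ} (h : q ^ 2 ≤ p) (h' : (1 - q) ^ 2 ≤ 1 - p) (τ : ℝ) :
    max p (2 * q * τ) + max (1 - p) (2 * (1 - q) * τ) ≤ 1 + τ ^ 2 := by
  have k1 := sq_nonneg (τ - q)
  have k2 := sq_nonneg (τ - (1 - q))
  have k3 := sq_nonneg (τ - 1)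
  have k4 := sq_nonneg τ
  rcases max_choice p (2 * q * τ) with h3 | h3 <;>
    rcases max_choice (1 - p) (2 * (1 - q) * τ) with h4 | h4 <;> rw [h3, h4] <;> linarith

/-- Some dual certificate proves the inequality for two atoms. -/
lemma exists_dualBound_le {α x d₁ a₁ d₂ a₂ : ℝ} (hb : Balanced α x) (h0 : 0 < x) (h1 : x < 1)
    (hd₁ : 0 ≤ d₁) (ha₁ : 0 ≤ a₁) (hd₂ : 0 ≤ d₂) (ha₂ : 0 ≤ a₂) (hx : d₁ + d₂ = x)
    (hx' : a₁ + a₂ = 1 - x) (hord : d₁ * a₂ ≤ d₂ * a₁) :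
    ∃ A₁ B₁ A₂ B₂ : ℝ, 0 ≤ A₁ ∧ 0 ≤ A₂ ∧ (0 < d₁ → 0 < A₁) ∧ (0 < a₁ → 0 < B₁) ∧ (0 < d₂ → 0 < A₂) ∧
      (0 < a₂ → 0 < B₂) ∧ (∀ τ, 0 ≤ τ → max A₁ (B₁ * τ) + max A₂ (B₂ * τ) ≤ 1 + τ ^ 2) ∧
      dualBound α d₁ a₁ d₂ a₂ A₁ B₁ A₂ B₂ ≤
        max (α * (outEnt x (1 - x) - x * log 2)) (outEnt (1 - x) x - (1 - x) * log 2) := by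
  have hd : 0 < 1 - x := by linarith
  have hpq : d₁ / x ≤ a₁ / (1 - x) := by
    rw [div_le_div_iff₀ h0 hd, ← hx', ← hx]; linarith
  have hp2 : d₂ / x = 1 - d₁ / x := by rw [eq_sub_iff_add_eq, ← add_div, add_comm, hx, div_self h0.ne']
  have hq2 : a₂ / (1 - x) = 1 - a₁ / (1 - x) := by
    rw [eq_sub_iff_add_eq, ← add_div, add_comm, hx', div_self hd.ne']
  -- With p = d₁/x and q = a₁/(1 - x) the multipliers p, 2q, 1 - p, 2(1 - q) belong to V = X; they
  -- are admissible when q² ≤ p. The other inequality, (1 - q)² ≤ 1 - p, then follows from p ≤ q.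
  rcases le_or_gt ((a₁ / (1 - x)) ^ 2) (d₁ / x) with hI | hII
  · refine ⟨d₁ / x, 2 * (a₁ / (1 - x)), d₂ / x, 2 * (a₂ / (1 - x)), by positivity, by positivity,
      fun h => by positivity, fun h => by positivity, fun h => by positivity, fun h => by positivity,
      fun τ hτ => ?_,
      (dualBound_le_of_degraded hb h0 h1 hd₁ ha₁ hd₂ ha₂ hx hx').trans (le_max_right _ _)⟩
    rw [hp2, hq2]
    have hq0 : 0 ≤ a₁ / (1 - x) := by positivity
    have hq1 : 0 ≤ 1 - a₁ / (1 - x) := hq2 ▸ by positivity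
    generalize d₁ / x = p at *
    generalize a₁ / (1 - x) = q at *
    exact max_add_max_le hI (by nlinarith) τ
  have ha₁' : 0 < a₁ := by
    rcases ha₁.eq_or_lt with h | h
    · rw [← h] at hII
      have : 0 ≤ d₁ / x := by positivity
      simp only [zero_div] at hII
      linarith
    · exact h
  have hm₂ : 0 < d₂ + a₂ := by
    rcases (add_nonneg hd₂ ha₂).eq_or_lt with h | h
    · have e1 : d₂ = 0 := by linarith
      have e2 : a₂ = 0 := by linarith
      rw [e1, add_zero] at hx
      rw [e2, add_zero] at hx'
      rw [hx, hx', div_self h0.ne', div_self hd.ne'] at hII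
      norm_num at hII
    · exact h
  -- The multipliers θ², 2θ, 1 - θ², 2(1 - θ) meet the constraint with equality at τ = 0, θ, 1. The
  -- majorant is thus exact when V reveals X except on one value with τ = θ, where the first atom
  -- has input 1 and the second input 0. If n is the mass of Z = 0 on that value, this determines d₁
  -- and a₁ as in `hdn` and `han`; the equation solved here is the result of eliminating n.
  obtain ⟨θ, hθ, hg⟩ : ∃ θ ∈ Icc (0 : ℝ) 1,
      (1 + θ) * a₁ + 2 * d₁ - θ * (1 + θ) + x * θ * (1 - θ) = 0 := by
    refine intermediate_value_Icc' zero_le_one (f := fun θ : ℝ =>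
      (1 + θ) * a₁ + 2 * d₁ - θ * (1 + θ) + x * θ * (1 - θ)) (by fun_prop) ⟨?_, ?_⟩
    · show _ ≤ _
      linarith
    · show _ ≤ _
      linarith
  have hθ0 : 0 < θ := by
    rcases hθ.1.eq_or_lt with h | h
    · rw [← h] at hg; linarith
    · exact h
  have hθ1 : θ < 1 := by
    rcases hθ.2.eq_or_lt with h | h
    · rw [h] at hg; linarith
    · exact h
  have hm : 0 < 1 - θ := by linarith
  have hp : 0 < 1 + θ := by linarith
  have hsq : 0 < θ ^ 2 := by positivity
  have hsq1 : 0 < 1 - θ ^ 2 := by nlinarith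
  set n := (x - d₁ / θ ^ 2) / (1 - θ ^ 2) with hn
  have hdn : d₁ = θ ^ 2 * (x - n * (1 - θ ^ 2)) := by rw [hn]; field_simp; ring
  have han : a₁ = θ * (1 - x) + 2 * n * θ ^ 2 * (1 - θ) := by
    have : (1 + θ) * a₁ = (1 + θ) * (θ * (1 - x) + 2 * n * θ ^ 2 * (1 - θ)) := by
      linear_combination hg - 2 * hdn
    exact mul_left_cancel₀ hp.ne' this
  -- A negative n would put the split back into the case q² ≤ p.
  have hn0 : 0 ≤ n := by
    by_contra! h
    have k1 : θ ^ 2 ≤ d₁ / x := by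
      rw [le_div_iff₀ h0, hdn]
      have : 0 ≤ θ ^ 2 * (-n * (1 - θ ^ 2)) := by
        have : 0 ≤ -n := by linarith
        positivity
      linarith
    have k2 : a₁ / (1 - x) ≤ θ := by
      rw [div_le_iff₀ hd, han]
      have : 0 ≤ 2 * -n * θ ^ 2 * (1 - θ) := by
        have : 0 ≤ -n := by linarith
        positivity
      linarith
    have : (a₁ / (1 - x)) ^ 2 ≤ θ ^ 2 := pow_le_pow_left₀ (by positivity) k2 2
    linarith
  refine ⟨θ ^ 2, 2 * θ, 1 - θ ^ 2, 2 * (1 - θ), hsq.le, hsq1.le, fun _ => hsq, fun _ => by positivity,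
    fun _ => hsq1, fun _ => by positivity, fun τ hτ => ?_, ?_⟩
  · exact max_add_max_le le_rfl (by nlinarith) τ
  -- the endpoint where `V` reveals the input
  have hstart : dualBound α (x * θ ^ 2) ((1 - x) * θ) (x * (1 - θ ^ 2)) ((1 - x) * (1 - θ))
      (θ ^ 2) (2 * θ) (1 - θ ^ 2) (2 * (1 - θ)) ≤
        max (α * (outEnt x (1 - x) - x * log 2)) (outEnt (1 - x) x - (1 - x) * log 2) := by
    have := dualBound_le_of_degraded hb h0 h1 (d₁ := x * θ ^ 2) (a₁ := (1 - x) * θ)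
      (d₂ := x * (1 - θ ^ 2)) (a₂ := (1 - x) * (1 - θ)) (by positivity) (by positivity)
      (by positivity) (by positivity) (by ring) (by ring)
    rw [mul_div_cancel_left₀ _ h0.ne', mul_div_cancel_left₀ _ hd.ne', mul_div_cancel_left₀ _ h0.ne',
      mul_div_cancel_left₀ _ hd.ne'] at this
    exact this.trans (le_max_right _ _)
  -- interpolation between the two endpoints of the line of constant `θ`
  have hline : ∀ N d a : ℝ, 0 < N → n ≤ N → d = θ ^ 2 * (x - N * (1 - θ ^ 2)) →
      a = θ * (1 - x) + 2 * N * θ ^ 2 * (1 - θ) → 0 ≤ d → 0 ≤ x - d → 0 ≤ a → 0 ≤ 1 - x - a →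
      dualBound α d a (x - d) (1 - x - a) (θ ^ 2) (2 * θ) (1 - θ ^ 2) (2 * (1 - θ)) ≤
        max (α * (outEnt x (1 - x) - x * log 2)) (outEnt (1 - x) x - (1 - x) * log 2) →
      dualBound α d₁ a₁ d₂ a₂ (θ ^ 2) (2 * θ) (1 - θ ^ 2) (2 * (1 - θ)) ≤
        max (α * (outEnt x (1 - x) - x * log 2)) (outEnt (1 - x) x - (1 - x) * log 2) := by
    intro N d a hN hnN hdN haN hd0 hd0' ha0 ha0' hend
    have hc0 : 0 ≤ n / N := by positivity
    have hc1 : n / N ≤ 1 := (div_le_one hN).2 hnN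
    have hcN : n / N * N = n := div_mul_cancel₀ _ hN.ne'
    have := dualBound_convex (c := n / N) (A₁ := θ ^ 2) (B₁ := 2 * θ) (A₂ := 1 - θ ^ 2)
      (B₂ := 2 * (1 - θ)) (d₁ := x * θ ^ 2) (a₁ := (1 - x) * θ) (d₂ := x * (1 - θ ^ 2))
      (a₂ := (1 - x) * (1 - θ)) (zero_le_one.trans hb.one_le) (by positivity) (by positivity)
      (by positivity) (by positivity) hd0 ha0 hd0' ha0' (by ring) (by ring) hc0 hc1
    have e1 : (1 - n / N) * (x * θ ^ 2) + n / N * d = d₁ := by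
      rw [hdN, hdn]; linear_combination (-θ ^ 2 * (1 - θ ^ 2)) * hcN
    have e2 : (1 - n / N) * ((1 - x) * θ) + n / N * a = a₁ := by
      rw [haN, han]; linear_combination (2 * θ ^ 2 * (1 - θ)) * hcN
    have e3 : (1 - n / N) * (x * (1 - θ ^ 2)) + n / N * (x - d) = d₂ := by linarith
    have e4 : (1 - n / N) * ((1 - x) * (1 - θ)) + n / N * (1 - x - a) = a₂ := by linarith
    rw [e1, e2, e3, e4] at this
    refine this.trans ?_
    have b1 := mul_le_mul_of_nonneg_left hstart (sub_nonneg.2 hc1)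
    have b2 := mul_le_mul_of_nonneg_left hend hc0
    linarith
  -- As n grows from 0, the special value of V exhausts either the input 0 (at n = x/(1 - θ²)) or
  -- the input 1 (at n = (1 - x)/(2θ²)); the case distinction tells which comes first.
  rcases le_or_gt ((1 + x) * θ ^ 2) (1 - x) with hcase | hcase
  · have hN : x / (1 - θ ^ 2) * (1 - θ ^ 2) = x := div_mul_cancel₀ _ hsq1.ne'
    have hfac : (1 - θ ^ 2) = (1 - θ) * (1 + θ) := by ring
    refine hline (x / (1 - θ ^ 2)) 0 (θ * (1 - x) + 2 * x * θ ^ 2 / (1 + θ)) (by positivity) ?_ ?_ ?_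
      le_rfl (by linarith) (by positivity) ?_ ?_
    · rw [le_div_iff₀ hsq1]
      have : 0 ≤ θ ^ 2 * (x - n * (1 - θ ^ 2)) := hdn ▸ hd₁
      linarith [nonneg_of_mul_nonneg_right this hsq]
    · rw [hN]; ring
    · rw [hfac]; field_simp
    · have : 1 - x - (θ * (1 - x) + 2 * x * θ ^ 2 / (1 + θ))
          = (1 - x - (1 + x) * θ ^ 2) / (1 + θ) := by field_simp; ring
      rw [this]
      exact div_nonneg (by linarith) hp.le
    · rw [sub_zero, dualBound_edgeOne h0 h1 hθ0 hθ1]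
      exact edgeOne_le hb.one_le h0 h1 hθ0.le hcase
  · have hN : (1 - x) / (2 * θ ^ 2) * (2 * θ ^ 2) = 1 - x := div_mul_cancel₀ _ (by positivity)
    set d := θ ^ 2 * x - (1 - x) * (1 - θ ^ 2) / 2 with hdd
    have hd0 : 0 ≤ d := by rw [hdd]; nlinarith
    have hdx : 0 ≤ x - d := by
      have : x - d = (1 + x) / 2 * (1 - θ ^ 2) := by rw [hdd]; ring
      rw [this]; positivity
    refine hline ((1 - x) / (2 * θ ^ 2)) d (1 - x) (by positivity) ?_ ?_ ?_ hd0 hdx hd.le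
      (by linarith) ?_
    · rw [le_div_iff₀ (by positivity)]
      have : a₂ = (1 - θ) * (1 - x - n * (2 * θ ^ 2)) := by
        linear_combination hx' - han
      have h3 : 0 ≤ (1 - θ) * (1 - x - n * (2 * θ ^ 2)) := this ▸ ha₂
      linarith [nonneg_of_mul_nonneg_right h3 hm]
    · rw [hdd]; linear_combination ((1 - θ ^ 2) / 2) * hN
    · linear_combination -(1 - θ) * hN
    · rw [sub_self, dualBound_edgeTwo h0 h1 hθ0 hθ1 hdd]
      exact edgeTwo_le hb.one_le h0 h1 hb.edge hd0 (by linarith)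

/-! ### Reduction to two values of U -/

/-- The weighted sum rate `α I(U;Y) + I(V;Z) - I(U;V)` for total mass one, in terms of the masses
`s u v` at the input `0` and `t u v` at the input `1`. -/
def sumRate {U V : Type*} [Fintype U] [Fintype V] (α : ℝ) (s t : U → V → ℝ) : ℝ :=
  α * (outEnt (∑ u, ∑ v, s u v) (∑ u, ∑ v, t u v) - ∑ u, outEnt (∑ v, s u v) (∑ v, t u v))
    + (outEnt (∑ u, ∑ v, t u v) (∑ u, ∑ v, s u v) - ∑ v, outEnt (∑ u, t u v) (∑ u, s u v))
    - (∑ u, negMulLog (∑ v, (s u v + t u v)) + ∑ v, negMulLog (∑ u, (s u v + t u v))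
      - ∑ u, ∑ v, negMulLog (s u v + t u v))

section Reduction

variable {ι : Type*} [Fintype ι]

/-- The step length is the least ratio `w i / -L i` over the decreasing coordinates, that is, the
first moment at which a positive weight reaches zero. -/
lemma exists_step {w L : ι → ℝ} (hw : ∀ i, 0 ≤ w i) (hL : ∃ i, L i < 0)
    (hwL : ∀ i, w i = 0 → L i = 0) :
    ∃ r > 0, (∀ i, 0 ≤ w i + r * L i) ∧ ∃ j, w j ≠ 0 ∧ w j + r * L j = 0 := by
  classical
  obtain ⟨i₀, hi₀⟩ := hL
  obtain ⟨j, hj, hmin⟩ := Finset.exists_min_image (Finset.univ.filter fun i => L i < 0)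
    (fun i => w i / -L i) ⟨i₀, by simpa using hi₀⟩
  have hj : L j < 0 := by simpa using hj
  have hwj : w j ≠ 0 := fun h => hj.ne (hwL j h)
  have hr : 0 < w j / -L j := div_pos ((hw j).lt_of_ne' hwj) (by linarith)
  refine ⟨w j / -L j, hr, fun i => ?_, j, hwj, ?_⟩
  · rcases lt_or_ge (L i) 0 with h | h
    · have := hmin i (by simpa using h)
      rw [le_div_iff₀ (by linarith)] at this
      linarith
    · have := hw i
      positivity
  · rw [div_mul_eq_mul_div, div_neg, mul_div_cancel_right₀ _ hj.ne, add_neg_cancel]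

/-- A convex function of nonnegative weights with two linear constraints is dominated by its values
at weights with at most two nonzero entries. -/
lemma exists_card_support_le_two {a b : ι → ℝ} {f : (ι → ℝ) → ℝ}
    (hf : ConvexOn ℝ {w | ∀ i, 0 ≤ w i} f) (w : ι → ℝ) (hw : ∀ i, 0 ≤ w i)
    (hab : ∀ i, w i ≠ 0 → 0 < a i + b i) :
    ∃ w' : ι → ℝ, (∀ i, 0 ≤ w' i) ∧ ∑ i, w' i * a i = ∑ i, w i * a i ∧
      ∑ i, w' i * b i = ∑ i, w i * b i ∧ f w ≤ f w' ∧ {i | w' i ≠ 0}.ncard ≤ 2 := by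
  classical
  induction hn : {i | w i ≠ 0}.ncard using Nat.strong_induction_on generalizing w with
  | _ n ih =>
    rcases le_or_gt n 2 with h2 | h2
    · exact ⟨w, hw, rfl, rfl, le_rfl, hn ▸ h2⟩
    -- a direction preserving the constraints
    obtain ⟨L, hL0, hLa, hLb, hLw⟩ : ∃ L : ι → ℝ, L ≠ 0 ∧ ∑ i, L i * a i = 0 ∧ ∑ i, L i * b i = 0 ∧
        ∀ i, w i = 0 → L i = 0 := by
      let Φ : (ι → ℝ) →ₗ[ℝ] (ℝ × ℝ) × ({i // w i = 0} → ℝ) :=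
        { toFun := fun L => ((∑ i, L i * a i, ∑ i, L i * b i), fun i => L i)
          map_add' := fun L L' => by
            ext <;> simp [add_mul, Finset.sum_add_distrib]
          map_smul' := fun c L => by
            ext <;> simp [mul_assoc, Finset.mul_sum] }
      have hcard : Fintype.card {i // w i = 0} + n = Fintype.card ι := by
        have h3 := Set.ncard_add_ncard_compl {i | w i ≠ 0}
        have h4 : {i | w i ≠ 0}ᶜ.ncard = Fintype.card {i // w i = 0} := by
          rw [← Nat.card_eq_fintype_card, ← Nat.card_coe_set_eq]
          exact Nat.card_congr (Equiv.subtypeEquivRight fun i => by simp)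
        rw [hn, h4, Nat.card_eq_fintype_card] at h3
        omega
      have hker : LinearMap.ker Φ ≠ ⊥ := by
        refine Φ.ker_ne_bot_of_finrank_lt ?_
        simp only [Module.finrank_prod, Module.finrank_fintype_fun_eq_card, Module.finrank_self]
        omega
      obtain ⟨L, hL, hL0⟩ := Submodule.exists_mem_ne_zero_of_ne_bot hker
      rw [LinearMap.mem_ker] at hL
      have h3 := congrArg Prod.fst hL
      have h4 := congrArg Prod.snd hL
      exact ⟨L, hL0, congrArg Prod.fst h3, congrArg Prod.snd h3, fun i hi => congrFun h4 ⟨i, hi⟩⟩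
    have hsum : ∑ i, L i * (a i + b i) = 0 := by
      simp only [mul_add, Finset.sum_add_distrib, hLa, hLb, add_zero]
    obtain ⟨i₀, hi₀⟩ := Function.ne_iff.1 hL0
    -- The sum of the constraints has positive coefficients on the support, so a nonzero direction
    -- in their kernel has entries of both signs; moving either way eventually kills a weight.
    have hneg : ∀ M : ι → ℝ, M i₀ ≠ 0 → (∀ i, w i = 0 → M i = 0) → ∑ i, M i * (a i + b i) = 0 →
        ∃ i, M i < 0 := fun M hM hMw hMs => by
      by_contra! h
      have hnn : ∀ i ∈ Finset.univ, 0 ≤ M i * (a i + b i) := fun i _ => by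
        by_cases hi : w i = 0
        · simp [hMw i hi]
        · exact mul_nonneg (h i) (hab i hi).le
      have := (Finset.sum_eq_zero_iff_of_nonneg hnn).1 hMs i₀ (Finset.mem_univ _)
      rcases mul_eq_zero.1 this with h' | h'
      · exact hM h'
      · exact (hab i₀ fun h0 => hM (hMw i₀ h0)).ne' h'
    obtain ⟨r, hr, hr1, j, hj, hj'⟩ := exists_step hw (hneg L hi₀ hLw hsum) hLw
    obtain ⟨r', hr', hr1', j', hjw', hj''⟩ := exists_step (L := -L) hw
      (hneg (-L) (by simpa using hi₀) (fun i hi => by simp [hLw i hi]) (by simpa using hsum))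
      (fun i hi => by simp [hLw i hi])
    have hstep : ∀ ρ : ℝ, (∀ i, 0 ≤ w i + ρ * L i) → (∃ j, w j ≠ 0 ∧ w j + ρ * L j = 0) →
        f w ≤ f (fun i => w i + ρ * L i) →
        ∃ w' : ι → ℝ, (∀ i, 0 ≤ w' i) ∧ ∑ i, w' i * a i = ∑ i, w i * a i ∧
          ∑ i, w' i * b i = ∑ i, w i * b i ∧ f w ≤ f w' ∧ {i | w' i ≠ 0}.ncard ≤ 2 := by
      rintro ρ h1 ⟨j, hj, hj'⟩ hle
      have hsub : {i | w i + ρ * L i ≠ 0} ⊆ {i | w i ≠ 0} := fun i hi h0 => hi (by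
        rw [h0, hLw i h0]; simp)
      obtain ⟨w', c1, c2, c3, c4, c5⟩ := ih _ (hn ▸ Set.ncard_lt_ncard
        ⟨hsub, fun h => h hj hj'⟩ (Set.toFinite _)) _ h1 (fun i hi => hab i (hsub hi)) rfl
      refine ⟨w', c1, c2.trans ?_, c3.trans ?_, hle.trans c4, c5⟩
      · simp only [add_mul, Finset.sum_add_distrib, mul_assoc, ← Finset.mul_sum, hLa, mul_zero,
          add_zero]
      · simp only [add_mul, Finset.sum_add_distrib, mul_assoc, ← Finset.mul_sum, hLb, mul_zero,
          add_zero]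
    have hr2 : ∀ i, 0 ≤ w i + -r' * L i := fun i => by simpa using hr1' i
    have hmid : f w ≤ max (f fun i => w i + r * L i) (f fun i => w i + -r' * L i) := by
      have h3 : 0 ≤ r' / (r + r') := by positivity
      have h4 : 0 ≤ r / (r + r') := by positivity
      have h5 : r' / (r + r') + r / (r + r') = 1 := by field_simp; ring
      have := hf.2 (x := fun i => w i + r * L i) hr1 (y := fun i => w i + -r' * L i) hr2 h3 h4 h5
      have e : (r' / (r + r')) • (fun i => w i + r * L i) + (r / (r + r')) • (fun i => w i + -r' * L i)
          = w := by
        ext i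
        simp only [Pi.add_apply, Pi.smul_apply, smul_eq_mul]
        field_simp
        ring
      rw [e] at this
      refine this.trans (Convex.combo_le_max _ _ h3 h4 h5)
    rcases le_max_iff.1 hmid with h | h
    · exact hstep r hr1 ⟨j, hj, hj'⟩ h
    · exact hstep (-r') hr2 ⟨j', hjw', by simpa using hj''⟩ h

end Reduction
-- The terms w log w of H(U) and H(U,V) cancel, and H(V) cancels between I(V;Z) and I(U;V). Apart
-- from the input totals, what remains is linear in the weights minus H(V,Z).
lemma sumRate_smul_eq {U V : Type*} [Fintype U] [Fintype V] (α : ℝ) (s t : U → V → ℝ) (w : U → ℝ) :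
    sumRate α (fun u v => w u * s u v) (fun u v => w u * t u v)
      = α * outEnt (∑ u, w u * ∑ v, s u v) (∑ u, w u * ∑ v, t u v)
        + outEnt (∑ u, w u * ∑ v, t u v) (∑ u, w u * ∑ v, s u v)
        + (∑ u, w u * (-α * outEnt (∑ v, s u v) (∑ v, t u v) - negMulLog (∑ v, (s u v + t u v))
            + ∑ v, negMulLog (s u v + t u v))
          - ∑ v, (negMulLog ((∑ u, w u * t u v) / 2)
            + negMulLog ((∑ u, w u * t u v) / 2 + ∑ u, w u * s u v))) := by
  have e1 : ∀ u v, w u * s u v + w u * t u v = w u * (s u v + t u v) := fun u v => by ring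
  have e2 : ∀ v, outEnt (∑ u, w u * t u v) (∑ u, w u * s u v)
      = negMulLog ((∑ u, w u * t u v) / 2)
        + negMulLog ((∑ u, w u * t u v) / 2 + ∑ u, w u * s u v)
        - negMulLog (∑ u, w u * (s u v + t u v)) := fun v => by
    rw [outEnt, ← Finset.sum_add_distrib]
    simp only [← mul_add, add_comm (t _ v)]
  have e3 : ∀ u, negMulLog (w u * ∑ v, (s u v + t u v))
      = (∑ v, (s u v + t u v)) * negMulLog (w u) + w u * negMulLog (∑ v, (s u v + t u v)) :=
    fun u => negMulLog_mul _ _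
  have e4 : ∀ u v, negMulLog (w u * (s u v + t u v))
      = (s u v + t u v) * negMulLog (w u) + w u * negMulLog (s u v + t u v) :=
    fun u v => negMulLog_mul _ _
  simp only [sumRate, e1, e2, ← Finset.mul_sum, outEnt_smul, e3, e4]
  simp only [Finset.sum_add_distrib, Finset.sum_sub_distrib, ← Finset.sum_mul, mul_add, mul_sub]
  have e5 : ∑ u, w u * (-α * outEnt (∑ v, s u v) (∑ v, t u v))
      = -α * ∑ u, w u * outEnt (∑ v, s u v) (∑ v, t u v) := by
    rw [Finset.mul_sum]; exact Finset.sum_congr rfl fun u _ => by ring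
  rw [e5]
  simp only [← Finset.mul_sum]
  ring

lemma convexOn_sumRate_aux {U V : Type*} [Fintype U] [Fintype V] (c : U → ℝ) {s t : U → V → ℝ}
    (hs : ∀ u v, 0 ≤ s u v) (ht : ∀ u v, 0 ≤ t u v) :
    ConvexOn ℝ {w : U → ℝ | ∀ i, 0 ≤ w i} fun w => ∑ u, w u * c u
      - ∑ v, (negMulLog ((∑ u, w u * t u v) / 2)
        + negMulLog ((∑ u, w u * t u v) / 2 + ∑ u, w u * s u v)) := by
  refine ⟨fun w hw w' hw' a b ha hb _ i => ?_, fun w hw w' hw' a b ha hb hab => ?_⟩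
  · have := hw i
    have := hw' i
    simp only [Pi.add_apply, Pi.smul_apply, smul_eq_mul]
    positivity
  have lin : ∀ g : U → ℝ, ∑ u, (a • w + b • w') u * g u
      = a * ∑ u, w u * g u + b * ∑ u, w' u * g u := fun g => by
    rw [Finset.mul_sum, Finset.mul_sum, ← Finset.sum_add_distrib]
    refine Finset.sum_congr rfl fun u _ => ?_
    simp only [Pi.add_apply, Pi.smul_apply, smul_eq_mul]
    ring
  simp only [lin, smul_eq_mul]
  have key : ∀ v, a * (negMulLog ((∑ u, w u * t u v) / 2)
        + negMulLog ((∑ u, w u * t u v) / 2 + ∑ u, w u * s u v))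
      + b * (negMulLog ((∑ u, w' u * t u v) / 2)
        + negMulLog ((∑ u, w' u * t u v) / 2 + ∑ u, w' u * s u v))
      ≤ negMulLog ((a * ∑ u, w u * t u v + b * ∑ u, w' u * t u v) / 2)
        + negMulLog ((a * ∑ u, w u * t u v + b * ∑ u, w' u * t u v) / 2
          + (a * ∑ u, w u * s u v + b * ∑ u, w' u * s u v)) := fun v => by
    have p1 : 0 ≤ ∑ u, w u * t u v := Finset.sum_nonneg fun u _ => mul_nonneg (hw u) (ht u v)
    have p2 : 0 ≤ ∑ u, w' u * t u v := Finset.sum_nonneg fun u _ => mul_nonneg (hw' u) (ht u v)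
    have p3 : 0 ≤ ∑ u, w u * s u v := Finset.sum_nonneg fun u _ => mul_nonneg (hw u) (hs u v)
    have p4 : 0 ≤ ∑ u, w' u * s u v := Finset.sum_nonneg fun u _ => mul_nonneg (hw' u) (hs u v)
    have n1 := concaveOn_negMulLog.2 (mem_Ici.2 (div_nonneg p1 two_pos.le))
      (mem_Ici.2 (div_nonneg p2 two_pos.le)) ha hb hab
    have n2 := concaveOn_negMulLog.2 (mem_Ici.2 (add_nonneg (div_nonneg p1 two_pos.le) p3))
      (mem_Ici.2 (add_nonneg (div_nonneg p2 two_pos.le) p4)) ha hb hab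
    simp only [smul_eq_mul] at n1 n2
    refine le_trans (le_of_eq ?_) ((add_le_add n1 n2).trans (le_of_eq ?_))
    · ring
    · congr 1
      · congr 1; ring
      · congr 1; ring
  have := Finset.sum_le_sum fun v (_ : v ∈ Finset.univ) => key v
  rw [Finset.sum_add_distrib, ← Finset.mul_sum, ← Finset.mul_sum] at this
  linarith

/-- `sumRate` for two values of `U`. -/
def pairRate {V : Type*} [Fintype V] (α : ℝ) (s₁ t₁ s₂ t₂ : V → ℝ) : ℝ :=
  α * (outEnt (∑ v, s₁ v + ∑ v, s₂ v) (∑ v, t₁ v + ∑ v, t₂ v)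
      - (outEnt (∑ v, s₁ v) (∑ v, t₁ v) + outEnt (∑ v, s₂ v) (∑ v, t₂ v)))
    + (outEnt (∑ v, t₁ v + ∑ v, t₂ v) (∑ v, s₁ v + ∑ v, s₂ v)
      - ∑ v, outEnt (t₁ v + t₂ v) (s₁ v + s₂ v))
    - (negMulLog (∑ v, (s₁ v + t₁ v)) + negMulLog (∑ v, (s₂ v + t₂ v))
      + ∑ v, negMulLog ((s₁ v + t₁ v) + (s₂ v + t₂ v))
      - (∑ v, negMulLog (s₁ v + t₁ v) + ∑ v, negMulLog (s₂ v + t₂ v)))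

lemma pairRate_comm {V : Type*} [Fintype V] (α : ℝ) (s₁ t₁ s₂ t₂ : V → ℝ) :
    pairRate α s₁ t₁ s₂ t₂ = pairRate α s₂ t₂ s₁ t₁ := by
  simp only [pairRate, add_comm (∑ v, s₁ v), add_comm (∑ v, t₁ v), add_comm (s₁ _ + t₁ _),
    add_comm (t₁ _) (t₂ _), add_comm (s₁ _) (s₂ _)]
  ring

lemma sumRate_eq_pairRate {U V : Type*} [Fintype U] [Fintype V] (α : ℝ) {s t : U → V → ℝ} {i j : U}
    (hij : i ≠ j) (hs : ∀ u, u ≠ i ∧ u ≠ j → s u = 0) (ht : ∀ u, u ≠ i ∧ u ≠ j → t u = 0) :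
    sumRate α s t = pairRate α (s i) (t i) (s j) (t j) := by
  have key : ∀ g : (V → ℝ) → (V → ℝ) → ℝ, g 0 0 = 0 →
      ∑ u, g (s u) (t u) = g (s i) (t i) + g (s j) (t j) := fun g hg =>
    Fintype.sum_eq_add i j hij fun u hu => by rw [hs u hu, ht u hu, hg]
  simp only [sumRate, pairRate]
  rw [key (fun a b => ∑ v, a v) (by simp), key (fun a b => ∑ v, b v) (by simp),
    key (fun a b => outEnt (∑ v, a v) (∑ v, b v)) (by simp),
    key (fun a b => negMulLog (∑ v, (a v + b v))) (by simp),
    key (fun a b => ∑ v, negMulLog (a v + b v)) (by simp)]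
  have k1 := fun v => key (fun a _ => a v) (by simp)
  have k2 := fun v => key (fun _ b => b v) (by simp)
  have k3 := fun v => key (fun a b => a v + b v) (by simp)
  simp only [k1, k2, k3]

lemma sumRate_eq_pairRate_zero {U V : Type*} [Fintype U] [Fintype V] (α : ℝ) {s t : U → V → ℝ}
    {i : U} (hs : ∀ u, u ≠ i → s u = 0) (ht : ∀ u, u ≠ i → t u = 0) :
    sumRate α s t = pairRate α (s i) (t i) 0 0 := by
  have key : ∀ g : (V → ℝ) → (V → ℝ) → ℝ, g 0 0 = 0 →
      ∑ u, g (s u) (t u) = g (s i) (t i) := fun g hg =>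
    Fintype.sum_eq_single i fun u hu => by rw [hs u hu, ht u hu, hg]
  simp only [sumRate, pairRate]
  rw [key (fun a b => ∑ v, a v) (by simp), key (fun a b => ∑ v, b v) (by simp),
    key (fun a b => outEnt (∑ v, a v) (∑ v, b v)) (by simp),
    key (fun a b => negMulLog (∑ v, (a v + b v))) (by simp),
    key (fun a b => ∑ v, negMulLog (a v + b v)) (by simp)]
  have k1 := fun v => key (fun a _ => a v) (by simp)
  have k2 := fun v => key (fun _ b => b v) (by simp)
  have k3 := fun v => key (fun a b => a v + b v) (by simp)
  simp only [k1, k2, k3]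
  simp

/-- The majorant is linear, so summing it over v gives a bound by the marginal masses alone. -/
lemma pairRate_le_dualBound {V : Type*} [Fintype V] (α : ℝ) {s₁ t₁ s₂ t₂ : V → ℝ}
    (hs₁ : ∀ v, 0 ≤ s₁ v) (ht₁ : ∀ v, 0 ≤ t₁ v) (hs₂ : ∀ v, 0 ≤ s₂ v) (ht₂ : ∀ v, 0 ≤ t₂ v)
    {A₁ B₁ A₂ B₂ : ℝ} (hA₁ : 0 ≤ A₁) (hA₂ : 0 ≤ A₂) (h₁ : 0 < ∑ v, s₁ v → 0 < A₁)
    (h₁' : 0 < ∑ v, t₁ v → 0 < B₁) (h₂ : 0 < ∑ v, s₂ v → 0 < A₂) (h₂' : 0 < ∑ v, t₂ v → 0 < B₂)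
    (h : ∀ τ, 0 ≤ τ → max A₁ (B₁ * τ) + max A₂ (B₂ * τ) ≤ 1 + τ ^ 2) :
    pairRate α s₁ t₁ s₂ t₂ ≤
      dualBound α (∑ v, s₁ v) (∑ v, t₁ v) (∑ v, s₂ v) (∑ v, t₂ v) A₁ B₁ A₂ B₂ := by
  have pos : ∀ {g : V → ℝ}, (∀ v, 0 ≤ g v) → ∀ v, 0 < g v → 0 < ∑ v, g v := fun hg v hv =>
    hv.trans_le (Finset.single_le_sum (fun v _ => hg v) (Finset.mem_univ v))
  have key := Finset.sum_le_sum fun v (_ : v ∈ Finset.univ) =>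
    negMulLog_add_le (hs₁ v) (ht₁ v) (hs₂ v) (ht₂ v) hA₁ hA₂ (fun hv => h₁ (pos hs₁ v hv))
      (fun hv => h₁' (pos ht₁ v hv)) (fun hv => h₂ (pos hs₂ v hv)) (fun hv => h₂' (pos ht₂ v hv)) h
  have e : ∀ v, outEnt (t₁ v + t₂ v) (s₁ v + s₂ v) = negMulLog ((t₁ v + t₂ v) / 2)
      + negMulLog ((t₁ v + t₂ v) / 2 + (s₁ v + s₂ v))
      - negMulLog ((s₁ v + t₁ v) + (s₂ v + t₂ v)) := fun v => by
    rw [outEnt]; congr 2; ring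
  simp only [Finset.sum_add_distrib, ← Finset.sum_mul] at key
  simp only [pairRate, dualBound, e, Finset.sum_sub_distrib, Finset.sum_add_distrib]
  linarith

lemma pairRate_le {V : Type*} [Fintype V] {α x : ℝ} (hb : Balanced α x) (h0 : 0 < x) (h1 : x < 1)
    {s₁ t₁ s₂ t₂ : V → ℝ} (hs₁ : ∀ v, 0 ≤ s₁ v) (ht₁ : ∀ v, 0 ≤ t₁ v) (hs₂ : ∀ v, 0 ≤ s₂ v)
    (ht₂ : ∀ v, 0 ≤ t₂ v) (hx : ∑ v, s₁ v + ∑ v, s₂ v = x)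
    (hx' : ∑ v, t₁ v + ∑ v, t₂ v = 1 - x) :
    pairRate α s₁ t₁ s₂ t₂ ≤
      max (α * (outEnt x (1 - x) - x * log 2)) (outEnt (1 - x) x - (1 - x) * log 2) := by
  wlog hord : (∑ v, s₁ v) * (∑ v, t₂ v) ≤ (∑ v, s₂ v) * (∑ v, t₁ v) generalizing s₁ t₁ s₂ t₂
  · rw [pairRate_comm]
    exact this hs₂ ht₂ hs₁ ht₁ (by linarith) (by linarith) (le_of_not_ge hord)
  obtain ⟨A₁, B₁, A₂, B₂, hA₁, hA₂, h₁, h₁', h₂, h₂', h, hle⟩ := exists_dualBound_le hb h0 h1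
    (Finset.sum_nonneg fun v _ => hs₁ v) (Finset.sum_nonneg fun v _ => ht₁ v)
    (Finset.sum_nonneg fun v _ => hs₂ v) (Finset.sum_nonneg fun v _ => ht₂ v) hx hx' hord
  exact (pairRate_le_dualBound α hs₁ ht₁ hs₂ ht₂ hA₁ hA₂ h₁ h₁' h₂ h₂' h).trans hle

lemma pairRate_le_of_degenerate {V : Type*} [Fintype V] {α x : ℝ} (hx01 : x = 0 ∨ x = 1)
    {s₁ t₁ s₂ t₂ : V → ℝ} (hs₁ : ∀ v, 0 ≤ s₁ v) (ht₁ : ∀ v, 0 ≤ t₁ v) (hs₂ : ∀ v, 0 ≤ s₂ v)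
    (ht₂ : ∀ v, 0 ≤ t₂ v) (hx : ∑ v, s₁ v + ∑ v, s₂ v = x)
    (hx' : ∑ v, t₁ v + ∑ v, t₂ v = 1 - x) :
    pairRate α s₁ t₁ s₂ t₂ ≤
      max (α * (outEnt x (1 - x) - x * log 2)) (outEnt (1 - x) x - (1 - x) * log 2) := by
  refine le_max_of_le_right ?_
  have p1 := Finset.sum_nonneg fun v (_ : v ∈ Finset.univ) => hs₁ v
  have p2 := Finset.sum_nonneg fun v (_ : v ∈ Finset.univ) => ht₁ v
  have p3 := Finset.sum_nonneg fun v (_ : v ∈ Finset.univ) => hs₂ v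
  have p4 := Finset.sum_nonneg fun v (_ : v ∈ Finset.univ) => ht₂ v
  -- Here X is constant; multipliers m and 2m for an atom of mass m are admissible because 2τ ≤ 1 +
  -- τ² and the masses add up to one.
  have key := pairRate_le_dualBound α hs₁ ht₁ hs₂ ht₂ (A₁ := ∑ v, s₁ v + ∑ v, t₁ v)
    (B₁ := 2 * (∑ v, s₁ v + ∑ v, t₁ v)) (A₂ := ∑ v, s₂ v + ∑ v, t₂ v)
    (B₂ := 2 * (∑ v, s₂ v + ∑ v, t₂ v)) (by positivity) (by positivity) (fun h => by positivity)
    (fun h => by positivity) (fun h => by positivity) (fun h => by positivity) (fun τ hτ => by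
      have hm : ∀ p : ℝ, 0 ≤ p → max p (2 * p * τ) ≤ p * (1 + τ ^ 2) := fun p hp =>
        max_le (by nlinarith [mul_nonneg hp (sq_nonneg τ)])
          (by nlinarith [mul_nonneg hp (sq_nonneg (τ - 1))])
      refine (add_le_add (hm _ (add_nonneg p1 p2)) (hm _ (add_nonneg p3 p4))).trans (le_of_eq ?_)
      linear_combination (1 + τ ^ 2) * (hx + hx'))
  refine key.trans (le_of_eq ?_)
  have f : ∀ a : ℝ, a * log (2 * a) = a * log 2 - negMulLog a := fun a => by
    rcases eq_or_ne a 0 with rfl | h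
    · simp
    · rw [log_mul two_ne_zero h, negMulLog]; ring
  rcases hx01 with rfl | rfl
  · have q1 : ∑ v, s₁ v = 0 := by linarith
    have q2 : ∑ v, s₂ v = 0 := by linarith
    rw [sub_zero] at hx'
    simp only [q1, q2, dualBound, f, hx', add_zero, outEnt_zero_left, outEnt_zero_right, zero_add,
      zero_mul, sub_zero]
    linear_combination (-log 2) * hx'
  · have q1 : ∑ v, t₁ v = 0 := by linarith
    have q2 : ∑ v, t₂ v = 0 := by linarith
    simp only [q1, q2, dualBound, hx, add_zero, outEnt_zero_left, outEnt_zero_right, sub_self,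
      zero_mul, sub_zero, negMulLog]
    linear_combination (-α * log 2) * hx

/-- Reduction to two values of `U`. -/
lemma sumRate_le_of_pairRate_le {U V : Type*} [Fintype U] [Fintype V] {α M : ℝ} {s t : U → V → ℝ}
    (hs : ∀ u v, 0 ≤ s u v) (ht : ∀ u v, 0 ≤ t u v)
    (h : ∀ s₁ t₁ s₂ t₂ : V → ℝ, (∀ v, 0 ≤ s₁ v) → (∀ v, 0 ≤ t₁ v) → (∀ v, 0 ≤ s₂ v) →
      (∀ v, 0 ≤ t₂ v) → ∑ v, s₁ v + ∑ v, s₂ v = ∑ u, ∑ v, s u v →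
      ∑ v, t₁ v + ∑ v, t₂ v = ∑ u, ∑ v, t u v → pairRate α s₁ t₁ s₂ t₂ ≤ M)
    (hpos : 0 < ∑ u, ∑ v, s u v + ∑ u, ∑ v, t u v) :
    sumRate α s t ≤ M := by
  classical
  have ps : ∀ u, 0 ≤ ∑ v, s u v := fun u => Finset.sum_nonneg fun v _ => hs u v
  have pt : ∀ u, 0 ≤ ∑ v, t u v := fun u => Finset.sum_nonneg fun v _ => ht u v
  -- the indicator of the values of positive mass
  let w : U → ℝ := fun u => if ∑ v, s u v + ∑ v, t u v = 0 then 0 else 1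
  have hw : ∀ u, 0 ≤ w u := fun u => by simp only [w]; split_ifs <;> norm_num
  have hwst : ∀ u v, w u * s u v = s u v ∧ w u * t u v = t u v := fun u v => by
    simp only [w]
    split_ifs with h0
    · have h1 : ∑ v, s u v = 0 := le_antisymm (by linarith [pt u]) (ps u)
      have h2 : ∑ v, t u v = 0 := le_antisymm (by linarith [ps u]) (pt u)
      have h3 := (Finset.sum_eq_zero_iff_of_nonneg fun v _ => hs u v).1 h1 v (Finset.mem_univ v)
      have h4 := (Finset.sum_eq_zero_iff_of_nonneg fun v _ => ht u v).1 h2 v (Finset.mem_univ v)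
      simp [h3, h4]
    · simp
  have hS : ∑ u, w u * ∑ v, s u v = ∑ u, ∑ v, s u v := by
    simp only [Finset.mul_sum, (hwst _ _).1]
  have hT : ∑ u, w u * ∑ v, t u v = ∑ u, ∑ v, t u v := by
    simp only [Finset.mul_sum, (hwst _ _).2]
  obtain ⟨w', hw', hwa, hwb, hle, hcard⟩ := exists_card_support_le_two
    (a := fun u => ∑ v, s u v) (b := fun u => ∑ v, t u v)
    (convexOn_sumRate_aux (fun u => -α * outEnt (∑ v, s u v) (∑ v, t u v)
      - negMulLog (∑ v, (s u v + t u v)) + ∑ v, negMulLog (s u v + t u v)) hs ht) w hw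
    (fun u hu => lt_of_le_of_ne (add_nonneg (ps u) (pt u)) fun h0 => hu (by simp [w, ← h0]))
  have e1 : sumRate α s t = sumRate α (fun u v => w u * s u v) (fun u v => w u * t u v) := by
    simp only [(hwst _ _).1, (hwst _ _).2]
  have e2 : sumRate α s t ≤ sumRate α (fun u v => w' u * s u v) (fun u v => w' u * t u v) := by
    rw [e1, sumRate_smul_eq, sumRate_smul_eq, hwa, hwb]
    exact add_le_add_right hle _
  refine e2.trans ?_
  rw [hS] at hwa
  rw [hT] at hwb
  have n1 : ∀ u v, 0 ≤ w' u * s u v := fun u v => mul_nonneg (hw' u) (hs u v)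
  have n2 : ∀ u v, 0 ≤ w' u * t u v := fun u v => mul_nonneg (hw' u) (ht u v)
  obtain ⟨i, hi⟩ : ∃ i, w' i ≠ 0 := by
    by_contra! h0
    simp only [h0, zero_mul, Finset.sum_const_zero] at hwa hwb
    rw [← hwa, ← hwb] at hpos
    simp at hpos
  by_cases hj : ∃ j, j ≠ i ∧ w' j ≠ 0
  · obtain ⟨j, hji, hj⟩ := hj
    have hsupp : ∀ u, u ≠ i ∧ u ≠ j → w' u = 0 := fun u hu => by
      by_contra h0
      have hsub : ({u, i, j} : Set U) ⊆ {u | w' u ≠ 0} := by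
        rintro x (rfl | rfl | rfl) <;> assumption
      have := Set.ncard_le_ncard hsub (Set.toFinite _)
      have h3 : ({u, i, j} : Set U).ncard = 3 := by
        rw [Set.ncard_eq_toFinset_card']
        simp [Finset.card_insert_of_notMem, hu.1, hu.2, hji.symm]
      omega
    have hsum : ∀ g : U → ℝ, w' i * g i + w' j * g j = ∑ u, w' u * g u := fun g =>
      (Fintype.sum_eq_add (f := fun u => w' u * g u) i j hji.symm fun u hu => by rw [hsupp u hu, zero_mul]).symm
    rw [sumRate_eq_pairRate α hji.symm (fun u hu => by ext v; simp [hsupp u hu])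
      (fun u hu => by ext v; simp [hsupp u hu])]
    refine h _ _ _ _ (n1 i) (n2 i) (n1 j) (n2 j) ?_ ?_
    · rw [← hwa, ← hsum, Finset.mul_sum, Finset.mul_sum]
    · rw [← hwb, ← hsum, Finset.mul_sum, Finset.mul_sum]
  · push Not at hj
    have hsum : ∀ g : U → ℝ, w' i * g i = ∑ u, w' u * g u := fun g =>
      (Fintype.sum_eq_single (f := fun u => w' u * g u) i fun u hu => by rw [hj u hu, zero_mul]).symm
    rw [sumRate_eq_pairRate_zero α (fun u hu => by ext v; simp [hj u hu])
      (fun u hu => by ext v; simp [hj u hu])]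
    refine h _ _ _ _ (n1 i) (n2 i) (fun v => le_rfl) (fun v => le_rfl) ?_ ?_
    · rw [← hwa, ← hsum, Finset.mul_sum]; simp
    · rw [← hwb, ← hsum, Finset.mul_sum]; simp

/-! ### The information inequality for every α -/

lemma concaveOn_mixEnt_sub {c : ℝ} (hc : 0 ≤ c) :
    ConcaveOn ℝ (Icc 0 (1 / 2)) (mixEnt 0 c (-c)) :=
  concaveOn_mixEnt le_rfl (by norm_num) fun y hy => by
    have h0 := hy.1
    have h1 : 0 < 1 - y := by linarith [hy.2]
    have h2 : 0 < 2 - y := by linarith [hy.2]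
    have : 0 / (y * (1 - y)) + c / (y * (2 - y)) + -c / ((1 - y) * (1 + y))
        = c * (1 - 2 * y) / (y * (2 - y) * ((1 - y) * (1 + y))) := by field_simp; ring
    rw [this]
    exact div_nonneg (mul_nonneg hc (by linarith [hy.2])) (by positivity)

/-- `I(X;Z) ≤ I(X;Y)` if the input `0` is the less likely one. -/
lemma outEnt_sub_le_outEnt_sub {s t : ℝ} (hs : 0 ≤ s) (hst : s ≤ t) :
    outEnt t s - t * log 2 ≤ outEnt s t - s * log 2 := by
  -- Split off the balanced part (s, s), on which the two output entropies agree, from the pure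
  -- remainder (0, t - s).
  have := mixEnt_superadd (concaveOn_mixEnt_sub zero_le_one) hs hs le_rfl (sub_nonneg.2 hst)
    (by linarith) (by linarith) (by linarith) (by linarith)
  simp only [outEnt_zero_left, outEnt_zero_right, add_zero, add_sub_cancel] at this
  linarith

/-- The information inequality for the binary skew-symmetric broadcast channel, for total mass
one. -/
theorem sumRate_le_of_sum_eq_one {U V : Type*} [Fintype U] [Fintype V] {α : ℝ} (hα : 1 ≤ α)
    {s t : U → V → ℝ} (hs : ∀ u v, 0 ≤ s u v) (ht : ∀ u v, 0 ≤ t u v)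
    (h1 : ∑ u, ∑ v, s u v + ∑ u, ∑ v, t u v = 1) :
    sumRate α s t ≤
      max (α * (outEnt (∑ u, ∑ v, s u v) (∑ u, ∑ v, t u v) - (∑ u, ∑ v, s u v) * log 2))
        (outEnt (∑ u, ∑ v, t u v) (∑ u, ∑ v, s u v) - (∑ u, ∑ v, t u v) * log 2) := by
  have ps : ∀ u, 0 ≤ ∑ v, s u v := fun u => Finset.sum_nonneg fun v _ => hs u v
  have pt : ∀ u, 0 ≤ ∑ v, t u v := fun u => Finset.sum_nonneg fun v _ => ht u v
  -- The sum rate is affine in the weight, with slope I(U;Y); `hI0` and `hI1` bound the slope by 0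
  -- and I(X;Y).
  have hlin : ∀ β, sumRate α s t = sumRate β s t + (α - β) * (outEnt (∑ u, ∑ v, s u v)
      (∑ u, ∑ v, t u v) - ∑ u, outEnt (∑ v, s u v) (∑ v, t u v)) := fun β => by
    simp only [sumRate]; ring
  have hI0 := sub_nonneg.2 (sum_outEnt_le Finset.univ ps pt)
  have hI1 : outEnt (∑ u, ∑ v, s u v) (∑ u, ∑ v, t u v) - ∑ u, outEnt (∑ v, s u v) (∑ v, t u v)
      ≤ outEnt (∑ u, ∑ v, s u v) (∑ u, ∑ v, t u v) - (∑ u, ∑ v, s u v) * log 2 := by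
    rw [Finset.sum_mul]
    exact sub_le_sub_left (Finset.sum_le_sum fun u _ => mul_log_two_le_outEnt (ps u) (pt u)) _
  have hx0 : 0 ≤ ∑ u, ∑ v, s u v := Finset.sum_nonneg fun u _ => ps u
  have hx1 : 0 ≤ ∑ u, ∑ v, t u v := Finset.sum_nonneg fun u _ => pt u
  have hT : ∑ u, ∑ v, t u v = 1 - ∑ u, ∑ v, s u v := by linarith
  have hgood : ∀ β, (0 < ∑ u, ∑ v, s u v → ∑ u, ∑ v, s u v < 1 → Balanced β (∑ u, ∑ v, s u v)) →
      sumRate β s t ≤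
      max (β * (outEnt (∑ u, ∑ v, s u v) (∑ u, ∑ v, t u v) - (∑ u, ∑ v, s u v) * log 2))
        (outEnt (∑ u, ∑ v, t u v) (∑ u, ∑ v, s u v) - (∑ u, ∑ v, t u v) * log 2) := fun β hβ => by
    refine sumRate_le_of_pairRate_le hs ht (fun s₁ t₁ s₂ t₂ g1 g2 g3 g4 g5 g6 => ?_) (by linarith)
    rw [hT] at g6 ⊢
    rcases hx0.eq_or_lt with h | h
    · exact pairRate_le_of_degenerate (Or.inl h.symm) g1 g2 g3 g4 g5 g6
    rcases (show ∑ u, ∑ v, s u v ≤ 1 by linarith).eq_or_lt with h' | h'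
    · exact pairRate_le_of_degenerate (Or.inr h') g1 g2 g3 g4 g5 g6
    · exact pairRate_le (hβ h h') h h' g1 g2 g3 g4 g5 g6
  set x := ∑ u, ∑ v, s u v
  set IY := outEnt x (∑ u, ∑ v, t u v) - x * log 2 with hIY
  set IZ := outEnt (∑ u, ∑ v, t u v) x - (∑ u, ∑ v, t u v) * log 2 with hIZ
  have hIY0 : 0 ≤ IY := sub_nonneg.2 (mul_log_two_le_outEnt hx0 hx1)
  -- comparison of the two extreme strategies at `α = 1`
  have hcmp : (x ≤ 1 / 2 → IZ ≤ IY) ∧ (1 / 2 ≤ x → IY ≤ IZ) :=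
    ⟨fun h => outEnt_sub_le_outEnt_sub hx0 (by linarith),
      fun h => outEnt_sub_le_outEnt_sub hx1 (by linarith)⟩
  rcases le_or_gt x (1 / 2) with hx | hx
  · have k1 := hgood 1 fun h _ => balanced_one h hx
    rw [one_mul, max_eq_left (hcmp.1 hx)] at k1
    refine le_max_of_le_left ?_
    rw [hlin 1]
    have := mul_le_mul_of_nonneg_left hI1 (sub_nonneg.2 hα)
    linarith
  · rcases hIY0.eq_or_lt with h | h
    -- If I(X;Y) = 0 then X is constant, so `Balanced` is required only vacuously.
    · have k1 := hgood α fun h2 h3 => by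
        have := mul_log_two_lt_outEnt h2 (show 0 < ∑ u, ∑ v, t u v by linarith)
        linarith
      exact k1
    · have hβ : 1 ≤ IZ / IY := (one_le_div h).2 (hcmp.2 hx.le)
      have hβe : IZ / IY * IY = IZ := div_mul_cancel₀ _ h.ne'
      have k1 := hgood (IZ / IY) fun h2 h3 => balanced_of_eq hβ hx.le h3 (by
        rw [← hT, ← hIY, ← hIZ]; exact hβe)
      rw [hβe, max_self] at k1
      rw [hlin (IZ / IY)]
      -- Below the balancing weight the slope is at least 0 and I(X;Z) is the maximum; above it the
      -- slope is at most I(X;Y) and α I(X;Y) is.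
      rcases le_total α (IZ / IY) with h4 | h4
      · refine le_max_of_le_right ?_
        have := mul_nonneg (sub_nonneg.2 h4) hI0
        linarith
      · refine le_max_of_le_left ?_
        have := mul_le_mul_of_nonneg_left hI1 (sub_nonneg.2 h4)
        linarith

/-- `sumRate` is not homogeneous, since the mutual information of U and V is left unnormalized.
Adding `negMulLog` of the total mass repairs this, which explains the extra term in the next
theorem. -/
lemma sumRate_smul {U V : Type*} [Fintype U] [Fintype V] (α c : ℝ) (s t : U → V → ℝ) :
    sumRate α (fun u v => c * s u v) (fun u v => c * t u v)
      = c * sumRate α s t - (∑ u, ∑ v, s u v + ∑ u, ∑ v, t u v) * negMulLog c := by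
  have e1 : ∀ u v, c * s u v + c * t u v = c * (s u v + t u v) := fun u v => by ring
  have e2 : ∑ v, (∑ u, (s u v + t u v)) * negMulLog c
      = (∑ u, ∑ v, s u v + ∑ u, ∑ v, t u v) * negMulLog c := by
    rw [← Finset.sum_mul, Finset.sum_comm]; simp only [Finset.sum_add_distrib]
  have e3 : ∑ u, (∑ v, (s u v + t u v)) * negMulLog c
      = (∑ u, ∑ v, s u v + ∑ u, ∑ v, t u v) * negMulLog c := by
    rw [← Finset.sum_mul]; simp only [Finset.sum_add_distrib]
  have e4 : ∑ u, ∑ v, (s u v + t u v) * negMulLog c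
      = (∑ u, ∑ v, s u v + ∑ u, ∑ v, t u v) * negMulLog c := by
    simp only [← Finset.sum_mul, Finset.sum_add_distrib]
  have k1 : ∑ u, negMulLog (c * ∑ v, (s u v + t u v))
      = c * ∑ u, negMulLog (∑ v, (s u v + t u v))
        + (∑ u, ∑ v, s u v + ∑ u, ∑ v, t u v) * negMulLog c := by
    simp only [negMulLog_mul c]
    rw [Finset.sum_add_distrib, ← Finset.mul_sum, e3, add_comm]
  have k2 : ∑ v, negMulLog (c * ∑ u, (s u v + t u v))
      = c * ∑ v, negMulLog (∑ u, (s u v + t u v))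
        + (∑ u, ∑ v, s u v + ∑ u, ∑ v, t u v) * negMulLog c := by
    simp only [negMulLog_mul c]
    rw [Finset.sum_add_distrib, ← Finset.mul_sum, e2, add_comm]
  have k3 : ∑ u, ∑ v, negMulLog (c * (s u v + t u v))
      = c * ∑ u, ∑ v, negMulLog (s u v + t u v)
        + (∑ u, ∑ v, s u v + ∑ u, ∑ v, t u v) * negMulLog c := by
    have : ∀ u, ∑ v, negMulLog (c * (s u v + t u v))
        = (∑ v, (s u v + t u v) * negMulLog c) + c * ∑ v, negMulLog (s u v + t u v) := fun u => by
      simp only [negMulLog_mul c]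
      rw [Finset.sum_add_distrib, ← Finset.mul_sum]
    simp only [this]
    rw [Finset.sum_add_distrib, ← Finset.mul_sum, e4, add_comm]
  simp only [sumRate, e1, ← Finset.mul_sum, outEnt_smul, k1, k2, k3]
  ring

/-- The information inequality for arbitrary total mass. -/
theorem sumRate_add_negMulLog_le {U V : Type*} [Fintype U] [Fintype V] {α : ℝ} (hα : 1 ≤ α)
    {s t : U → V → ℝ} (hs : ∀ u v, 0 ≤ s u v) (ht : ∀ u v, 0 ≤ t u v) :
    sumRate α s t + negMulLog (∑ u, ∑ v, s u v + ∑ u, ∑ v, t u v) ≤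
      max (α * (outEnt (∑ u, ∑ v, s u v) (∑ u, ∑ v, t u v) - (∑ u, ∑ v, s u v) * log 2))
        (outEnt (∑ u, ∑ v, t u v) (∑ u, ∑ v, s u v) - (∑ u, ∑ v, t u v) * log 2) := by
  have ps : 0 ≤ ∑ u, ∑ v, s u v := Finset.sum_nonneg fun u _ => Finset.sum_nonneg fun v _ => hs u v
  have pt : 0 ≤ ∑ u, ∑ v, t u v := Finset.sum_nonneg fun u _ => Finset.sum_nonneg fun v _ => ht u v
  rcases (add_nonneg ps pt).eq_or_lt with h | h
  · have h1 : ∑ u, ∑ v, s u v = 0 := by linarith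
    have h2 : ∑ u, ∑ v, t u v = 0 := by linarith
    have h3 : ∀ u v, s u v = 0 := fun u v => (Finset.sum_eq_zero_iff_of_nonneg fun v _ => hs u v).1
      ((Finset.sum_eq_zero_iff_of_nonneg fun u _ => Finset.sum_nonneg fun v _ => hs u v).1 h1 u
        (Finset.mem_univ u)) v (Finset.mem_univ v)
    have h4 : ∀ u v, t u v = 0 := fun u v => (Finset.sum_eq_zero_iff_of_nonneg fun v _ => ht u v).1
      ((Finset.sum_eq_zero_iff_of_nonneg fun u _ => Finset.sum_nonneg fun v _ => ht u v).1 h2 u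
        (Finset.mem_univ u)) v (Finset.mem_univ v)
    simp [sumRate, h3, h4]
  set S := ∑ u, ∑ v, s u v with hS
  set T := ∑ u, ∑ v, t u v with hT
  have hc : 0 ≤ (S + T)⁻¹ := by positivity
  have key := sumRate_le_of_sum_eq_one hα (s := fun u v => (S + T)⁻¹ * s u v)
    (t := fun u v => (S + T)⁻¹ * t u v) (fun u v => mul_nonneg hc (hs u v))
    (fun u v => mul_nonneg hc (ht u v)) (by
      simp only [← Finset.mul_sum, ← hS, ← hT]; field_simp)
  rw [sumRate_smul] at key
  simp only [← Finset.mul_sum, ← hS, ← hT, outEnt_smul] at key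
  have key2 := mul_le_mul_of_nonneg_left key h.le
  have e1 : (S + T) * ((S + T)⁻¹ * sumRate α s t - (S + T) * negMulLog (S + T)⁻¹)
      = sumRate α s t + negMulLog (S + T) := by
    rw [negMulLog, negMulLog, log_inv]; field_simp; ring
  have e2 : (S + T) * max (α * ((S + T)⁻¹ * outEnt S T - (S + T)⁻¹ * S * log 2))
      ((S + T)⁻¹ * outEnt T S - (S + T)⁻¹ * T * log 2)
      = max (α * (outEnt S T - S * log 2)) (outEnt T S - T * log 2) := by
    rw [mul_max_of_nonneg _ _ h.le]
    congr 1 <;> field_simp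
  rwa [e1, e2] at key2

/-! ### Concave envelope over W: two values suffice -/

section Envelope

variable (α l s t : ℝ)

/-- The contribution of a value of `W` for which the first receiver is served. -/
def gainOne : ℝ := (1 - l) * (outEnt s t - outEnt t s) - α * (s * log 2)

/-- The contribution of a value of `W` for which the second receiver is served. -/
def gainTwo : ℝ := l * outEnt t s - (α - 1 + l) * outEnt s t - t * log 2

/-- `gainTwo` is concave where this quadratic form is nonnegative and convex elsewhere. -/
def curvForm : ℝ := l * s ^ 2 - 2 * (α - 1) * (s * t) - (α - 1 + l) * t ^ 2

lemma gainOne_smul (c : ℝ) : gainOne α l (c * s) (c * t) = c * gainOne α l s t := by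
  simp only [gainOne, outEnt_smul]; ring

lemma gainTwo_smul (c : ℝ) : gainTwo α l (c * s) (c * t) = c * gainTwo α l s t := by
  simp only [gainTwo, outEnt_smul]; ring

lemma curvForm_smul (c : ℝ) : curvForm α l (c * s) (c * t) = c ^ 2 * curvForm α l s t := by
  simp only [curvForm]; ring

lemma gainOne_zero_right : gainOne α l s 0 = gainTwo α l s 0 := by
  simp [gainOne, gainTwo]; ring

lemma gainOne_zero_left : gainOne α l 0 t = gainTwo α l 0 t := by
  simp [gainOne, gainTwo]; ring

variable {α l s t} {s' t' : ℝ}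

lemma gainOne_eq : gainOne α l s t
    = 0 * inEnt s t + (1 - l) * outEnt s t + -(1 - l) * outEnt t s - α * (s * log 2) := by
  simp only [gainOne]; ring

lemma gainTwo_eq : gainTwo α l s t
    = 0 * inEnt s t + -(α - 1 + l) * outEnt s t + l * outEnt t s - t * log 2 := by
  simp only [gainTwo]; ring

lemma gainOne_superadd (hl1 : l ≤ 1) (hs : 0 ≤ s) (hst : s ≤ t) (hs' : 0 ≤ s') (hst' : s' ≤ t') :
    gainOne α l s t + gainOne α l s' t' ≤ gainOne α l (s + s') (t + t') := by
  have := mixEnt_superadd (concaveOn_mixEnt_sub (sub_nonneg.2 hl1)) hs (hs.trans hst) hs'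
    (hs'.trans hst') (by linarith) (by linarith) (by linarith) (by linarith)
  rw [gainOne_eq, gainOne_eq, gainOne_eq]
  linarith

/-- For proportions of input 0 above 1/2 the gain is convex, so it lies below its chord from the
balanced input to the pure input 0. -/
lemma gainOne_le_of_le (hl1 : l ≤ 1) (ht : 0 ≤ t) (hst : t ≤ s) :
    gainOne α l s t ≤ gainOne α l t t + gainOne α l (s - t) 0 := by
  have hconv : ConvexOn ℝ (Icc (1 / 2) 1) (mixEnt 0 (1 - l) (-(1 - l))) :=
    convexOn_mixEnt (by norm_num) le_rfl fun y hy => by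
      have h0 : 0 < y := by linarith [hy.1]
      have h1 : 0 < 1 - y := by linarith [hy.2]
      have h2 : 0 < 2 - y := by linarith [hy.2]
      have : 0 / (y * (1 - y)) + (1 - l) / (y * (2 - y)) + -(1 - l) / ((1 - y) * (1 + y))
          = (1 - l) * (1 - 2 * y) / (y * (2 - y) * ((1 - y) * (1 + y))) := by field_simp; ring
      rw [this]
      exact div_nonpos_of_nonpos_of_nonneg
        (mul_nonpos_of_nonneg_of_nonpos (sub_nonneg.2 hl1) (by linarith [hy.1])) (by positivity)
  have := mixEnt_subadd hconv ht ht (sub_nonneg.2 hst) le_rfl (by linarith) (by linarith)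
    (by linarith) (by linarith)
  rw [add_sub_cancel, add_zero] at this
  rw [gainOne_eq, gainOne_eq, gainOne_eq]
  linarith

/-- The region of concavity is a convex cone. For two of its points, the cross term of the quadratic
form is bounded below by comparison with the form at the point of larger ratio t/s. -/
lemma curvForm_add (hα : 1 ≤ α) (hl : 0 ≤ l) (hs : 0 ≤ s) (ht : 0 ≤ t) (hs' : 0 ≤ s') (ht' : 0 ≤ t')
    (h : 0 ≤ curvForm α l s t) (h' : 0 ≤ curvForm α l s' t') :
    0 ≤ curvForm α l (s + s') (t + t') := by
  wlog hle : t * s' ≤ t' * s generalizing s t s' t'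
  · rw [add_comm s, add_comm t]
    exact this hs' ht' hs ht h' h (le_of_not_ge hle)
  have hα' : 0 ≤ α - 1 := by linarith
  have hal : 0 ≤ α - 1 + l := by linarith
  have hb : 0 ≤ l * s * s' - (α - 1) * (s * t' + s' * t) - (α - 1 + l) * (t * t') := by
    rcases hs'.eq_or_lt with h0 | h0
    · subst h0
      have h1 : (α - 1 + l) * t' ^ 2 ≤ 0 := by simp only [curvForm] at h'; linarith
      have h2 : (α - 1 + l) * t' = 0 := by
        rcases ht'.eq_or_lt with h3 | h3
        · simp [← h3]
        · have : α - 1 + l ≤ 0 := by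
            by_contra! h4
            have : 0 < (α - 1 + l) * t' ^ 2 := by positivity
            linarith
          rw [le_antisymm this hal, zero_mul]
      have h3 : (α - 1) * t' = 0 := le_antisymm
        (by have := mul_nonneg hl ht'; linarith) (mul_nonneg hα' ht')
      have : l * s * 0 - (α - 1) * (s * t' + 0 * t) - (α - 1 + l) * (t * t') = 0 := by
        linear_combination (-s) * h3 - t * h2
      exact this.ge
    · have h1 : 0 ≤ (l * s * s' - (α - 1) * (s * t' + s' * t) - (α - 1 + l) * (t * t')) * s' := by
        have h2 := mul_nonneg h' hs
        have h3 : 0 ≤ t' * s - t * s' := by linarith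
        have h4 : 0 ≤ (α - 1) * s' * (t' * s - t * s') := by positivity
        have h5 : 0 ≤ (α - 1 + l) * t' * (t' * s - t * s') := by positivity
        simp only [curvForm] at h2
        linarith
      exact nonneg_of_mul_nonneg_left h1 h0
  simp only [curvForm] at h h' ⊢
  linarith

/-- On the quadrant the form divided by s² decreases with t/s, so it changes sign across at most one
ray. -/
lemma curvForm_mul_le (hα : 1 ≤ α) (hl : 0 ≤ l) (hs : 0 ≤ s) (ht : 0 ≤ t) (hs' : 0 ≤ s')
    (ht' : 0 ≤ t') (hle : t * s' ≤ t' * s) :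
    curvForm α l s' t' * s ^ 2 ≤ curvForm α l s t * s' ^ 2 := by
  have h4 : 0 ≤ (α - 1) * s * s' * (t' * s - t * s') := by positivity
  have h5 : 0 ≤ (α - 1 + l) * (t' * s - t * s') * (t' * s + t * s') := by positivity
  simp only [curvForm]
  linarith

lemma curv_eq {y : ℝ} (h0 : 0 < y) (h1 : y < 1) :
    0 / (y * (1 - y)) + -(α - 1 + l) / (y * (2 - y)) + l / ((1 - y) * (1 + y))
      = curvForm α l y (1 - y) / (y * (2 - y) * ((1 - y) * (1 + y))) := by
  have h2 : 1 - y ≠ 0 := by linarith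
  have h3 : 2 - y ≠ 0 := by linarith
  simp only [curvForm]
  field_simp
  ring

lemma gainTwo_superadd (hα : 1 ≤ α) (hl : 0 ≤ l) (hs : 0 ≤ s) (ht : 0 ≤ t) (hs' : 0 ≤ s')
    (ht' : 0 ≤ t') (h : 0 ≤ curvForm α l s t) (h' : 0 ≤ curvForm α l s' t') :
    gainTwo α l s t + gainTwo α l s' t' ≤ gainTwo α l (s + s') (t + t') := by
  rcases (add_nonneg hs ht).eq_or_lt with hm | hm
  · have h3 : s = 0 := by linarith
    have h4 : t = 0 := by linarith
    simp [h3, h4, gainTwo]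
  rcases (add_nonneg hs' ht').eq_or_lt with hm' | hm'
  · have h3 : s' = 0 := by linarith
    have h4 : t' = 0 := by linarith
    simp [h3, h4, gainTwo]
  obtain ⟨lo, hlo0, hlo1, hlo2, hloc⟩ : ∃ lo, 0 ≤ lo ∧ lo * (s + t) ≤ s ∧ lo * (s' + t') ≤ s' ∧
      0 ≤ curvForm α l lo (1 - lo) := by
    have hnorm : ∀ {a b : ℝ}, 0 < a + b → 0 ≤ curvForm α l a b →
        0 ≤ curvForm α l (a / (a + b)) (1 - a / (a + b)) := fun {a b} hab hq => by
      have e1 : a / (a + b) = (a + b)⁻¹ * a := by field_simp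
      have e2 : 1 - a / (a + b) = (a + b)⁻¹ * b := by field_simp; ring
      rw [e2, e1, curvForm_smul]
      positivity
    rcases le_total (s / (s + t)) (s' / (s' + t')) with hc | hc
    · exact ⟨_, by positivity, (div_mul_cancel₀ _ hm.ne').le, (le_div_iff₀ hm').1 hc, hnorm hm h⟩
    · exact ⟨_, by positivity, (le_div_iff₀ hm).1 hc, (div_mul_cancel₀ _ hm'.ne').le, hnorm hm' h'⟩
  have hconc : ConcaveOn ℝ (Icc lo 1) (mixEnt 0 (-(α - 1 + l)) l) :=
    concaveOn_mixEnt hlo0 le_rfl fun y hy => by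
      have h0 : 0 < y := hlo0.trans_lt hy.1
      have h1 : 0 < 1 - y := by linarith [hy.2]
      have h2 : 0 < 2 - y := by linarith [hy.2]
      rw [curv_eq h0 hy.2]
      refine div_nonneg ?_ (by positivity)
      have hl1 : 0 < 1 - lo := by linarith [hy.1]
      have k1 : 0 ≤ curvForm α l ((1 - y) / (1 - lo) * lo) ((1 - y) / (1 - lo) * (1 - lo)) := by
        rw [curvForm_smul]; positivity
      have k2 : 0 ≤ curvForm α l ((y - lo) / (1 - lo)) 0 := by
        simp only [curvForm, mul_zero, sub_zero, ne_eq, OfNat.ofNat_ne_zero, not_false_eq_true,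
          zero_pow]
        positivity
      have h3 : 0 ≤ y - lo := by linarith [hy.1]
      have k3 := curvForm_add hα hl (by positivity) (by positivity) (by positivity) le_rfl k1 k2
      have e1 : (1 - y) / (1 - lo) * lo + (y - lo) / (1 - lo) = y := by field_simp; ring
      have e2 : (1 - y) / (1 - lo) * (1 - lo) + 0 = 1 - y := by field_simp; ring
      rwa [e1, e2] at k3
  have := mixEnt_superadd hconc hs ht hs' ht' hlo1 (by linarith) hlo2 (by linarith)
  rw [gainTwo_eq, gainTwo_eq, gainTwo_eq]
  linarith

/-- The ray through (s, r) bounds the cone of concavity. Between it and the pure input 1 the gain is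
convex, so it lies below the chord. -/
lemma gainTwo_le (hα : 1 ≤ α) (hl : 0 ≤ l) (hs : 0 < s) {r : ℝ} (hr : 0 ≤ r)
    (hrt : r ≤ t) (hQ : curvForm α l s r = 0) :
    gainTwo α l s t ≤ gainTwo α l s r + gainTwo α l 0 (t - r) := by
  have hm : 0 < s + r := by linarith
  have hhi : s / (s + r) ≤ 1 := (div_le_one hm).2 (by linarith)
  have hconv : ConvexOn ℝ (Icc 0 (s / (s + r))) (mixEnt 0 (-(α - 1 + l)) l) :=
    convexOn_mixEnt le_rfl hhi fun y hy => by
      have h0 := hy.1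
      have h1 : 0 < 1 - y := by linarith [hy.2]
      have h2 : 0 < 2 - y := by linarith [hy.2]
      rw [curv_eq h0 (hy.2.trans_le hhi)]
      refine div_nonpos_of_nonpos_of_nonneg ?_ (by positivity)
      have hy2 := (lt_div_iff₀ hm).1 hy.2
      have := curvForm_mul_le hα hl hs.le hr h0.le h1.le (by linarith)
      rw [hQ, zero_mul] at this
      by_contra! h3
      have : 0 < curvForm α l y (1 - y) * s ^ 2 := by positivity
      linarith
  have := mixEnt_subadd hconv hs.le hr le_rfl (sub_nonneg.2 hrt) (by linarith)
    (div_mul_cancel₀ _ hm.ne').ge (by linarith) (by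
      rw [zero_add]; positivity)
  rw [add_sub_cancel, add_zero] at this
  rw [gainTwo_eq, gainTwo_eq, gainTwo_eq]
  linarith

/-- Every value of `W` splits into two values, one for each receiver, without loss. -/
lemma exists_split (hα : 1 ≤ α) (hl : 0 ≤ l) (hl1 : l ≤ 1) (hs : 0 ≤ s) (ht : 0 ≤ t) :
    ∃ s₀ t₀ s₁ t₁ : ℝ, 0 ≤ s₀ ∧ s₀ ≤ t₀ ∧ 0 ≤ s₁ ∧ 0 ≤ t₁ ∧ 0 ≤ curvForm α l s₁ t₁ ∧ s₀ + s₁ = s ∧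
      t₀ + t₁ = t ∧ max (gainOne α l s t) (gainTwo α l s t) ≤ gainOne α l s₀ t₀ + gainTwo α l s₁ t₁ := by
  have z1 : gainOne α l 0 0 = 0 := by simp [gainOne]
  have z2 : gainTwo α l 0 0 = 0 := by simp [gainTwo]
  have z3 : curvForm α l 0 0 = 0 := by simp [curvForm]
  rcases le_total (gainTwo α l s t) (gainOne α l s t) with h | h
  · rw [max_eq_left h]
    rcases le_total s t with hst | hst
    · exact ⟨s, t, 0, 0, hs, hst, le_rfl, le_rfl, z3.ge, by simp, by simp, by simp [z2]⟩
    · refine ⟨t, t, s - t, 0, ht, le_rfl, sub_nonneg.2 hst, le_rfl, ?_, by ring, by ring, ?_⟩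
      · simp only [curvForm, mul_zero, sub_zero, ne_eq, OfNat.ofNat_ne_zero, not_false_eq_true,
          zero_pow]
        positivity
      -- The pure piece counts the same for either receiver, so it can be handed to the second one.
      · rw [← gainOne_zero_right]
        exact gainOne_le_of_le hl1 ht hst
  · rw [max_eq_right h]
    rcases le_or_gt 0 (curvForm α l s t) with hQ | hQ
    · exact ⟨0, 0, s, t, le_rfl, le_rfl, hs, ht, hQ, by simp, by simp, by simp [z1]⟩
    rcases hs.eq_or_lt with rfl | hs0
    · exact ⟨0, t, 0, 0, le_rfl, ht, le_rfl, le_rfl, z3.ge, by simp, by simp,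
        by rw [z2, gainOne_zero_left, add_zero]⟩
    obtain ⟨r, hr, hr0⟩ : ∃ r ∈ Icc 0 t, curvForm α l s r = 0 := by
      refine intermediate_value_Icc' ht (f := fun r => curvForm α l s r)
        (by unfold curvForm; fun_prop) ⟨hQ.le, ?_⟩
      show 0 ≤ curvForm α l s 0
      simp only [curvForm, mul_zero, sub_zero, ne_eq, OfNat.ofNat_ne_zero, not_false_eq_true,
        zero_pow]
      positivity
    exact ⟨0, t - r, s, r, le_rfl, sub_nonneg.2 hr.2, hs, hr.1, hr0.ge, by ring, by ring, by
      rw [gainOne_zero_left, add_comm]; exact gainTwo_le hα hl hs0 hr.1 hr.2 hr0⟩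

/-- Reduction to two values of `W`. -/
lemma exists_split_sum (hα : 1 ≤ α) (hl : 0 ≤ l) (hl1 : l ≤ 1) {W : Type*} (A : Finset W)
    {s t : W → ℝ} (hs : ∀ w, 0 ≤ s w) (ht : ∀ w, 0 ≤ t w) :
    ∃ s₀ t₀ s₁ t₁ : ℝ, 0 ≤ s₀ ∧ s₀ ≤ t₀ ∧ 0 ≤ s₁ ∧ 0 ≤ t₁ ∧ 0 ≤ curvForm α l s₁ t₁ ∧
      s₀ + s₁ = ∑ w ∈ A, s w ∧ t₀ + t₁ = ∑ w ∈ A, t w ∧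
      ∑ w ∈ A, max (gainOne α l (s w) (t w)) (gainTwo α l (s w) (t w))
        ≤ gainOne α l s₀ t₀ + gainTwo α l s₁ t₁ := by
  classical
  induction A using Finset.induction_on with
  | empty =>
    exact ⟨0, 0, 0, 0, le_rfl, le_rfl, le_rfl, le_rfl, by simp [curvForm], by simp, by simp,
      by simp [gainOne, gainTwo]⟩
  | insert w A hw ih =>
    obtain ⟨s₀, t₀, s₁, t₁, h1, h2, h3, h4, h5, h6, h7, h8⟩ := ih
    obtain ⟨s₀', t₀', s₁', t₁', g1, g2, g3, g4, g5, g6, g7, g8⟩ :=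
      exists_split hα hl hl1 (hs w) (ht w)
    refine ⟨s₀' + s₀, t₀' + t₀, s₁' + s₁, t₁' + t₁, by linarith, by linarith, by linarith,
      by linarith, curvForm_add hα hl g3 g4 h3 h4 g5 h5, ?_, ?_, ?_⟩
    · rw [Finset.sum_insert hw]; linarith
    · rw [Finset.sum_insert hw]; linarith
    · rw [Finset.sum_insert hw]
      have k1 := gainOne_superadd (α := α) hl1 g1 g2 h1 h2
      have k2 := gainTwo_superadd hα hl g3 g4 h3 h4 g5 h5
      linarith

end Envelope

/-! ### The Lagrangian and its saddle point -/

/-- `I(W; Y)` in terms of the masses of `(W, X)`. -/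
def infoOne (q : Fin 2 × Fin 2 → ℝ) : ℝ :=
  outEnt (q (0, 0) + q (1, 0)) (q (0, 1) + q (1, 1))
    - (outEnt (q (0, 0)) (q (0, 1)) + outEnt (q (1, 0)) (q (1, 1)))

/-- `I(W; Z)` in terms of the masses of `(W, X)`. -/
def infoTwo (q : Fin 2 × Fin 2 → ℝ) : ℝ :=
  outEnt (q (0, 1) + q (1, 1)) (q (0, 0) + q (1, 0))
    - (outEnt (q (0, 1)) (q (0, 0)) + outEnt (q (1, 1)) (q (1, 0)))

/-- The private part of the weighted sum rate in terms of the masses of `(W, X)`. -/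
def privRate (α : ℝ) (q : Fin 2 × Fin 2 → ℝ) : ℝ :=
  α * (outEnt (q (0, 0)) (q (0, 1)) - q (0, 0) * log 2)
    + (outEnt (q (1, 1)) (q (1, 0)) - q (1, 1) * log 2)

/-- The weighted sum rate of randomized time division in terms of the masses of `(W, X)`. -/
def tdRate (α : ℝ) (q : Fin 2 × Fin 2 → ℝ) : ℝ :=
  min (infoOne q) (infoTwo q) + (α - 1) * infoOne q + privRate α q

/-- `tdRate` with the minimum replaced by a convex combination. -/
def lagr (α l : ℝ) (q : Fin 2 × Fin 2 → ℝ) : ℝ :=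
  (α - 1 + l) * outEnt (q (0, 0) + q (1, 0)) (q (0, 1) + q (1, 1))
    + (1 - l) * outEnt (q (0, 1) + q (1, 1)) (q (0, 0) + q (1, 0))
    + gainOne α l (q (0, 0)) (q (0, 1)) + gainTwo α l (q (1, 0)) (q (1, 1))

lemma lagr_eq (α l : ℝ) (q : Fin 2 × Fin 2 → ℝ) :
    lagr α l q = l * infoOne q + (1 - l) * infoTwo q + (α - 1) * infoOne q + privRate α q := by
  simp only [lagr, infoOne, infoTwo, privRate, gainOne, gainTwo]; ring

@[fun_prop] lemma continuous_infoOne : Continuous infoOne := by unfold infoOne; fun_prop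

@[fun_prop] lemma continuous_infoTwo : Continuous infoTwo := by unfold infoTwo; fun_prop

@[fun_prop] lemma continuous_privRate (α : ℝ) : Continuous (privRate α) := by
  unfold privRate; fun_prop

lemma continuous_lagr (α : ℝ) :
    Continuous fun x : ℝ × (Fin 2 × Fin 2 → ℝ) => lagr α x.1 x.2 := by
  simp only [lagr_eq]
  have h1 := continuous_infoOne.comp (continuous_snd (X := ℝ) (Y := Fin 2 × Fin 2 → ℝ))
  have h2 := continuous_infoTwo.comp (continuous_snd (X := ℝ) (Y := Fin 2 × Fin 2 → ℝ))
  have h3 := (continuous_privRate α).comp (continuous_snd (X := ℝ) (Y := Fin 2 × Fin 2 → ℝ))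
  simp only [Function.comp_def] at h1 h2 h3
  fun_prop

lemma lagr_smul (α l c : ℝ) (q : Fin 2 × Fin 2 → ℝ) : lagr α l (c • q) = c * lagr α l q := by
  simp only [lagr, Pi.smul_apply, smul_eq_mul, gainOne_smul, gainTwo_smul, ← mul_add, outEnt_smul]
  ring

/-- The masses where `lagr` is concave. -/
def Good (α l : ℝ) (q : Fin 2 × Fin 2 → ℝ) : Prop :=
  q (0, 0) ≤ q (0, 1) ∧ 0 ≤ curvForm α l (q (1, 0)) (q (1, 1))

lemma lagr_superadd {α l : ℝ} (hα : 1 ≤ α) (hl : 0 ≤ l) (hl1 : l ≤ 1) {p q : Fin 2 × Fin 2 → ℝ}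
    (hp : ∀ i, 0 ≤ p i) (hq : ∀ i, 0 ≤ q i) (gp : Good α l p) (gq : Good α l q) :
    lagr α l p + lagr α l q ≤ lagr α l (p + q) := by
  have h1 := gainOne_superadd (α := α) hl1 (hp _) gp.1 (hq _) gq.1
  have h2 := gainTwo_superadd hα hl (hp _) (hp _) (hq _) (hq _) gp.2 gq.2
  have h3 := mul_le_mul_of_nonneg_left (outEnt_superadd (add_nonneg (hp (0, 0)) (hp (1, 0)))
    (add_nonneg (hp (0, 1)) (hp (1, 1))) (add_nonneg (hq (0, 0)) (hq (1, 0)))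
    (add_nonneg (hq (0, 1)) (hq (1, 1)))) (show 0 ≤ α - 1 + l by linarith)
  have h4 := mul_le_mul_of_nonneg_left (outEnt_superadd (add_nonneg (hp (0, 1)) (hp (1, 1)))
    (add_nonneg (hp (0, 0)) (hp (1, 0))) (add_nonneg (hq (0, 1)) (hq (1, 1)))
    (add_nonneg (hq (0, 0)) (hq (1, 0)))) (show 0 ≤ 1 - l by linarith)
  simp only [lagr, Pi.add_apply]
  rw [add_add_add_comm (p (0, 0)), add_add_add_comm (p (0, 1))]
  linarith

lemma Good.smul {α l c : ℝ} (hc : 0 ≤ c) {q : Fin 2 × Fin 2 → ℝ} (h : Good α l q) :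
    Good α l (c • q) := by
  refine ⟨mul_le_mul_of_nonneg_left h.1 hc, ?_⟩
  simp only [Pi.smul_apply, smul_eq_mul, curvForm_smul]
  exact mul_nonneg (sq_nonneg c) h.2

/-- Two values of `W` are enough. -/
lemma exists_good_le_lagr {α l : ℝ} (hα : 1 ≤ α) (hl : 0 ≤ l) (hl1 : l ≤ 1) {W : Type*} [Fintype W]
    {s t : W → ℝ} (hs : ∀ w, 0 ≤ s w) (ht : ∀ w, 0 ≤ t w) (h1 : ∑ w, s w + ∑ w, t w = 1) :
    ∃ q ∈ stdSimplex ℝ (Fin 2 × Fin 2), Good α l q ∧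
      (α - 1 + l) * outEnt (∑ w, s w) (∑ w, t w) + (1 - l) * outEnt (∑ w, t w) (∑ w, s w)
        + ∑ w, max (gainOne α l (s w) (t w)) (gainTwo α l (s w) (t w)) ≤ lagr α l q := by
  obtain ⟨s₀, t₀, s₁, t₁, g1, g2, g3, g4, g5, g6, g7, g8⟩ :=
    exists_split_sum hα hl hl1 Finset.univ hs ht
  refine ⟨fun i => ![![s₀, t₀], ![s₁, t₁]] i.1 i.2, ⟨?_, ?_⟩, ⟨by simpa using g2, by simpa using g5⟩,
    ?_⟩
  · rintro ⟨i, j⟩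
    fin_cases i <;> fin_cases j <;> simp <;> linarith
  · simp only [Fintype.sum_prod_type, Fin.sum_univ_two]
    simp
    linarith
  · simp only [lagr]
    simp only [Matrix.cons_val_zero, Matrix.cons_val_one, Matrix.cons_val_fin_one, g6, g7]
    linarith

lemma exists_good_isMaxOn_lagr {α l : ℝ} (hα : 1 ≤ α) (hl : 0 ≤ l) (hl1 : l ≤ 1) :
    ∃ p ∈ stdSimplex ℝ (Fin 2 × Fin 2), Good α l p ∧
      ∀ q ∈ stdSimplex ℝ (Fin 2 × Fin 2), lagr α l q ≤ lagr α l p := by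
  obtain ⟨p, hp, hmax⟩ := (isCompact_stdSimplex ℝ (Fin 2 × Fin 2)).exists_isMaxOn
    ⟨_, single_mem_stdSimplex ℝ (0, 0)⟩
    (((continuous_lagr α).comp (Continuous.prodMk_right l)).continuousOn)
  have hsum := hp.2
  simp only [Fintype.sum_prod_type, Fin.sum_univ_two] at hsum
  obtain ⟨q, hq, gq, hle⟩ := exists_good_le_lagr hα hl hl1 (W := Fin 2) (s := fun w => p (w, 0))
    (t := fun w => p (w, 1)) (fun w => hp.1 _) (fun w => hp.1 _) (by
      simp only [Fin.sum_univ_two]; linarith)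
  refine ⟨q, hq, gq, fun r hr => (hmax hr).trans (le_trans ?_ hle)⟩
  simp only [Fin.sum_univ_two, lagr, Function.comp]
  have h1 := le_max_left (gainOne α l (p (0, 0)) (p (0, 1))) (gainTwo α l (p (0, 0)) (p (0, 1)))
  have h2 := le_max_right (gainOne α l (p (1, 0)) (p (1, 1))) (gainTwo α l (p (1, 0)) (p (1, 1)))
  linarith

/-- A saddle point: the minimum in `tdRate` can be exchanged with the maximum. -/
theorem exists_tdRate_eq_lagr {α : ℝ} (hα : 1 ≤ α) :
    ∃ l ∈ Icc (0 : ℝ) 1, ∃ p ∈ stdSimplex ℝ (Fin 2 × Fin 2), tdRate α p = lagr α l p ∧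
      ∀ q ∈ stdSimplex ℝ (Fin 2 × Fin 2), lagr α l q ≤ lagr α l p := by
  set K := stdSimplex ℝ (Fin 2 × Fin 2) with hK
  have hKc : IsCompact K := isCompact_stdSimplex ℝ _
  -- `lagr` need not be concave on the whole simplex. Keeping only maximizers that satisfy `Good`
  -- makes it possible to mix two of them later.
  set N : Set (ℝ × (Fin 2 × Fin 2 → ℝ)) := {x | x ∈ Icc (0 : ℝ) 1 ×ˢ K ∧ Good α x.1 x.2 ∧
    ∀ q ∈ K, lagr α x.1 q ≤ lagr α x.1 x.2} with hN
  have hNc : IsCompact N := by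
    refine (isCompact_Icc.prod hKc).of_isClosed_subset ?_ fun x hx => hx.1
    refine ((isCompact_Icc.prod hKc).isClosed).inter (IsClosed.inter (IsClosed.inter ?_ ?_) ?_)
    · exact isClosed_le (f := fun x : ℝ × (Fin 2 × Fin 2 → ℝ) => x.2 (0, 0))
        (g := fun x => x.2 (0, 1)) (by fun_prop) (by fun_prop)
    · exact isClosed_le (f := fun _ : ℝ × (Fin 2 × Fin 2 → ℝ) => (0 : ℝ))
        (g := fun x => curvForm α x.1 (x.2 (1, 0)) (x.2 (1, 1))) (by fun_prop)
        (by unfold curvForm; fun_prop)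
    · have : {x : ℝ × (Fin 2 × Fin 2 → ℝ) | ∀ q ∈ K, lagr α x.1 q ≤ lagr α x.1 x.2}
          = ⋂ q ∈ K, {x | lagr α x.1 q ≤ lagr α x.1 x.2} := by ext x; simp
      show IsClosed {x : ℝ × (Fin 2 × Fin 2 → ℝ) | ∀ q ∈ K, lagr α x.1 q ≤ lagr α x.1 x.2}
      rw [this]
      refine isClosed_biInter fun q _ => isClosed_le ?_ (continuous_lagr α)
      exact (continuous_lagr α).comp (continuous_fst.prodMk continuous_const)
  have hc1 := continuous_infoOne.comp (continuous_snd (X := ℝ) (Y := Fin 2 × Fin 2 → ℝ))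
  have hc2 := continuous_infoTwo.comp (continuous_snd (X := ℝ) (Y := Fin 2 × Fin 2 → ℝ))
  set P := Prod.fst '' (N ∩ {x | infoOne x.2 ≤ infoTwo x.2}) with hP
  set Q := Prod.fst '' (N ∩ {x | infoTwo x.2 ≤ infoOne x.2}) with hQ
  have hPc : IsClosed P := ((hNc.inter_right (isClosed_le hc1 hc2)).image continuous_fst).isClosed
  have hQc : IsClosed Q := ((hNc.inter_right (isClosed_le hc2 hc1)).image continuous_fst).isClosed
  have hcov : Icc (0 : ℝ) 1 ⊆ P ∪ Q := fun l hl => by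
    obtain ⟨p, hp, gp, hmax⟩ := exists_good_isMaxOn_lagr hα hl.1 hl.2
    rcases le_total (infoOne p) (infoTwo p) with h | h
    · exact Or.inl ⟨(l, p), ⟨⟨⟨hl, hp⟩, gp, hmax⟩, h⟩, rfl⟩
    · exact Or.inr ⟨(l, p), ⟨⟨⟨hl, hp⟩, gp, hmax⟩, h⟩, rfl⟩
  have m0 : (0 : ℝ) ∈ Icc (0 : ℝ) 1 := by norm_num
  have m1 : (1 : ℝ) ∈ Icc (0 : ℝ) 1 := by norm_num
  -- At l = 1 the Lagrangian uses I(W;Y) in place of the minimum, which is exact when I(W;Y) ≤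
  -- I(W;Z); l = 0 is the mirror case.
  by_cases h1 : (1 : ℝ) ∈ P
  · obtain ⟨⟨l, p⟩, ⟨⟨⟨hl, hp⟩, -, hmax⟩, h⟩, rfl⟩ := h1
    refine ⟨1, m1, p, hp, ?_, hmax⟩
    rw [lagr_eq, tdRate, min_eq_left h]; ring
  by_cases h0 : (0 : ℝ) ∈ Q
  · obtain ⟨⟨l, p⟩, ⟨⟨⟨hl, hp⟩, -, hmax⟩, h⟩, rfl⟩ := h0
    refine ⟨0, m0, p, hp, ?_, hmax⟩
    rw [lagr_eq, tdRate, min_eq_right h]; ring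
  -- Otherwise 0 lies in P and 1 in Q. As [0,1] is connected, some l has good maximizers on both
  -- sides of I(W;Y) = I(W;Z).
  obtain ⟨l, hl, ⟨⟨l', p⟩, ⟨⟨⟨-, hp⟩, gp, hpm⟩, hple⟩, rfl⟩,
      ⟨⟨l'', q⟩, ⟨⟨⟨-, hq⟩, gq, hqm⟩, hqle⟩, hll⟩⟩ :=
    isPreconnected_closed_iff.1 isPreconnected_Icc P Q hPc hQc hcov
      ⟨0, m0, (hcov m0).resolve_right h0⟩ ⟨1, m1, (hcov m1).resolve_left h1⟩
  simp only at hll hl hp hpm hple hq hqm hqle gp gq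
  subst hll
  obtain ⟨c, hc, hc0⟩ : ∃ c ∈ Icc (0 : ℝ) 1,
      infoOne ((1 - c) • p + c • q) - infoTwo ((1 - c) • p + c • q) = 0 := by
    refine intermediate_value_Icc zero_le_one
      (f := fun c : ℝ => infoOne ((1 - c) • p + c • q) - infoTwo ((1 - c) • p + c • q))
      (by
        have e : Continuous fun c : ℝ => (1 - c) • p + c • q := by fun_prop
        exact ((continuous_infoOne.comp e).sub (continuous_infoTwo.comp e)).continuousOn) ⟨?_, ?_⟩
    · simpa using hple
    · simpa using hqle
  have hc1' : 0 ≤ 1 - c := sub_nonneg.2 hc.2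
  -- Superadditivity on `Good` makes the mixture a maximizer again; since its two informations are
  -- equal, the minimum and the convex combination coincide there.
  have hge := lagr_superadd hα hl.1 hl.2 (p := (1 - c) • p) (q := c • q)
    (fun i => mul_nonneg hc1' (hp.1 i)) (fun i => mul_nonneg hc.1 (hq.1 i))
    (gp.smul hc1') (gq.smul hc.1)
  rw [lagr_smul, lagr_smul, le_antisymm (hqm p hp) (hpm q hq) |>.symm] at hge
  refine ⟨_, hl, (1 - c) • p + c • q, convex_stdSimplex ℝ _ hp hq hc1' hc.1 (by ring), ?_,
    fun r hr => (hpm r hr).trans (le_trans (le_of_eq ?_) hge)⟩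
  · rw [lagr_eq, tdRate, sub_eq_zero.1 hc0, min_self]; ring
  · ring

/-- The weighted sum rate for arbitrary finite `W` is attained by two values of `W`. -/
theorem exists_isMax_tdRate {α : ℝ} (hα : 1 ≤ α) :
    ∃ p ∈ stdSimplex ℝ (Fin 2 × Fin 2),
      (∀ q ∈ stdSimplex ℝ (Fin 2 × Fin 2), tdRate α q ≤ tdRate α p) ∧
      ∀ (W : Type) [Fintype W] (s t : W → ℝ), (∀ w, 0 ≤ s w) → (∀ w, 0 ≤ t w) →
        ∑ w, s w + ∑ w, t w = 1 →
        min (outEnt (∑ w, s w) (∑ w, t w) - ∑ w, outEnt (s w) (t w))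
            (outEnt (∑ w, t w) (∑ w, s w) - ∑ w, outEnt (t w) (s w))
          + (α - 1) * (outEnt (∑ w, s w) (∑ w, t w) - ∑ w, outEnt (s w) (t w))
          + ∑ w, max (α * (outEnt (s w) (t w) - s w * log 2)) (outEnt (t w) (s w) - t w * log 2)
          ≤ tdRate α p := by
  obtain ⟨l, hl, p, hp, heq, hmax⟩ := exists_tdRate_eq_lagr hα
  have hmin : ∀ a b : ℝ, min a b ≤ l * a + (1 - l) * b := fun a b => by
    have h1 := mul_le_mul_of_nonneg_left (min_le_left a b) hl.1
    have h2 := mul_le_mul_of_nonneg_left (min_le_right a b) (sub_nonneg.2 hl.2)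
    linarith
  refine ⟨p, hp, fun q hq => ?_, fun W _ s t hs ht h1 => ?_⟩
  · rw [heq]
    refine le_trans ?_ (hmax q hq)
    rw [lagr_eq, tdRate]
    linarith [hmin (infoOne q) (infoTwo q)]
  · rw [heq]
    obtain ⟨q, hq, -, hle⟩ := exists_good_le_lagr hα hl.1 hl.2 hs ht h1
    refine le_trans ?_ (hle.trans (hmax q hq))
    have e : ∑ w, max (gainOne α l (s w) (t w)) (gainTwo α l (s w) (t w))
        = ∑ w, max (α * (outEnt (s w) (t w) - s w * log 2)) (outEnt (t w) (s w) - t w * log 2)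
          - (α - 1 + l) * ∑ w, outEnt (s w) (t w) - (1 - l) * ∑ w, outEnt (t w) (s w) := by
      rw [Finset.mul_sum, Finset.mul_sum, ← Finset.sum_sub_distrib, ← Finset.sum_sub_distrib]
      refine Finset.sum_congr rfl fun w _ => ?_
      rw [sub_sub, ← max_sub_sub_right]
      congr 1 <;> simp only [gainOne, gainTwo] <;> ring
    rw [e]
    linarith [hmin (outEnt (∑ w, s w) (∑ w, t w) - ∑ w, outEnt (s w) (t w))
      (outEnt (∑ w, t w) (∑ w, s w) - ∑ w, outEnt (t w) (s w))]

/-! ### Translation of the information quantities into masses -/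

section Entropies

lemma H_equiv {Ω β γ : Type*} [Fintype Ω] [Fintype β] [Fintype γ] (P : Ω → ℝ) (f : Ω → β)
    (e : β ≃ γ) : H P (fun s => e (f s)) = H P f := by
  classical
  simp only [H, entropy]
  rw [← e.sum_comp]
  simp [law]

variable {𝒜 β : Type*} [Fintype 𝒜] [Fintype β] (p : 𝒜 × Fin 2 → ℝ)

open Classical in
/-- The mass of `g A = b, X = x`. -/
def auxMass (g : 𝒜 → β) (b : β) (x : Fin 2) : ℝ := ∑ a, if g a = b then p (a, x) else 0

open Classical in
-- Only four triples (x, y, z) have positive probability: input 0 leaves `Y` free with Z = 0, input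
-- 1 leaves `Z` free with Y = 1, each outcome with probability 1/2.
lemma law_joint_bssc {δ : Type*} (F : 𝒜 × Fin 2 × Fin 2 × Fin 2 → δ) (b : δ) :
    law (joint bssc p) F b = ∑ a, ((if F (a, 0, 0, 0) = b then p (a, 0) / 2 else 0)
      + (if F (a, 0, 1, 0) = b then p (a, 0) / 2 else 0)
      + (if F (a, 1, 1, 0) = b then p (a, 1) / 2 else 0)
      + (if F (a, 1, 1, 1) = b then p (a, 1) / 2 else 0)) := by
  simp only [law, Fintype.sum_prod_type, Fin.sum_univ_two]
  refine Finset.sum_congr rfl fun a _ => ?_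
  simp [joint, bssc, bsscY, bsscZ, div_eq_mul_inv]
  ring

lemma H_aux (g : 𝒜 → β) : H (joint bssc p) (fun s => g (aux s))
    = ∑ b, negMulLog (auxMass p g b 0 + auxMass p g b 1) := by
  classical
  simp only [H, entropy, law_joint_bssc, auxMass]
  refine Finset.sum_congr rfl fun b _ => ?_
  rw [← Finset.sum_add_distrib]
  congr 1
  refine Finset.sum_congr rfl fun a _ => ?_
  by_cases h : g a = b <;> simp [aux, h]
  ring

lemma H_aux_outY (g : 𝒜 → β) : H (joint bssc p) (fun s => (g (aux s), outY s))
    = ∑ b, (negMulLog (auxMass p g b 0 / 2)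
      + negMulLog (auxMass p g b 0 / 2 + auxMass p g b 1)) := by
  classical
  simp only [H, entropy, law_joint_bssc, auxMass, Fintype.sum_prod_type, Fin.sum_univ_two]
  refine Finset.sum_congr rfl fun b _ => ?_
  rw [Finset.sum_div, ← Finset.sum_add_distrib]
  congr 2
  all_goals
    refine Finset.sum_congr rfl fun a _ => ?_
    by_cases h : g a = b <;> simp [aux, outY, h]
  ring

lemma H_aux_outZ (g : 𝒜 → β) : H (joint bssc p) (fun s => (g (aux s), outZ s))
    = ∑ b, (negMulLog (auxMass p g b 1 / 2)
      + negMulLog (auxMass p g b 1 / 2 + auxMass p g b 0)) := by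
  classical
  simp only [H, entropy, law_joint_bssc, auxMass, Fintype.sum_prod_type, Fin.sum_univ_two]
  refine Finset.sum_congr rfl fun b _ => ?_
  rw [Finset.sum_div, ← Finset.sum_add_distrib, add_comm]
  congr 2
  all_goals
    refine Finset.sum_congr rfl fun a _ => ?_
    by_cases h : g a = b <;> simp [aux, outZ, h]
  ring

lemma H_outY : H (joint bssc p) outY
    = negMulLog ((∑ a, p (a, 0)) / 2) + negMulLog ((∑ a, p (a, 0)) / 2 + ∑ a, p (a, 1)) := by
  classical
  simp only [H, entropy, law_joint_bssc, Fin.sum_univ_two]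
  rw [Finset.sum_div, ← Finset.sum_add_distrib]
  congr 2
  all_goals
    refine Finset.sum_congr rfl fun a _ => ?_
    simp [outY]
  ring

lemma H_outZ : H (joint bssc p) outZ
    = negMulLog ((∑ a, p (a, 1)) / 2) + negMulLog ((∑ a, p (a, 1)) / 2 + ∑ a, p (a, 0)) := by
  classical
  simp only [H, entropy, law_joint_bssc, Fin.sum_univ_two]
  rw [Finset.sum_div, ← Finset.sum_add_distrib, add_comm]
  congr 2
  all_goals
    refine Finset.sum_congr rfl fun a _ => ?_
    simp [outZ]
  ring

lemma I_aux_outY (g : 𝒜 → β) : I (joint bssc p) (fun s => g (aux s)) outY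
    = outEnt (∑ a, p (a, 0)) (∑ a, p (a, 1))
      - ∑ b, outEnt (auxMass p g b 0) (auxMass p g b 1)
      + negMulLog (∑ a, p (a, 0) + ∑ a, p (a, 1)) := by
  simp only [I, H_aux, H_outY, H_aux_outY, outEnt, Finset.sum_sub_distrib]; ring

lemma I_aux_outZ (g : 𝒜 → β) : I (joint bssc p) (fun s => g (aux s)) outZ
    = outEnt (∑ a, p (a, 1)) (∑ a, p (a, 0))
      - ∑ b, outEnt (auxMass p g b 1) (auxMass p g b 0)
      + negMulLog (∑ a, p (a, 0) + ∑ a, p (a, 1)) := by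
  simp only [I, H_aux, H_outZ, H_aux_outZ, outEnt, Finset.sum_sub_distrib,
    add_comm (auxMass p g _ 1), add_comm (∑ a, p (a, 1))]; ring

variable {γ : Type*} [Fintype γ]

lemma condI_aux_outY (g : 𝒜 → β) (h : 𝒜 → γ) :
    condI (joint bssc p) (fun s => g (aux s)) outY (fun s => h (aux s))
      = ∑ c, outEnt (auxMass p h c 0) (auxMass p h c 1)
        - ∑ b, ∑ c, outEnt (auxMass p (fun a => (g a, h a)) (b, c) 0)
            (auxMass p (fun a => (g a, h a)) (b, c) 1) := by
  have e1 : H (joint bssc p) (fun s => (outY s, h (aux s)))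
      = H (joint bssc p) (fun s => (h (aux s), outY s)) :=
    H_equiv _ (fun s => (h (aux s), outY s)) (Equiv.prodComm _ _)
  have e2 := (H_equiv (joint bssc p) (fun s => ((g (aux s), h (aux s)), outY s))
    ((Equiv.prodAssoc _ _ _).trans ((Equiv.refl _).prodCongr (Equiv.prodComm _ _)))).trans
      (H_aux_outY p (fun a => (g a, h a)))
  change H (joint bssc p) (fun s => (g (aux s), outY s, h (aux s))) = _ at e2
  have e3 := H_aux p (fun a => (g a, h a))
  simp only [condI, e1, e2, e3, H_aux, H_aux_outY, outEnt, Finset.sum_sub_distrib,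
    Fintype.sum_prod_type]
  ring

lemma condI_aux_outZ (g : 𝒜 → β) (h : 𝒜 → γ) :
    condI (joint bssc p) (fun s => g (aux s)) outZ (fun s => h (aux s))
      = ∑ c, outEnt (auxMass p h c 1) (auxMass p h c 0)
        - ∑ b, ∑ c, outEnt (auxMass p (fun a => (g a, h a)) (b, c) 1)
            (auxMass p (fun a => (g a, h a)) (b, c) 0) := by
  have e1 : H (joint bssc p) (fun s => (outZ s, h (aux s)))
      = H (joint bssc p) (fun s => (h (aux s), outZ s)) :=
    H_equiv _ (fun s => (h (aux s), outZ s)) (Equiv.prodComm _ _)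
  have e2 := (H_equiv (joint bssc p) (fun s => ((g (aux s), h (aux s)), outZ s))
    ((Equiv.prodAssoc _ _ _).trans ((Equiv.refl _).prodCongr (Equiv.prodComm _ _)))).trans
      (H_aux_outZ p (fun a => (g a, h a)))
  change H (joint bssc p) (fun s => (g (aux s), outZ s, h (aux s))) = _ at e2
  have e3 := H_aux p (fun a => (g a, h a))
  simp only [condI, e1, e2, e3, H_aux, H_aux_outZ, outEnt, Finset.sum_sub_distrib,
    Fintype.sum_prod_type, add_comm (auxMass p _ _ 1)]
  ring

lemma two_mul_negMulLog_half (s : ℝ) : 2 * negMulLog (s / 2) = negMulLog s + s * log 2 := by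
  have := outEnt_zero_right s
  simp only [outEnt, add_zero] at this
  linarith

lemma I_inX_outY : I (joint bssc p) inX outY
    = outEnt (∑ a, p (a, 0)) (∑ a, p (a, 1)) - (∑ a, p (a, 0)) * log 2
      + negMulLog (∑ a, p (a, 0) + ∑ a, p (a, 1)) := by
  classical
  have e1 : H (joint bssc p) inX = negMulLog (∑ a, p (a, 0)) + negMulLog (∑ a, p (a, 1)) := by
    simp only [H, entropy, law_joint_bssc, Fin.sum_univ_two]
    simp [inX]
  have e2 : H (joint bssc p) (fun s => (inX s, outY s))
      = 2 * negMulLog ((∑ a, p (a, 0)) / 2) + negMulLog (∑ a, p (a, 1)) := by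
    simp only [H, entropy, law_joint_bssc, Fintype.sum_prod_type, Fin.sum_univ_two]
    simp [inX, outY, Finset.sum_div]
    ring
  rw [I, e1, e2, H_outY, two_mul_negMulLog_half, outEnt]
  ring

lemma I_inX_outZ : I (joint bssc p) inX outZ
    = outEnt (∑ a, p (a, 1)) (∑ a, p (a, 0)) - (∑ a, p (a, 1)) * log 2
      + negMulLog (∑ a, p (a, 0) + ∑ a, p (a, 1)) := by
  classical
  have e1 : H (joint bssc p) inX = negMulLog (∑ a, p (a, 0)) + negMulLog (∑ a, p (a, 1)) := by
    simp only [H, entropy, law_joint_bssc, Fin.sum_univ_two]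
    simp [inX]
  have e2 : H (joint bssc p) (fun s => (inX s, outZ s))
      = 2 * negMulLog ((∑ a, p (a, 1)) / 2) + negMulLog (∑ a, p (a, 0)) := by
    simp only [H, entropy, law_joint_bssc, Fintype.sum_prod_type, Fin.sum_univ_two]
    simp [inX, outZ, Finset.sum_div]
    ring
  rw [I, e1, e2, H_outZ, two_mul_negMulLog_half, outEnt, add_comm (∑ a, p (a, 0))]
  ring

lemma law_aux (b : 𝒜) : law (joint bssc p) aux b = p (b, 0) + p (b, 1) := by
  classical
  rw [law_joint_bssc]
  show ∑ a, ((if a = b then p (a, 0) / 2 else 0) + (if a = b then p (a, 0) / 2 else 0)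
      + (if a = b then p (a, 1) / 2 else 0) + (if a = b then p (a, 1) / 2 else 0)) = _
  simp only [Finset.sum_add_distrib, Finset.sum_ite_eq', Finset.mem_univ, if_true]
  ring

open Classical in
lemma condOn_aux (b : 𝒜) : condOn (joint bssc p) aux b
    = joint bssc (fun i => if i.1 = b then p i / (p (b, 0) + p (b, 1)) else 0) := by
  funext s
  simp only [condOn, law_aux, joint, aux]
  split_ifs <;> ring

variable {p}

lemma law_mul_I_condOn_outY (hp : ∀ i, 0 ≤ p i) (b : 𝒜) :
    law (joint bssc p) aux b * I (condOn (joint bssc p) aux b) inX outY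
      = outEnt (p (b, 0)) (p (b, 1)) - p (b, 0) * log 2 := by
  classical
  rw [law_aux, condOn_aux, I_inX_outY]
  rcases (add_nonneg (hp (b, 0)) (hp (b, 1))).eq_or_lt with h | h
  · have h1 : p (b, 0) = 0 := by linarith [hp (b, 0), hp (b, 1)]
    have h2 : p (b, 1) = 0 := by linarith [hp (b, 0), hp (b, 1)]
    simp [h1, h2]
  · have e : ∀ c : ℝ, c / (p (b, 0) + p (b, 1)) = (p (b, 0) + p (b, 1))⁻¹ * c := fun c => by
      field_simp
    simp only [Finset.sum_ite_eq', Finset.mem_univ, if_true]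
    rw [e, e, outEnt_smul, ← mul_add, inv_mul_cancel₀ h.ne', negMulLog_one]
    field_simp
    ring

lemma law_mul_I_condOn_outZ (hp : ∀ i, 0 ≤ p i) (b : 𝒜) :
    law (joint bssc p) aux b * I (condOn (joint bssc p) aux b) inX outZ
      = outEnt (p (b, 1)) (p (b, 0)) - p (b, 1) * log 2 := by
  classical
  rw [law_aux, condOn_aux, I_inX_outZ]
  rcases (add_nonneg (hp (b, 0)) (hp (b, 1))).eq_or_lt with h | h
  · have h1 : p (b, 0) = 0 := by linarith [hp (b, 0), hp (b, 1)]
    have h2 : p (b, 1) = 0 := by linarith [hp (b, 0), hp (b, 1)]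
    simp [h1, h2]
  · have e : ∀ c : ℝ, c / (p (b, 0) + p (b, 1)) = (p (b, 0) + p (b, 1))⁻¹ * c := fun c => by
      field_simp
    simp only [Finset.sum_ite_eq', Finset.mem_univ, if_true]
    rw [e, e, outEnt_smul, ← mul_add, inv_mul_cancel₀ h.ne', negMulLog_one]
    field_simp
    ring

end Entropies

section Private

variable {𝒰 𝒱 : Type*} [Fintype 𝒰] [Fintype 𝒱] (p : (𝒰 × 𝒱) × Fin 2 → ℝ)

lemma auxMass_fst (u : 𝒰) (x : Fin 2) : auxMass p Prod.fst u x = ∑ v, p ((u, v), x) := by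
  classical
  simp only [auxMass, Fintype.sum_prod_type_right]
  exact Finset.sum_congr rfl fun v _ => by simp

lemma auxMass_snd (v : 𝒱) (x : Fin 2) : auxMass p Prod.snd v x = ∑ u, p ((u, v), x) := by
  classical
  simp only [auxMass, Fintype.sum_prod_type]
  exact Finset.sum_congr rfl fun v _ => by simp

lemma auxMass_id {𝒜 : Type*} [Fintype 𝒜] (p : 𝒜 × Fin 2 → ℝ) (a : 𝒜) (x : Fin 2) :
    auxMass p (fun a => a) a x = p (a, x) := by
  classical
  simp [auxMass]

lemma sum_eq_one_of_mem {𝒜 : Type*} [Fintype 𝒜] {p : 𝒜 × Fin 2 → ℝ}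
    (hp : p ∈ stdSimplex ℝ (𝒜 × Fin 2)) : ∑ a, p (a, 0) + ∑ a, p (a, 1) = 1 := by
  have := hp.2
  simpa only [Fintype.sum_prod_type, Fin.sum_univ_two, Finset.sum_add_distrib] using this

lemma I_aux_aux : I (joint bssc p) (fun s => (aux s).1) (fun s => (aux s).2)
    = ∑ u, negMulLog (∑ v, (p ((u, v), 0) + p ((u, v), 1)))
      + ∑ v, negMulLog (∑ u, (p ((u, v), 0) + p ((u, v), 1)))
      - ∑ u, ∑ v, negMulLog (p ((u, v), 0) + p ((u, v), 1)) := by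
  rw [I, H_aux p Prod.fst, H_aux p Prod.snd, H_aux p (fun a => (a.1, a.2))]
  simp only [auxMass_fst, auxMass_snd, Prod.mk.eta, auxMass_id, Fintype.sum_prod_type,
    Finset.sum_add_distrib]

variable {p}

lemma sumRate_eq_info (hp : p ∈ stdSimplex ℝ ((𝒰 × 𝒱) × Fin 2)) (a b : ℝ) :
    a * I (joint bssc p) (fun s => (aux s).1) outY
        + b * I (joint bssc p) (fun s => (aux s).2) outZ
        - I (joint bssc p) (fun s => (aux s).1) (fun s => (aux s).2)
      = a * (outEnt (∑ u, ∑ v, p ((u, v), 0)) (∑ u, ∑ v, p ((u, v), 1))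
          - ∑ u, outEnt (∑ v, p ((u, v), 0)) (∑ v, p ((u, v), 1)))
        + b * (outEnt (∑ u, ∑ v, p ((u, v), 1)) (∑ u, ∑ v, p ((u, v), 0))
          - ∑ v, outEnt (∑ u, p ((u, v), 1)) (∑ u, p ((u, v), 0)))
        - (∑ u, negMulLog (∑ v, (p ((u, v), 0) + p ((u, v), 1)))
          + ∑ v, negMulLog (∑ u, (p ((u, v), 0) + p ((u, v), 1)))
          - ∑ u, ∑ v, negMulLog (p ((u, v), 0) + p ((u, v), 1))) := by
  rw [I_aux_aux, I_aux_outY p Prod.fst, I_aux_outZ p Prod.snd, sum_eq_one_of_mem hp]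
  simp only [auxMass_fst, auxMass_snd, negMulLog_one, add_zero, Fintype.sum_prod_type]

theorem info_le_one {α : ℝ} (hα : 1 ≤ α) (hp : p ∈ stdSimplex ℝ ((𝒰 × 𝒱) × Fin 2)) :
    α * I (joint bssc p) (fun s => (aux s).1) outY
        + I (joint bssc p) (fun s => (aux s).2) outZ
        - I (joint bssc p) (fun s => (aux s).1) (fun s => (aux s).2)
      ≤ max (α * I (joint bssc p) inX outY) (I (joint bssc p) inX outZ) := by
  have h1 := sum_eq_one_of_mem hp
  have key := sumRate_le_of_sum_eq_one hα (s := fun u v => p ((u, v), 0))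
    (t := fun u v => p ((u, v), 1)) (fun u v => hp.1 _) (fun u v => hp.1 _) (by
      simpa only [Fintype.sum_prod_type] using h1)
  have e := sumRate_eq_info hp α 1
  simp only [one_mul] at e
  rw [e, I_inX_outY, I_inX_outZ, h1]
  simpa only [negMulLog_one, add_zero, Fintype.sum_prod_type, sumRate] using key

theorem info_le_two {α : ℝ} (hα : 1 ≤ α) (hp : p ∈ stdSimplex ℝ ((𝒰 × 𝒱) × Fin 2)) :
    I (joint bssc p) (fun s => (aux s).1) outY
        + α * I (joint bssc p) (fun s => (aux s).2) outZ
        - I (joint bssc p) (fun s => (aux s).1) (fun s => (aux s).2)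
      ≤ max (I (joint bssc p) inX outY) (α * I (joint bssc p) inX outZ) := by
  have h1 := sum_eq_one_of_mem hp
  -- The channel symmetry: exchanging the inputs and the auxiliaries exchanges the receivers.
  have key := sumRate_le_of_sum_eq_one hα (s := fun v u => p ((u, v), 1))
    (t := fun v u => p ((u, v), 0)) (fun u v => hp.1 _) (fun u v => hp.1 _) (by
      simp only [Fintype.sum_prod_type_right] at h1
      linarith)
  have e := sumRate_eq_info hp 1 α
  simp only [one_mul] at e
  rw [e, I_inX_outY, I_inX_outZ, h1, max_comm]
  simp only [sumRate, Finset.sum_comm (γ := 𝒱), add_comm (p (_, 1))] at key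
  simp only [negMulLog_one, add_zero, Fintype.sum_prod_type]
  refine le_trans (le_of_eq ?_) key
  ring

end Private

/-! ### Marton's bounds in terms of masses -/

section Marton

variable {U V W : Type*} [Fintype U] [Fintype V] [Fintype W]

/-- `I(U, W; Y)` in terms of the masses of `(W, U, V)` for the inputs `0` and `1`. -/
def rateOne (s t : W → U → V → ℝ) : ℝ :=
  outEnt (∑ w, ∑ u, ∑ v, s w u v) (∑ w, ∑ u, ∑ v, t w u v)
    - ∑ w, ∑ u, outEnt (∑ v, s w u v) (∑ v, t w u v)

/-- `I(V, W; Z)` in terms of the masses of `(W, U, V)` for the inputs `0` and `1`. -/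
def rateTwo (s t : W → U → V → ℝ) : ℝ :=
  outEnt (∑ w, ∑ u, ∑ v, t w u v) (∑ w, ∑ u, ∑ v, s w u v)
    - ∑ w, ∑ v, outEnt (∑ u, t w u v) (∑ u, s w u v)

/-- The bound on the sum rate in terms of the masses of `(W, U, V)` for the inputs `0` and `1`. -/
def rateSum (s t : W → U → V → ℝ) : ℝ :=
  min (outEnt (∑ w, ∑ u, ∑ v, s w u v) (∑ w, ∑ u, ∑ v, t w u v)
      - ∑ w, outEnt (∑ u, ∑ v, s w u v) (∑ u, ∑ v, t w u v))
    (outEnt (∑ w, ∑ u, ∑ v, t w u v) (∑ w, ∑ u, ∑ v, s w u v)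
      - ∑ w, outEnt (∑ u, ∑ v, t w u v) (∑ u, ∑ v, s w u v))
    + ∑ w, (sumRate 1 (s w) (t w)
      + negMulLog (∑ u, ∑ v, s w u v + ∑ u, ∑ v, t w u v))

lemma sum_triple (f : U × V × W → ℝ) : ∑ a, f a = ∑ w, ∑ u, ∑ v, f (u, v, w) := by
  simp only [Fintype.sum_prod_type]
  rw [Finset.sum_comm' (t' := Finset.univ) (s' := fun _ => Finset.univ) (by simp)]
  rw [Finset.sum_comm]
  simp only [Finset.sum_comm (γ := W)]

variable (p : (U × V × W) × Fin 2 → ℝ)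

lemma auxMass_W (w : W) (x : Fin 2) :
    auxMass p (fun a => a.2.2) w x = ∑ u, ∑ v, p ((u, v, w), x) := by
  classical
  simp only [auxMass, Fintype.sum_prod_type]
  exact Finset.sum_congr rfl fun u _ => Finset.sum_congr rfl fun v _ => by simp

lemma auxMass_UW (u : U) (w : W) (x : Fin 2) :
    auxMass p (fun a => (a.1, a.2.2)) (u, w) x = ∑ v, p ((u, v, w), x) := by
  classical
  simp only [auxMass, sum_triple, Prod.mk.injEq, ite_and]
  rw [Finset.sum_comm]
  simp [Finset.sum_comm (γ := W)]

lemma auxMass_VW (v : V) (w : W) (x : Fin 2) :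
    auxMass p (fun a => (a.2.1, a.2.2)) (v, w) x = ∑ u, p ((u, v, w), x) := by
  classical
  simp only [auxMass, sum_triple, Prod.mk.injEq, ite_and]
  simp only [Finset.sum_ite_eq', Finset.sum_comm (γ := W)]
  simp

variable {p} (hp : p ∈ stdSimplex ℝ ((U × V × W) × Fin 2))
include hp

lemma rateOne_eq : I (joint bssc p) (fun s => ((aux s).1, (aux s).2.2)) outY
    = rateOne (fun w u v => p ((u, v, w), 0)) (fun w u v => p ((u, v, w), 1)) := by
  rw [I_aux_outY p (fun a => (a.1, a.2.2)), sum_eq_one_of_mem hp]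
  simp only [negMulLog_one, add_zero, sum_triple]
  simp only [Fintype.sum_prod_type_right, auxMass_UW, rateOne]

lemma rateTwo_eq : I (joint bssc p) (fun s => ((aux s).2.1, (aux s).2.2)) outZ
    = rateTwo (fun w u v => p ((u, v, w), 0)) (fun w u v => p ((u, v, w), 1)) := by
  rw [I_aux_outZ p (fun a => (a.2.1, a.2.2)), sum_eq_one_of_mem hp]
  simp only [negMulLog_one, add_zero, sum_triple]
  simp only [Fintype.sum_prod_type_right, auxMass_VW, rateTwo]

lemma rateSum_eq :
    min (I (joint bssc p) (fun s => (aux s).2.2) outY) (I (joint bssc p) (fun s => (aux s).2.2) outZ)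
      + condI (joint bssc p) (fun s => (aux s).1) outY (fun s => (aux s).2.2)
      + condI (joint bssc p) (fun s => (aux s).2.1) outZ (fun s => (aux s).2.2)
      - condI (joint bssc p) (fun s => (aux s).1) (fun s => (aux s).2.1) (fun s => (aux s).2.2)
    = rateSum (fun w u v => p ((u, v, w), 0)) (fun w u v => p ((u, v, w), 1)) := by
  rw [I_aux_outY p (fun a => a.2.2), I_aux_outZ p (fun a => a.2.2), sum_eq_one_of_mem hp,
    condI_aux_outY p (fun a => a.1) (fun a => a.2.2),
    condI_aux_outZ p (fun a => a.2.1) (fun a => a.2.2), condI,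
    H_aux p (fun a => (a.1, a.2.2)), H_aux p (fun a => (a.2.1, a.2.2)),
    H_aux p (fun a => (a.1, a.2.1, a.2.2)), H_aux p (fun a => a.2.2)]
  simp only [Prod.mk.eta, auxMass_id, sum_triple, auxMass_W]
  simp only [Fintype.sum_prod_type_right, auxMass_UW, auxMass_VW, negMulLog_one, add_zero, rateSum,
    sumRate, one_mul, Finset.sum_add_distrib, Finset.sum_sub_distrib]
  have c1 : ∑ u, ∑ w, outEnt (∑ v, p ((u, v, w), 0)) (∑ v, p ((u, v, w), 1))
      = ∑ w, ∑ u, outEnt (∑ v, p ((u, v, w), 0)) (∑ v, p ((u, v, w), 1)) := Finset.sum_comm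
  have c2 : ∑ v, ∑ w, outEnt (∑ u, p ((u, v, w), 1)) (∑ u, p ((u, v, w), 0))
      = ∑ w, ∑ v, outEnt (∑ u, p ((u, v, w), 1)) (∑ u, p ((u, v, w), 0)) := Finset.sum_comm
  rw [c1, c2]
  ring

end Marton

lemma mem_martonRates_iff {R : ℝ × ℝ} : R ∈ martonRates bssc ↔ 0 ≤ R.1 ∧ 0 ≤ R.2 ∧
    ∃ (k l m : ℕ) (s t : Fin m → Fin k → Fin l → ℝ), (∀ w u v, 0 ≤ s w u v) ∧
      (∀ w u v, 0 ≤ t w u v) ∧ ∑ w, ∑ u, ∑ v, s w u v + ∑ w, ∑ u, ∑ v, t w u v = 1 ∧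
      R.1 < rateOne s t ∧ R.2 < rateTwo s t ∧ R.1 + R.2 < rateSum s t := by
  constructor
  · rintro ⟨h1, h2, k, l, m, p, hp, g1, g2, g3⟩
    rw [rateOne_eq hp] at g1
    rw [rateTwo_eq hp] at g2
    rw [rateSum_eq hp] at g3
    refine ⟨h1, h2, k, l, m, _, _, fun w u v => hp.1 _, fun w u v => hp.1 _, ?_, g1, g2, g3⟩
    have := sum_eq_one_of_mem hp
    simpa only [sum_triple] using this
  · rintro ⟨h1, h2, k, l, m, s, t, hs, ht, hst, g1, g2, g3⟩
    have hp : (fun i => ![s i.1.2.2 i.1.1 i.1.2.1, t i.1.2.2 i.1.1 i.1.2.1] i.2)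
        ∈ stdSimplex ℝ ((Fin k × Fin l × Fin m) × Fin 2) := by
      refine ⟨?_, ?_⟩
      · rintro ⟨a, x⟩
        fin_cases x
        · exact hs _ _ _
        · exact ht _ _ _
      · rw [Fintype.sum_prod_type]
        simp only [Fin.sum_univ_two, Finset.sum_add_distrib, sum_triple]
        exact hst
    refine ⟨h1, h2, k, l, m, _, hp, ?_, ?_, ?_⟩
    · rw [rateOne_eq hp]; exact g1
    · rw [rateTwo_eq hp]; exact g2
    · rw [rateSum_eq hp]; exact g3

/-! ### Symmetry between the receivers -/

section Swap

variable {U V W : Type*} [Fintype U] [Fintype V] [Fintype W] (s t : W → U → V → ℝ)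

lemma sumRate_swap (s t : U → V → ℝ) :
    sumRate 1 (fun v u => t u v) (fun v u => s u v) = sumRate 1 s t := by
  simp only [sumRate, Finset.sum_comm (γ := V) (α := U), add_comm (t _ _)]
  ring

lemma rateOne_swap : rateOne (fun w v u => t w u v) (fun w v u => s w u v) = rateTwo s t := by
  simp only [rateOne, rateTwo, Finset.sum_comm (γ := V) (α := U)]

lemma rateTwo_swap : rateTwo (fun w v u => t w u v) (fun w v u => s w u v) = rateOne s t := by
  simp only [rateOne, rateTwo, Finset.sum_comm (γ := V) (α := U)]

lemma rateSum_swap : rateSum (fun w v u => t w u v) (fun w v u => s w u v) = rateSum s t := by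
  simp only [rateSum]
  rw [min_comm]
  simp only [sumRate_swap (s _) (t _)]
  simp only [Finset.sum_comm (γ := V) (α := U), add_comm (∑ u, ∑ v, t _ u v)]

end Swap

lemma swap_mem_martonRates {R : ℝ × ℝ} (hR : R ∈ martonRates bssc) :
    R.swap ∈ martonRates bssc := by
  obtain ⟨h1, h2, k, l, m, s, t, hs, ht, hst, g1, g2, g3⟩ := mem_martonRates_iff.1 hR
  refine mem_martonRates_iff.2 ⟨h2, h1, l, k, m, fun w v u => t w u v, fun w v u => s w u v,
    fun _ _ _ => ht _ _ _, fun _ _ _ => hs _ _ _, ?_, ?_, ?_, ?_⟩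
  · simp only [Finset.sum_comm (γ := Fin l) (α := Fin k)]
    rw [add_comm]; exact hst
  · rw [rateOne_swap]; exact g2
  · rw [rateTwo_swap]; exact g1
  · rw [rateSum_swap]; simpa [add_comm] using g3

lemma swap_mem_martonRegion {R : ℝ × ℝ} (hR : R ∈ martonRegion bssc) :
    R.swap ∈ martonRegion bssc :=
  map_mem_closure continuous_swap hR fun _ => swap_mem_martonRates

/-! ### Converse and achievability for the weighted sum rate -/

section Converse

variable {U V W : Type*} [Fintype U] [Fintype V] [Fintype W] {s t : W → U → V → ℝ}

/-- The chain rule I(U,W;Y) = I(W;Y) + I(U;Y|W) turns the conditional terms into α I(U;Y|W) +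
I(V;Z|W) - I(U;V|W), and the information inequality applies to each value of W. -/
lemma rateOne_add_rateSum_le {α : ℝ} (hα : 1 ≤ α) (hs : ∀ w u v, 0 ≤ s w u v)
    (ht : ∀ w u v, 0 ≤ t w u v) :
    (α - 1) * rateOne s t + rateSum s t ≤
      min (outEnt (∑ w, ∑ u, ∑ v, s w u v) (∑ w, ∑ u, ∑ v, t w u v)
          - ∑ w, outEnt (∑ u, ∑ v, s w u v) (∑ u, ∑ v, t w u v))
        (outEnt (∑ w, ∑ u, ∑ v, t w u v) (∑ w, ∑ u, ∑ v, s w u v)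
          - ∑ w, outEnt (∑ u, ∑ v, t w u v) (∑ u, ∑ v, s w u v))
      + (α - 1) * (outEnt (∑ w, ∑ u, ∑ v, s w u v) (∑ w, ∑ u, ∑ v, t w u v)
          - ∑ w, outEnt (∑ u, ∑ v, s w u v) (∑ u, ∑ v, t w u v))
      + ∑ w, max
          (α * (outEnt (∑ u, ∑ v, s w u v) (∑ u, ∑ v, t w u v) - (∑ u, ∑ v, s w u v) * log 2))
          (outEnt (∑ u, ∑ v, t w u v) (∑ u, ∑ v, s w u v) - (∑ u, ∑ v, t w u v) * log 2) := by
  have key : ∑ w, (sumRate α (s w) (t w) + negMulLog (∑ u, ∑ v, s w u v + ∑ u, ∑ v, t w u v))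
      ≤ _ := Finset.sum_le_sum fun w _ => sumRate_add_negMulLog_le hα (hs w) (ht w)
  refine le_trans (le_of_eq ?_) (add_le_add_right key _)
  simp only [rateOne, rateSum, sumRate, Finset.sum_add_distrib, Finset.sum_sub_distrib,
    ← Finset.mul_sum]
  ring

end Converse

section Achievability

variable (q : Fin 2 × Fin 2 → ℝ)

/-- Randomized time division, input `0`: masses of `(W, U, V)`. -/
def tdZero (w u v : Fin 2) : ℝ := if u = 0 ∧ v = 0 then q (w, 0) else 0

/-- Randomized time division, input `1`: masses of `(W, U, V)`. -/
def tdOne (w u v : Fin 2) : ℝ := if u ≠ w ∧ v = w then q (w, 1) else 0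

lemma rateOne_td : rateOne (tdZero q) (tdOne q)
    = infoOne q + (outEnt (q (0, 0)) (q (0, 1)) - q (0, 0) * log 2) := by
  simp [rateOne, tdZero, tdOne, Fin.sum_univ_two, infoOne]
  ring

lemma rateTwo_td : rateTwo (tdZero q) (tdOne q)
    = infoTwo q + (outEnt (q (1, 1)) (q (1, 0)) - q (1, 1) * log 2) := by
  simp [rateTwo, tdZero, tdOne, Fin.sum_univ_two, infoTwo]
  ring

lemma rateSum_td : rateSum (tdZero q) (tdOne q) = tdRate 1 q := by
  simp [rateSum, sumRate, tdZero, tdOne, Fin.sum_univ_two, tdRate, infoOne, infoTwo, privRate]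

end Achievability

lemma infoOne_nonneg {q : Fin 2 × Fin 2 → ℝ} (hq : ∀ i, 0 ≤ q i) : 0 ≤ infoOne q :=
  sub_nonneg.2 (outEnt_superadd (hq _) (hq _) (hq _) (hq _))

lemma infoTwo_nonneg {q : Fin 2 × Fin 2 → ℝ} (hq : ∀ i, 0 ≤ q i) : 0 ≤ infoTwo q :=
  sub_nonneg.2 (outEnt_superadd (hq _) (hq _) (hq _) (hq _))

/-- `I(U, W; Y)` for randomized time division. -/
def tdFirst (q : Fin 2 × Fin 2 → ℝ) : ℝ :=
  infoOne q + (outEnt (q (0, 0)) (q (0, 1)) - q (0, 0) * log 2)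

/-- The rate pair of randomized time division with the largest first rate. -/
def tdPair (q : Fin 2 × Fin 2 → ℝ) : ℝ × ℝ :=
  (min (tdRate 1 q) (tdFirst q), max (tdRate 1 q - tdFirst q) 0)

lemma continuous_tdPair : Continuous tdPair := by
  unfold tdPair tdRate tdFirst
  fun_prop

lemma tdPair_mem_of_pos {q : Fin 2 × Fin 2 → ℝ} (hq : q ∈ stdSimplex ℝ (Fin 2 × Fin 2))
    (h0 : ∀ i, 0 < q i) : tdPair q ∈ martonRegion bssc := by
  have i1 := infoOne_nonneg hq.1
  have i2 := infoTwo_nonneg hq.1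
  have g1 := mul_log_two_lt_outEnt (h0 (0, 0)) (h0 (0, 1))
  have g2 := mul_log_two_lt_outEnt (h0 (1, 1)) (h0 (1, 0))
  have hm : 0 ≤ min (infoOne q) (infoTwo q) := le_min i1 i2
  have hm1 := min_le_left (infoOne q) (infoTwo q)
  have hF : 0 < tdFirst q := by unfold tdFirst; linarith
  have hS : tdRate 1 q = min (infoOne q) (infoTwo q)
      + (outEnt (q (0, 0)) (q (0, 1)) - q (0, 0) * log 2)
      + (outEnt (q (1, 1)) (q (1, 0)) - q (1, 1) * log 2) := by
    simp only [tdRate, privRate]; ring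
  have hS0 : 0 < tdRate 1 q := by linarith
  have hR1 : (tdPair q).1 ≤ tdFirst q := min_le_right _ _
  have hR10 : 0 ≤ (tdPair q).1 := le_min hS0.le hF.le
  have hR2 : (tdPair q).2 ≤ infoTwo q + (outEnt (q (1, 1)) (q (1, 0)) - q (1, 1) * log 2) := by
    refine max_le ?_ (by linarith)
    rw [hS, tdFirst]; linarith
  have hR20 : 0 ≤ (tdPair q).2 := le_max_right _ _
  have hR : (tdPair q).1 + (tdPair q).2 = tdRate 1 q := by
    simp only [tdPair]
    rcases le_total (tdRate 1 q) (tdFirst q) with h | h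
    · rw [min_eq_left h, max_eq_right (sub_nonpos.2 h), add_zero]
    · rw [min_eq_right h, max_eq_left (sub_nonneg.2 h)]; ring
  -- All masses being positive, the three rate bounds are strictly positive, so shrinking the pair
  -- by c < 1 makes the inequalities strict.
  have hmem : ∀ c ∈ Ico (0 : ℝ) 1, c • tdPair q ∈ martonRates bssc := fun c hc => by
    have hlt : ∀ a b : ℝ, 0 ≤ a → a ≤ b → 0 < b → c * a < b := fun a b ha hab hb =>
      (mul_le_mul_of_nonneg_left hab hc.1).trans_lt (by nlinarith [hc.2])
    refine mem_martonRates_iff.2 ⟨mul_nonneg hc.1 hR10, mul_nonneg hc.1 hR20, 2, 2, 2, tdZero q,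
      tdOne q, fun w u v => ?_, fun w u v => ?_, ?_, ?_, ?_, ?_⟩
    · unfold tdZero; split_ifs; exacts [hq.1 _, le_rfl]
    · unfold tdOne; split_ifs; exacts [hq.1 _, le_rfl]
    · have := hq.2
      simp only [Fintype.sum_prod_type, Fin.sum_univ_two] at this
      simp [tdZero, tdOne, Fin.sum_univ_two]
      linarith
    · rw [rateOne_td]
      exact hlt _ _ hR10 hR1 hF
    · rw [rateTwo_td]
      exact hlt _ _ hR20 hR2 (by linarith)
    · rw [rateSum_td, Prod.smul_fst, Prod.smul_snd, smul_eq_mul, smul_eq_mul, ← mul_add, hR]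
      exact hlt _ _ hS0.le le_rfl hS0
  have hlim : Filter.Tendsto (fun c : ℝ => c • tdPair q) (nhdsWithin 1 (Ico 0 1))
      (nhds (tdPair q)) := by
    have : Continuous fun c : ℝ => c • tdPair q := by fun_prop
    simpa using (this.tendsto 1).mono_left nhdsWithin_le_nhds
  have : (nhdsWithin (1 : ℝ) (Ico 0 1)).NeBot := right_nhdsWithin_Ico_neBot zero_lt_one
  exact mem_closure_of_tendsto hlim (Filter.eventually_of_mem self_mem_nhdsWithin hmem)

/-- Mixing with the uniform law makes all masses positive; the region is closed and `tdPair` is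
continuous. -/
lemma tdPair_mem {q : Fin 2 × Fin 2 → ℝ} (hq : q ∈ stdSimplex ℝ (Fin 2 × Fin 2)) :
    tdPair q ∈ martonRegion bssc := by
  have hu : (fun _ => 1 / 4 : Fin 2 × Fin 2 → ℝ) ∈ stdSimplex ℝ (Fin 2 × Fin 2) :=
    ⟨fun _ => by norm_num, by simp⟩
  have hcont : Continuous fun c : ℝ => c • q + (1 - c) • (fun _ => 1 / 4 : Fin 2 × Fin 2 → ℝ) := by
    fun_prop
  have hlim : Filter.Tendsto
      (fun c : ℝ => tdPair (c • q + (1 - c) • (fun _ => 1 / 4 : Fin 2 × Fin 2 → ℝ)))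
      (nhdsWithin 1 (Ico 0 1)) (nhds (tdPair q)) := by
    have := (continuous_tdPair.comp hcont).tendsto 1
    simp only [Function.comp, one_smul, sub_self, zero_smul, add_zero] at this
    exact this.mono_left nhdsWithin_le_nhds
  have : (nhdsWithin (1 : ℝ) (Ico 0 1)).NeBot := right_nhdsWithin_Ico_neBot zero_lt_one
  refine isClosed_closure.mem_of_tendsto hlim
    (Filter.eventually_of_mem self_mem_nhdsWithin fun c hc => ?_)
  have hc1 : 0 < 1 - c := sub_pos.2 hc.2
  refine tdPair_mem_of_pos (convex_stdSimplex ℝ _ hq hu hc.1 hc1.le (by ring)) fun i => ?_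
  have := mul_nonneg hc.1 (hq.1 i)
  simp only [Pi.add_apply, Pi.smul_apply, smul_eq_mul]
  linarith

lemma exists_tdRate_le {α : ℝ} (hα : 1 ≤ α) {q : Fin 2 × Fin 2 → ℝ}
    (hq : q ∈ stdSimplex ℝ (Fin 2 × Fin 2)) :
    ∃ R ∈ martonRegion bssc, tdRate α q ≤ α * R.1 + R.2 := by
  have e : tdRate α q = (α - 1) * tdFirst q + tdRate 1 q := by
    simp only [tdRate, tdFirst, privRate]; ring
  rcases le_total (tdFirst q) (tdRate 1 q) with h | h
  · refine ⟨_, tdPair_mem hq, ?_⟩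
    rw [e, tdPair, min_eq_right h, max_eq_left (sub_nonneg.2 h)]
    exact le_of_eq (by ring)
  · have hsum := hq.2
    simp only [Fintype.sum_prod_type, Fin.sum_univ_two] at hsum
    -- The sum rate bound is below I(U,W;Y), so no rate is left for the second receiver. Making W
    -- constant and U = X gives R₁ = I(X;Y), at least I(U,W;Y), and R₂ = 0.
    set r : Fin 2 × Fin 2 → ℝ := fun i => if i.1 = 0 then q (0, i.2) + q (1, i.2) else 0 with hr
    have hr' : r ∈ stdSimplex ℝ (Fin 2 × Fin 2) := by
      refine ⟨fun i => ?_, ?_⟩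
      · simp only [hr]; split_ifs
        exacts [add_nonneg (hq.1 _) (hq.1 _), le_rfl]
      · simp only [Fintype.sum_prod_type, Fin.sum_univ_two]
        simp [hr]; linarith
    have e1 : tdFirst r = outEnt (q (0, 0) + q (1, 0)) (q (0, 1) + q (1, 1))
        - (q (0, 0) + q (1, 0)) * log 2 := by simp [tdFirst, infoOne, hr]
    have e2 : tdRate 1 r = tdFirst r := by
      rw [e1]; simp [tdRate, infoOne, infoTwo, privRate, hr]
    refine ⟨_, tdPair_mem hr', ?_⟩
    rw [tdPair, e2, min_self, sub_self, max_self, add_zero, e1, e]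
    refine le_trans (b := α * tdFirst q) (by linarith) (mul_le_mul_of_nonneg_left ?_ (by linarith))
    have := mul_log_two_le_outEnt (hq.1 (1, 0)) (hq.1 (1, 1))
    simp only [tdFirst, infoOne]
    linarith

theorem exists_isGreatest {α : ℝ} (hα : 1 ≤ α) :
    ∃ M : ℝ, IsGreatest ((fun R : ℝ × ℝ => α * R.1 + R.2) '' martonRegion bssc) M ∧
      IsGreatest (tdRate α '' stdSimplex ℝ (Fin 2 × Fin 2)) M := by
  obtain ⟨p, hp, hmax, hW⟩ := exists_isMax_tdRate hα
  -- A linear bound passes to the closure. Only the bounds on R₁ and on R₁ + R₂ enter, with weights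
  -- α - 1 and 1.
  have hub : ∀ R ∈ martonRegion bssc, α * R.1 + R.2 ≤ tdRate α p := by
    refine closure_minimal ?_ (isClosed_le (f := fun R : ℝ × ℝ => α * R.1 + R.2)
      (g := fun _ => tdRate α p) (by fun_prop) (by fun_prop))
    intro R hR
    obtain ⟨-, -, k, l, m, s, t, hs, ht, hst, g1, -, g3⟩ := mem_martonRates_iff.1 hR
    have h1 := rateOne_add_rateSum_le hα hs ht
    have h2 := hW (Fin m) (fun w => ∑ u, ∑ v, s w u v) (fun w => ∑ u, ∑ v, t w u v)
      (fun w => Finset.sum_nonneg fun u _ => Finset.sum_nonneg fun v _ => hs w u v)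
      (fun w => Finset.sum_nonneg fun u _ => Finset.sum_nonneg fun v _ => ht w u v) hst
    have h3 := mul_le_mul_of_nonneg_left g1.le (sub_nonneg.2 hα)
    show α * R.1 + R.2 ≤ tdRate α p
    linarith
  obtain ⟨R, hR, hle⟩ := exists_tdRate_le hα hp
  refine ⟨tdRate α p, ⟨⟨R, hR, le_antisymm (hub R hR) hle⟩, ?_⟩, ⟨⟨p, hp, rfl⟩, ?_⟩⟩
  · rintro _ ⟨R, hR, rfl⟩
    exact hub R hR
  · rintro _ ⟨q, hq, rfl⟩
    exact hmax q hq

lemma I_aux_outY_eq {q : Fin 2 × Fin 2 → ℝ} (hq : q ∈ stdSimplex ℝ (Fin 2 × Fin 2)) :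
    I (joint bssc q) aux outY = infoOne q := by
  rw [show (aux : Fin 2 × Fin 2 × Fin 2 × Fin 2 → Fin 2) = fun s => aux s from rfl,
    I_aux_outY q (fun a => a), sum_eq_one_of_mem hq]
  simp [auxMass_id, Fin.sum_univ_two, infoOne]

lemma I_aux_outZ_eq {q : Fin 2 × Fin 2 → ℝ} (hq : q ∈ stdSimplex ℝ (Fin 2 × Fin 2)) :
    I (joint bssc q) aux outZ = infoTwo q := by
  rw [show (aux : Fin 2 × Fin 2 × Fin 2 × Fin 2 → Fin 2) = fun s => aux s from rfl,
    I_aux_outZ q (fun a => a), sum_eq_one_of_mem hq]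
  simp [auxMass_id, Fin.sum_univ_two, infoTwo]

/-! ### Exchange of the inputs and the maximum of R₁ + αR₂ -/

/-- Exchange the two inputs. -/
def flip (q : Fin 2 × Fin 2 → ℝ) : Fin 2 × Fin 2 → ℝ := fun i => q (i.1, 1 - i.2)

lemma flip_flip (q : Fin 2 × Fin 2 → ℝ) : flip (flip q) = q := by
  funext i
  simp [flip]

lemma flip_mem {q : Fin 2 × Fin 2 → ℝ} (hq : q ∈ stdSimplex ℝ (Fin 2 × Fin 2)) :
    flip q ∈ stdSimplex ℝ (Fin 2 × Fin 2) := by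
  refine ⟨fun i => hq.1 _, ?_⟩
  have := hq.2
  simp only [Fintype.sum_prod_type, Fin.sum_univ_two] at this ⊢
  simp [flip]
  linarith

lemma tdRate_flip (α : ℝ) (q : Fin 2 × Fin 2 → ℝ) : tdRate α (flip q)
    = min (infoOne q) (infoTwo q) + (α - 1) * infoTwo q
      + α * (outEnt (q (0, 1)) (q (0, 0)) - q (0, 1) * log 2)
      + (outEnt (q (1, 0)) (q (1, 1)) - q (1, 0) * log 2) := by
  have e1 : infoOne (flip q) = infoTwo q := by simp [infoOne, infoTwo, flip]
  have e2 : infoTwo (flip q) = infoOne q := by simp [infoOne, infoTwo, flip]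
  rw [tdRate, e1, e2, min_comm]
  simp [privRate, flip]
  ring

end BC

end

theorem mainTheorem1 (α : ℝ) (hα : 1 ≤ α) :
    -- the inequality, and the one with the roles of `Y` and `Z` swapped
    (∀ (𝒰 𝒱 : Type*) [Fintype 𝒰] [Fintype 𝒱], ∀ p ∈ stdSimplex ℝ ((𝒰 × 𝒱) × Fin 2),
      α * BC.I (BC.joint BC.bssc p) (fun s => (BC.aux s).1) BC.outY
          + BC.I (BC.joint BC.bssc p) (fun s => (BC.aux s).2) BC.outZ
          - BC.I (BC.joint BC.bssc p) (fun s => (BC.aux s).1) (fun s => (BC.aux s).2)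
        ≤ max (α * BC.I (BC.joint BC.bssc p) BC.inX BC.outY)
            (BC.I (BC.joint BC.bssc p) BC.inX BC.outZ) ∧
      BC.I (BC.joint BC.bssc p) (fun s => (BC.aux s).1) BC.outY
          + α * BC.I (BC.joint BC.bssc p) (fun s => (BC.aux s).2) BC.outZ
          - BC.I (BC.joint BC.bssc p) (fun s => (BC.aux s).1) (fun s => (BC.aux s).2)
        ≤ max (BC.I (BC.joint BC.bssc p) BC.inX BC.outY)
            (α * BC.I (BC.joint BC.bssc p) BC.inX BC.outZ)) ∧
    -- the maximum of `α R₁ + R₂` over Marton's inner bound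
    (∃ M : ℝ,
      IsGreatest ((fun R : ℝ × ℝ => α * R.1 + R.2) '' BC.martonRegion BC.bssc) M ∧
      IsGreatest ((fun p : Fin 2 × Fin 2 → ℝ =>
          min (BC.I (BC.joint BC.bssc p) BC.aux BC.outY) (BC.I (BC.joint BC.bssc p) BC.aux BC.outZ)
            + (α - 1) * BC.I (BC.joint BC.bssc p) BC.aux BC.outY
            + α * (BC.law (BC.joint BC.bssc p) BC.aux 0
                * BC.I (BC.condOn (BC.joint BC.bssc p) BC.aux 0) BC.inX BC.outY)
            + BC.law (BC.joint BC.bssc p) BC.aux 1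
                * BC.I (BC.condOn (BC.joint BC.bssc p) BC.aux 1) BC.inX BC.outZ)
        '' stdSimplex ℝ (Fin 2 × Fin 2)) M) ∧
    -- the maximum of `R₁ + α R₂` over Marton's inner bound
    (∃ M : ℝ,
      IsGreatest ((fun R : ℝ × ℝ => R.1 + α * R.2) '' BC.martonRegion BC.bssc) M ∧
      IsGreatest ((fun p : Fin 2 × Fin 2 → ℝ =>
          min (BC.I (BC.joint BC.bssc p) BC.aux BC.outY) (BC.I (BC.joint BC.bssc p) BC.aux BC.outZ)
            + (α - 1) * BC.I (BC.joint BC.bssc p) BC.aux BC.outZ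
            + α * (BC.law (BC.joint BC.bssc p) BC.aux 0
                * BC.I (BC.condOn (BC.joint BC.bssc p) BC.aux 0) BC.inX BC.outZ)
            + BC.law (BC.joint BC.bssc p) BC.aux 1
                * BC.I (BC.condOn (BC.joint BC.bssc p) BC.aux 1) BC.inX BC.outY)
        '' stdSimplex ℝ (Fin 2 × Fin 2)) M) := by
  refine ⟨fun 𝒰 𝒱 _ _ p hp => ⟨BC.info_le_one hα hp, BC.info_le_two hα hp⟩, ?_, ?_⟩
  · obtain ⟨M, h1, h2⟩ := BC.exists_isGreatest hα
    refine ⟨M, h1, ?_⟩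
    rw [Set.image_congr (g := BC.tdRate α) fun p hp => ?_]
    · exact h2
    · rw [BC.I_aux_outY_eq hp, BC.I_aux_outZ_eq hp, BC.law_mul_I_condOn_outY hp.1,
        BC.law_mul_I_condOn_outZ hp.1, BC.tdRate, BC.privRate]
      ring
  · obtain ⟨M, h1, h2⟩ := BC.exists_isGreatest hα
    refine ⟨M, ?_, ?_⟩
    · convert h1 using 1
      ext x
      constructor
      · rintro ⟨R, hR, rfl⟩
        exact ⟨R.swap, BC.swap_mem_martonRegion hR, add_comm _ _⟩
      · rintro ⟨R, hR, rfl⟩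
        exact ⟨R.swap, BC.swap_mem_martonRegion hR, add_comm _ _⟩
    -- The objective is the earlier one after exchanging the inputs, and this exchange is an
    -- involution of the simplex, so the set of values is unchanged.
    · rw [Set.image_congr (g := fun p => BC.tdRate α (BC.flip p)) fun p hp => ?_]
      · convert h2 using 1
        ext x
        constructor
        · rintro ⟨q, hq, rfl⟩
          exact ⟨BC.flip q, BC.flip_mem hq, rfl⟩
        · rintro ⟨q, hq, rfl⟩
          exact ⟨BC.flip q, BC.flip_mem hq, by simp only [BC.flip_flip]⟩
      · rw [BC.I_aux_outY_eq hp, BC.I_aux_outZ_eq hp, BC.law_mul_I_condOn_outY hp.1,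
          BC.law_mul_I_condOn_outZ hp.1, BC.tdRate_flip]
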